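/- **Notation.** Let $s\ge 0$, let $\mathbf m=(m_1,\dots,m_s)$ be positive integers, $m=m_1+\cdots+m_s$, and $I=\{-m,\dots,-1\}\cup\{1,2,3,\dots\}$, whose negative part is divided into consecutive blocks of sizes $m_1,\dots,m_s$. Let $\mathbb Z_+^{\mathbf m+\infty}$ (resp. $\mathbb Z_+^{\mathbf m|\infty}$) be the set of $f:I\to\mathbb Z$ that are strictly decreasing on each negative block and satisfy $f(1)>f(2)>\cdots$ with $f(i)=1-i$ for $i\gg0$ (resp. $f(1)<f(2)<\cdots$ with $f(i)=i$ for $i\gg 0$). *Quantum group.* $U_q(\mathfrak{gl}_\infty)$ is the $\mathbb Q(q)$-algebra with the usual Chevalley generators $E_a,F_a,K_a^{\pm1}$ ($a\in\mathbb Z$) and relations, with bar involution the ring automorphism $q\mapsto q^{-1}$, $E_a\mapsto E_a$, $F_a\mapsto F_a$, $K_a\mapsto K_a^{-1}$, and comultiplication $\Delta(E_a)=1\otimes E_a+E_a\otimes K_{a+1}K_a^{-1}$, $\Delta(F_a)=F_a\otimes1+K_aK_{a+1}^{-1}\otimes F_a$, $\Delta(K_a)=K_a\otimes K_a$. Let $\mathcal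 U=U_q(\mathfrak{sl}_\infty)$ be the subalgebra generated by all $E_a,F_a,K_aK_{a+1}^{-1}$. Let $\mathbb V$ be the natural module with basis $v_a$ ($K_av_b=q^{\delta_{ab}}v_b$, $E_av_{a+1}=v_a$, $F_av_a=v_{a+1}$) and $\mathbb W$ its dual with basis $w_a$ ($K_aw_b=q^{-\delta_{ab}}w_b$, $E_aw_a=w_{a+1}$, $F_aw_{a+1}=w_a$), all other $E_av_b,F_av_b,E_aw_b,F_aw_b$ being zero. *Fock spaces.* The spaces $\mathcal E^{\mathbf m+\infty}=\bigotimes_{a=1}^s\Lambda^{m_a}\mathbb V\otimes\Lambda^\infty\mathbb V$ and $\mathcal E^{\mathbf m|\infty}=\bigotimes_{a=1}^s\Lambda^{m_a}\mathbb V\otimes\Lambda^\infty\mathbb W$, built from (semi-infinite) $q$-wedges, are $\mathcal U$-modules by the iterated comultiplication, with monomial bases $\mathcal K_f$ ($f\in\mathbb Z_+^{\mathbf m+\infty}$) and $K_f$ ($f\in\mathbb Z_+^{\mathbf m|\infty}$): the tensor products of the $q$-wedges of the $v_{f(i)}$ over each negative block with the $q$-wedge of the $v_{f(i)}$, resp.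 $w_{f(i)}$, over $i>0$. Their completions $\widehat{\mathcal E}^{\mathbf m+\infty}$, $\widehat{\mathcal E}^{\mathbf m|\infty}$ consist of the possibly infinite linear combinations of monomials in which, for every $n\in\mathbb N$, only finitely many monomials occur with $f(i+1)=-i$ for all $i\ge n$ (resp. with $f(i)\ge -n$ for all $i>0$); they carry the inverse limit topology given by the projections onto these monomials. *Orderings.* The Bruhat ordering $\le$ on $\mathbb Z_+^{\mathbf m+\infty}$ is induced from the partial order on functions $I\to\mathbb Z$ generated by $f\cdot\tau_{ij}<f$ for $i<j$ with $f(i)>f(j)$, where $\tau_{ij}$ is a transposition. The super Bruhat ordering $\preccurlyeq$ on $\mathbb Z_+^{\mathbf m|\infty}$ is induced from the one generated by $g\prec f$ whenever $g$ is obtained from $f$ (i) by decreasing $f(i)$ and $f(j)$ by $1$, where $i<0<j$ and $f(i)=f(j)$; (ii) as $f\cdot\tau_{ij}$, $i<j<0$, $f(i)>f(j)$; or (iii) as $f\cdot\tau_{ij}$, $0<i<j$, $f(i)<f(j)$. *Bar involutions and bases.* On each of the two completions there is a unique continuous bar map, anti-linear for $q\mapsto q^{-1}$, which fixes the monomials of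 minimal $f$, satisfies $\overline{Xu}=\overline X\,\overline u$ for $X\in\mathcal U$, is an involution, and sends the monomial of each $f$ to itself plus a possibly infinite $\mathbb Z[q,q^{-1}]$-combination of monomials of smaller $g$. There is then a unique canonical (resp. dual canonical) topological basis, indexed by the same $f$, consisting of bar-invariant elements of the form: the monomial of $f$ plus a possibly infinite combination of monomials of smaller $g$ with coefficients in $q\mathbb Z[q]$ (resp. $q^{-1}\mathbb Z[q^{-1}]$). Denote these bases and their coefficients by $\mathcal U_f=\sum_g\mathfrak u_{g,f}\mathcal K_g$, $\mathcal L_f=\sum_g\mathfrak l_{g,f}\mathcal K_g$ in $\widehat{\mathcal E}^{\mathbf m+\infty}$ (parabolic Kazhdan–Lusztig polynomials of type $A$) and $U_f=\sum_gu_{g,f}K_g$, $L_f=\sum_g\ell_{g,f}K_g$ in $\widehat{\mathcal E}^{\mathbf m|\infty}$ (Brundan–Kazhdan–Lusztig polynomials). *Labels.* For $f\in\mathbb Z_+^{\mathbf m+\infty}$ let $\lambda$ be the partition $\lambda_i=f(i)+i-1$ ($i>0$) and $\lambda'$ its conjugate; define $f^\natural\in\mathbb Z_+^{\mathbf m|\infty}$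 by $f^\natural(i)=f(i)$ for $i<0$ and $f^\natural(j)=j-\lambda'_j$ for $j>0$. **Theorem.** The map $f\mapsto f^\natural$ is a bijection $\mathbb Z_+^{\mathbf m+\infty}\to\mathbb Z_+^{\mathbf m|\infty}$, and there is an isomorphism of topological $\mathcal U$-modules $\natural:\widehat{\mathcal E}^{\mathbf m+\infty}\to\widehat{\mathcal E}^{\mathbf m|\infty}$ such that, with the bar involutions and bases above (which exist and are unique): 1. $\natural(\mathcal K_f)=K_{f^\natural}$ for all $f\in\mathbb Z_+^{\mathbf m+\infty}$; 2. $\natural(\overline u)=\overline{\natural(u)}$ for all $u\in\widehat{\mathcal E}^{\mathbf m+\infty}$; 3. $\natural(\mathcal L_f)=L_{f^\natural}$ for all $f\in\mathbb Z_+^{\mathbf m+\infty}$; 4. $\natural(\mathcal U_f)=U_{f^\natural}$ for all $f\in\mathbb Z_+^{\mathbf m+\infty}$; 5. $\mathfrak u_{g,f}(q)=u_{g^\natural,f^\natural}(q)$ and $\mathfrak l_{g,f}(q)=\ell_{g^\natural,f^\natural}(q)$ for all $f,g\in\mathbb Z_+^{\mathbf m+\infty}$. -/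

import Mathlib

noncomputable section

namespace FockDuality

/-- The ground field `ℚ(q)`. -/
abbrev Qq : Type := RatFunc ℚ

/-- The indeterminate `q`. -/
def q : Qq := RatFunc.X

theorem q_ne_zero : q ≠ 0 := RatFunc.X_ne_zero

theorem transcendental_q : Transcendental ℚ q := by
  intro h
  refine RatFunc.transcendental_X (K := ℚ) ?_
  convert h using 1
  · exact Subsingleton.elim _ _
  · rfl

theorem aeval_q_inv_injective :
    Function.Injective (Polynomial.aeval q⁻¹ : Polynomial ℚ →ₐ[ℚ] Qq) := by
  rw [← transcendental_iff_injective]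
  intro h
  exact transcendental_q (by simpa using h.inv)

/-- The field automorphism of `ℚ(q)` given by `q ↦ q⁻¹`. -/
def qBar : Qq →+* Qq :=
  RatFunc.liftRingHom (Polynomial.aeval q⁻¹ : Polynomial ℚ →ₐ[ℚ] Qq).toRingHom
    (nonZeroDivisors_le_comap_nonZeroDivisors_of_injective _ aeval_q_inv_injective)

theorem qBar_q : qBar q = q⁻¹ := by
  have h := RatFunc.liftRingHom_apply_div (Polynomial.aeval q⁻¹ : Polynomial ℚ →ₐ[ℚ] Qq).toRingHom
    (nonZeroDivisors_le_comap_nonZeroDivisors_of_injective _ aeval_q_inv_injective)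
    Polynomial.X 1
  simpa only [qBar, q, Polynomial.aeval_X, map_one, div_one, AlgHom.toRingHom_eq_coe, RingHom.coe_coe, RatFunc.algebraMap_X] using h

/-- The subring `ℤ[q, q⁻¹]` of `ℚ(q)`. -/
def laurentInt : Subring Qq := Subring.closure {q, q⁻¹}

/-- `q ℤ[q]`, as a subset of `ℚ(q)`. -/
def qZq : Set Qq := {c | ∃ p : Polynomial ℤ, c = q * Polynomial.aeval q p}

/-- `q⁻¹ ℤ[q⁻¹]`, as a subset of `ℚ(q)`. -/
def qInvZqInv : Set Qq := {c | ∃ p : Polynomial ℤ, c = q⁻¹ * Polynomial.aeval q⁻¹ p}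

/-! ### The quantum groups -/

/-- The generators `E_a, F_a, K_a, K_a⁻¹` (`a ∈ ℤ`) of `U_q(gl_∞)`. -/
inductive Gen : Type
  | E (a : ℤ)
  | F (a : ℤ)
  | K (a : ℤ)
  | Kinv (a : ℤ)

open Gen

/-- The defining relations of `U_q(gl_∞)`, written for a family `D` of elements of a
`ℚ(q)`-algebra `B`: `UqRel D x y` says that `x = y` is one of the defining relations. -/
inductive UqRel {B : Type} [Ring B] [Algebra Qq B] (D : Gen → B) : B → B → Prop
  | K_Kinv (a : ℤ) : UqRel D (D (K a) * D (Kinv a)) 1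
  | Kinv_K (a : ℤ) : UqRel D (D (Kinv a) * D (K a)) 1
  | K_K (a b : ℤ) : UqRel D (D (K a) * D (K b)) (D (K b) * D (K a))
  | K_E (a b : ℤ) : UqRel D (D (K a) * D (E b) * D (Kinv a))
      (q ^ ((if a = b then 1 else 0) - (if a = b + 1 then 1 else 0) : ℤ) • D (E b))
  | K_F (a b : ℤ) : UqRel D (D (K a) * D (F b) * D (Kinv a))
      (q ^ ((if a = b + 1 then 1 else 0) - (if a = b then 1 else 0) : ℤ) • D (F b))
  | E_F_same (a : ℤ) : UqRel D (D (E a) * D (F a) - D (F a) * D (E a))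
      ((q - q⁻¹)⁻¹ • (D (K a) * D (Kinv (a + 1)) - D (K (a + 1)) * D (Kinv a)))
  | E_F_ne (a b : ℤ) (h : a ≠ b) : UqRel D (D (E a) * D (F b) - D (F b) * D (E a)) 0
  | E_E_far (a b : ℤ) (h : 1 < |a - b|) : UqRel D (D (E a) * D (E b)) (D (E b) * D (E a))
  | F_F_far (a b : ℤ) (h : 1 < |a - b|) : UqRel D (D (F a) * D (F b)) (D (F b) * D (F a))
  | E_serre (a b : ℤ) (h : |a - b| = 1) :
      UqRel D (D (E a) * D (E a) * D (E b) + D (E b) * D (E a) * D (E a))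
        ((q + q⁻¹) • (D (E a) * D (E b) * D (E a)))
  | F_serre (a b : ℤ) (h : |a - b| = 1) :
      UqRel D (D (F a) * D (F a) * D (F b) + D (F b) * D (F a) * D (F a))
        ((q + q⁻¹) • (D (F a) * D (F b) * D (F a)))

/-- The family `D` satisfies the defining relations of `U_q(gl_∞)`. -/
def IsQuantum {B : Type} [Ring B] [Algebra Qq B] (D : Gen → B) : Prop :=
  ∀ x y, UqRel D x y → x = y

/-- The quantum group `U_q(gl_∞)`. -/
abbrev UqGl : Type := RingQuot (UqRel (FreeAlgebra.ι Qq : Gen → FreeAlgebra Qq Gen))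

/-- The generators of `U_q(gl_∞)` as elements of that algebra. -/
def UqGl.gen (x : Gen) : UqGl := RingQuot.mkAlgHom Qq _ (FreeAlgebra.ι Qq x)

theorem UqRel.map {B C : Type} [Ring B] [Algebra Qq B] [Ring C] [Algebra Qq C] (φ : B →ₐ[Qq] C)
    {D : Gen → B} {x y : B} (h : UqRel D x y) : UqRel (fun i => φ (D i)) (φ x) (φ y) := by
  cases h <;> simp only [map_mul, map_add, map_sub, map_smul, map_one, map_zero] <;>
    constructor <;> assumption

/-- The algebra homomorphism out of `U_q(gl_∞)` given by a family satisfying the relations. -/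
def UqGl.lift {B : Type} [Ring B] [Algebra Qq B] (D : Gen → B) (hD : IsQuantum D) :
    UqGl →ₐ[Qq] B :=
  RingQuot.liftAlgHom Qq ⟨FreeAlgebra.lift Qq D, fun x y h => hD _ _ (by
    have h2 := h.map (FreeAlgebra.lift Qq D)
    simpa only [FreeAlgebra.lift_ι_apply] using h2)⟩

theorem UqGl.lift_gen {B : Type} [Ring B] [Algebra Qq B] (D : Gen → B) (hD : IsQuantum D)
    (x : Gen) : UqGl.lift D hD (UqGl.gen x) = D x := by
  simp [UqGl.lift, UqGl.gen]

theorem UqGl.isQuantum_gen : IsQuantum UqGl.gen := by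
  have key : ∀ {x y : FreeAlgebra Qq Gen}, UqRel (FreeAlgebra.ι Qq) x y →
      RingQuot.mkAlgHom Qq (UqRel (FreeAlgebra.ι Qq : Gen → FreeAlgebra Qq Gen)) x =
      RingQuot.mkAlgHom Qq (UqRel (FreeAlgebra.ι Qq : Gen → FreeAlgebra Qq Gen)) y :=
    fun h => RingQuot.mkAlgHom_rel Qq h
  intro x y h
  cases h <;>
    simp only [UqGl.gen, ← map_mul, ← map_sub, ← map_add, ← map_smul, ← map_one (RingQuot.mkAlgHom Qq
      (UqRel (FreeAlgebra.ι Qq : Gen → FreeAlgebra Qq Gen))), ← map_zero (RingQuot.mkAlgHom Qq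
      (UqRel (FreeAlgebra.ι Qq : Gen → FreeAlgebra Qq Gen)))] <;>
    exact key (by constructor <;> assumption)

theorem IsQuantum.commute_K_K {B : Type} [Ring B] [Algebra Qq B] {D : Gen → B}
    (hD : IsQuantum D) (a b : ℤ) : Commute (D (K a)) (D (K b)) := hD _ _ (.K_K a b)

theorem IsQuantum.commute_K_Kinv {B : Type} [Ring B] [Algebra Qq B] {D : Gen → B}
    (hD : IsQuantum D) (a b : ℤ) : Commute (D (K a)) (D (Kinv b)) :=
  Commute.units_inv_right (u := ⟨D (K b), D (Kinv b), hD _ _ (.K_Kinv b), hD _ _ (.Kinv_K b)⟩)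
    (hD.commute_K_K a b)

theorem IsQuantum.commute_Kinv_Kinv {B : Type} [Ring B] [Algebra Qq B] {D : Gen → B}
    (hD : IsQuantum D) (a b : ℤ) : Commute (D (Kinv a)) (D (Kinv b)) :=
  Commute.units_inv_left (u := ⟨D (K a), D (Kinv a), hD _ _ (.K_Kinv a), hD _ _ (.Kinv_K a)⟩)
    (hD.commute_K_Kinv a b)

/-- `U_q(gl_∞)` with scalars acting through `q ↦ q⁻¹`. -/
def UqTwist : Type := UqGl

instance : Ring UqTwist := inferInstanceAs (Ring UqGl)

instance : Algebra Qq UqTwist where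
  algebraMap := (algebraMap Qq UqGl).comp qBar
  smul c x := HSMul.hSMul (β := UqGl) (γ := UqGl) (qBar c) x
  commutes' c x := Algebra.commutes (A := UqGl) (qBar c) x
  smul_def' c x := Algebra.smul_def (A := UqGl) (qBar c) x

/-- The images of the generators under the bar involution. -/
def barGen : Gen → UqGl
  | E a => UqGl.gen (E a)
  | F a => UqGl.gen (F a)
  | K a => UqGl.gen (Kinv a)
  | Kinv a => UqGl.gen (K a)

theorem conj_inv {B : Type} [Ring B] [Algebra Qq B] {k k' x : B} {c : Qq} (hc : c ≠ 0)
    (h1 : k' * k = 1) (h : k * x * k' = c • x) : k' * x * k = c⁻¹ • x := by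
  have h2 : k' * (k * x * k') * k = x := by
    rw [mul_assoc k x, ← mul_assoc k', h1, one_mul, mul_assoc, h1, mul_one]
  have h3 : x = c • (k' * x * k) := by
    conv_lhs => rw [← h2, h]
    simp
  conv_rhs => rw [h3]
  rw [smul_smul, inv_mul_cancel₀ hc, one_smul]

theorem smul_sub_flip {B : Type} [Ring B] [Algebra Qq B] (c : Qq) (u v : B) :
    c • (u - v) = (-c) • (v - u) := by
  rw [neg_smul, ← smul_neg, neg_sub]

theorem barGen_isQuantum : IsQuantum (B := UqTwist) barGen := by
  have key := UqGl.isQuantum_gen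
  have hz : ∀ n : ℤ, qBar (q ^ n) = (q ^ n)⁻¹ := fun n => by
    rw [map_zpow₀, qBar_q, inv_zpow]
  have h2 : qBar (q + q⁻¹) = q + q⁻¹ := by
    rw [map_add, map_inv₀, qBar_q, inv_inv, add_comm]
  intro x y h
  cases h with
  | K_Kinv a => exact key _ _ (.Kinv_K a)
  | Kinv_K a => exact key _ _ (.K_Kinv a)
  | K_K a b => exact key.commute_Kinv_Kinv a b
  | K_E a b =>
    change UqGl.gen (Kinv a) * UqGl.gen (E b) * UqGl.gen (K a) =
      qBar (q ^ ((if a = b then 1 else 0) - (if a = b + 1 then 1 else 0) : ℤ)) • UqGl.gen (E b)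
    rw [hz]
    exact conj_inv (zpow_ne_zero _ q_ne_zero) (key _ _ (.Kinv_K a)) (key _ _ (.K_E a b))
  | K_F a b =>
    change UqGl.gen (Kinv a) * UqGl.gen (F b) * UqGl.gen (K a) =
      qBar (q ^ ((if a = b + 1 then 1 else 0) - (if a = b then 1 else 0) : ℤ)) • UqGl.gen (F b)
    rw [hz]
    exact conj_inv (zpow_ne_zero _ q_ne_zero) (key _ _ (.Kinv_K a)) (key _ _ (.K_F a b))
  | E_F_same a =>
    refine (key _ _ (.E_F_same a)).trans ?_
    change _ = qBar (q - q⁻¹)⁻¹ • (UqGl.gen (Kinv a) * UqGl.gen (K (a + 1)) -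
      UqGl.gen (Kinv (a + 1)) * UqGl.gen (K a))
    rw [map_inv₀, map_sub, map_inv₀, qBar_q, inv_inv, (key.commute_K_Kinv a (a + 1)).eq,
      (key.commute_K_Kinv (a + 1) a).eq, ← neg_sub q q⁻¹, inv_neg]
    exact smul_sub_flip _ _ _
  | E_F_ne a b h => exact key _ _ (.E_F_ne a b h)
  | E_E_far a b h => exact key _ _ (.E_E_far a b h)
  | F_F_far a b h => exact key _ _ (.F_F_far a b h)
  | E_serre a b h =>
    refine (key _ _ (.E_serre a b h)).trans ?_
    change _ = qBar (q + q⁻¹) • (UqGl.gen (E a) * UqGl.gen (E b) * UqGl.gen (E a))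
    rw [h2]
  | F_serre a b h =>
    refine (key _ _ (.F_serre a b h)).trans ?_
    change _ = qBar (q + q⁻¹) • (UqGl.gen (F a) * UqGl.gen (F b) * UqGl.gen (F a))
    rw [h2]

/-- The bar involution of `U_q(gl_∞)`: the ring homomorphism, anti-linear for `q ↦ q⁻¹`, fixing
`E_a` and `F_a` and sending `K_a` to `K_a⁻¹`. -/
def barU : UqGl →+* UqGl :=
  ((UqGl.lift (B := UqTwist) barGen barGen_isQuantum : UqGl →ₐ[Qq] UqTwist) : UqGl →+* UqTwist)

theorem barU_gen (x : Gen) : barU (UqGl.gen x) = barGen x :=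
  UqGl.lift_gen (B := UqTwist) barGen barGen_isQuantum x

theorem barU_smul (c : Qq) (x : UqGl) : barU (c • x) = qBar c • barU x :=
  map_smul (UqGl.lift (B := UqTwist) barGen barGen_isQuantum) c x

/-- The subalgebra `𝒰 = U_q(sl_∞)` generated by `E_a`, `F_a` and `K_a K_{a+1}⁻¹`. -/
def UqSl : Subalgebra Qq UqGl :=
  Algebra.adjoin Qq (⋃ a : ℤ, {UqGl.gen (E a), UqGl.gen (F a),
    UqGl.gen (K a) * UqGl.gen (Kinv (a + 1))})

/-! ### Comultiplication -/

/-- The comultiplication on generators: for two families `D₁, D₂` of commuting operators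
satisfying the relations, the family by which `Δ` lets the generators act on the tensor product
(`D₁` acting on the first factor and `D₂` on the second), that is
`Δ(E_a) = 1 ⊗ E_a + E_a ⊗ K_{a+1} K_a⁻¹`, `Δ(F_a) = F_a ⊗ 1 + K_a K_{a+1}⁻¹ ⊗ F_a`,
`Δ(K_a) = K_a ⊗ K_a`. -/
def tensorFamily {B : Type} [Ring B] (D₁ D₂ : Gen → B) : Gen → B
  | E a => D₂ (E a) + D₁ (E a) * (D₂ (K (a + 1)) * D₂ (Kinv a))
  | F a => D₁ (F a) + D₁ (K a) * D₁ (Kinv (a + 1)) * D₂ (F a)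
  | K a => D₁ (K a) * D₂ (K a)
  | Kinv a => D₁ (Kinv a) * D₂ (Kinv a)

/-- The trivial family, by which the generators act through the counit. -/
def counitFamily {B : Type} [Ring B] : Gen → B
  | E _ => 0
  | F _ => 0
  | K _ => 1
  | Kinv _ => 1

theorem counitFamily_isQuantum {B : Type} [Ring B] [Algebra Qq B] :
    IsQuantum (counitFamily : Gen → B) := by
  intro x y h
  cases h <;> simp [counitFamily]

theorem serre_add {R B : Type} [Field R] [Ring B] [Algebra R B] {q : R} (hq : q ≠ 0)
    {x x' y y' : B}
    (h1 : x' * x = (q ^ (-2 : ℤ)) • (x * x')) (h2 : x' * y = q • (y * x'))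
    (h3 : y' * x = q • (x * y'))
    (hs : x * x * y + y * x * x = (q + q⁻¹) • (x * y * x))
    (hs' : x' * x' * y' + y' * x' * x' = (q + q⁻¹) • (x' * y' * x')) :
    (x + x') * (x + x') * (y + y') + (y + y') * (x + x') * (x + x') =
      (q + q⁻¹) • ((x + x') * (y + y') * (x + x')) := by
  have h1' : ∀ z, x' * (x * z) = (q ^ (-2 : ℤ)) • (x * (x' * z)) := fun z => by
    rw [← mul_assoc, h1, smul_mul_assoc, mul_assoc]
  have h2' : ∀ z, x' * (y * z) = q • (y * (x' * z)) := fun z => by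
    rw [← mul_assoc, h2, smul_mul_assoc, mul_assoc]
  have h3' : ∀ z, y' * (x * z) = q • (x * (y' * z)) := fun z => by
    rw [← mul_assoc, h3, smul_mul_assoc, mul_assoc]
  simp only [mul_assoc] at hs hs'
  simp only [mul_add, add_mul, mul_assoc, h1, h2, h3, h1', h2', h3', mul_smul_comm, smul_mul_assoc,
    smul_smul]
  rw [← eq_sub_iff_add_eq] at hs hs'
  rw [hs, hs']
  match_scalars <;> field_simp <;> ring

/-- Moving `K_c K_d⁻¹` past an element on which `K_c`, `K_d` act by powers of `q`. -/
theorem swap_of_conj {B : Type} [Ring B] [Algebra Qq B] {k k' x : B} {c : Qq}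
    (h1 : k' * k = 1) (h : k * x * k' = c • x) : k * x = c • (x * k) := by
  rw [← smul_mul_assoc, ← h, mul_assoc (k * x), h1, mul_one]

/-- The Cartan exponent: `K_a K_{a+1}⁻¹ E_b = q ^ cartan a b • E_b K_a K_{a+1}⁻¹`. -/
def cartan (a b : ℤ) : ℤ :=
  if a = b then 2 else if |a - b| = 1 then -1 else 0

theorem IsQuantum.K_E {B : Type} [Ring B] [Algebra Qq B] {D : Gen → B}
    (hD : IsQuantum D) (a b : ℤ) :
    D (K a) * D (Kinv (a + 1)) * D (E b) =
      q ^ cartan a b • (D (E b) * (D (K a) * D (Kinv (a + 1)))) := by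
  have h1 := swap_of_conj (hD _ _ (.Kinv_K a)) (hD _ _ (.K_E a b))
  have h2 := swap_of_conj (hD _ _ (.K_Kinv (a + 1)))
    (conj_inv (zpow_ne_zero _ q_ne_zero) (hD _ _ (.Kinv_K (a + 1))) (hD _ _ (.K_E (a + 1) b)))
  rw [mul_assoc, h2, mul_smul_comm, ← mul_assoc, h1, smul_mul_assoc, smul_smul, mul_assoc,
    ← zpow_neg, ← zpow_add₀ q_ne_zero]
  congr 2
  unfold cartan
  split_ifs <;> grind

theorem IsQuantum.K_F {B : Type} [Ring B] [Algebra Qq B] {D : Gen → B}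
    (hD : IsQuantum D) (a b : ℤ) :
    D (K a) * D (Kinv (a + 1)) * D (F b) =
      q ^ (-cartan a b) • (D (F b) * (D (K a) * D (Kinv (a + 1)))) := by
  have h1 := swap_of_conj (hD _ _ (.Kinv_K a)) (hD _ _ (.K_F a b))
  have h2 := swap_of_conj (hD _ _ (.K_Kinv (a + 1)))
    (conj_inv (zpow_ne_zero _ q_ne_zero) (hD _ _ (.Kinv_K (a + 1))) (hD _ _ (.K_F (a + 1) b)))
  rw [mul_assoc, h2, mul_smul_comm, ← mul_assoc, h1, smul_mul_assoc, smul_smul, mul_assoc,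
    ← zpow_neg, ← zpow_add₀ q_ne_zero]
  congr 2
  unfold cartan
  split_ifs <;> grind

theorem IsQuantum.K_E' {B : Type} [Ring B] [Algebra Qq B] {D : Gen → B}
    (hD : IsQuantum D) (a b : ℤ) :
    D (K (a + 1)) * D (Kinv a) * D (E b) =
      q ^ (-cartan a b) • (D (E b) * (D (K (a + 1)) * D (Kinv a))) := by
  have h1 := swap_of_conj (hD _ _ (.Kinv_K (a + 1))) (hD _ _ (.K_E (a + 1) b))
  have h2 := swap_of_conj (hD _ _ (.K_Kinv a))
    (conj_inv (zpow_ne_zero _ q_ne_zero) (hD _ _ (.Kinv_K a)) (hD _ _ (.K_E a b)))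
  rw [mul_assoc, h2, mul_smul_comm, ← mul_assoc, h1, smul_mul_assoc, smul_smul, mul_assoc,
    ← zpow_neg, ← zpow_add₀ q_ne_zero]
  congr 2
  unfold cartan
  split_ifs <;> grind

theorem IsQuantum.K_F' {B : Type} [Ring B] [Algebra Qq B] {D : Gen → B}
    (hD : IsQuantum D) (a b : ℤ) :
    D (K (a + 1)) * D (Kinv a) * D (F b) =
      q ^ (cartan a b) • (D (F b) * (D (K (a + 1)) * D (Kinv a))) := by
  have h1 := swap_of_conj (hD _ _ (.Kinv_K (a + 1))) (hD _ _ (.K_F (a + 1) b))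
  have h2 := swap_of_conj (hD _ _ (.K_Kinv a))
    (conj_inv (zpow_ne_zero _ q_ne_zero) (hD _ _ (.Kinv_K a)) (hD _ _ (.K_F a b)))
  rw [mul_assoc, h2, mul_smul_comm, ← mul_assoc, h1, smul_mul_assoc, smul_smul, mul_assoc,
    ← zpow_neg, ← zpow_add₀ q_ne_zero]
  congr 2
  unfold cartan
  split_ifs <;> grind

theorem cartan_comm (a b : ℤ) : cartan a b = cartan b a := by
  by_cases h : a = b
  · rw [h]
  · simp [cartan, h, Ne.symm h, abs_sub_comm]

theorem mul_pair {B : Type} [Ring B] {u₁ u₂ k₁ k₂ : B} (h : Commute k₁ u₂) :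
    (u₁ * k₁) * (u₂ * k₂) = (u₁ * u₂) * (k₁ * k₂) := by
  rw [mul_assoc, ← mul_assoc k₁, h.eq]; simp only [mul_assoc]

theorem serre_mul {B : Type} [Ring B] [Algebra Qq B] {u v k l : B} (c : Qq)
    (huk : Commute u k) (hul : Commute u l) (hvk : Commute v k) (hkl : Commute k l)
    (h : u * u * v + v * u * u = c • (u * v * u)) :
    (u * k) * (u * k) * (v * l) + (v * l) * (u * k) * (u * k) =
      c • ((u * k) * (v * l) * (u * k)) := by
  rw [mul_pair huk.symm, mul_pair (hvk.symm.mul_left hvk.symm), mul_pair hul.symm,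
    mul_pair (hul.symm.mul_left huk.symm), mul_pair hvk.symm,
    mul_pair (huk.symm.mul_left hul.symm), ← hkl.eq, mul_assoc k l k, ← hkl.eq, ← mul_assoc k k l,
    ← add_mul, h, smul_mul_assoc]

theorem tensorFamily_isQuantum {B : Type} [Ring B] [Algebra Qq B] {D₁ D₂ : Gen → B}
    (h₁ : IsQuantum D₁) (h₂ : IsQuantum D₂) (hc : ∀ i j, Commute (D₁ i) (D₂ j)) :
    IsQuantum (tensorFamily D₁ D₂) := by
  have hkk : ∀ a b, Commute (D₂ (K (a + 1)) * D₂ (Kinv a)) (D₂ (K (b + 1)) * D₂ (Kinv b)) :=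
    fun a b => ((h₂.commute_K_K _ _).mul_right (h₂.commute_K_Kinv _ _)).mul_left
      ((h₂.commute_K_Kinv _ _).symm.mul_right (h₂.commute_Kinv_Kinv _ _))
  have hll : ∀ a b, Commute (D₁ (K a) * D₁ (Kinv (a + 1))) (D₁ (K b) * D₁ (Kinv (b + 1))) :=
    fun a b => ((h₁.commute_K_K _ _).mul_right (h₁.commute_K_Kinv _ _)).mul_left
      ((h₁.commute_K_Kinv _ _).symm.mul_right (h₁.commute_Kinv_Kinv _ _))
  have hck : ∀ i a, Commute (D₁ i) (D₂ (K (a + 1)) * D₂ (Kinv a)) :=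
    fun i a => (hc _ _).mul_right (hc _ _)
  have hcl : ∀ i a, Commute (D₁ (K a) * D₁ (Kinv (a + 1))) (D₂ i) :=
    fun i a => (hc _ _).mul_left (hc _ _)
  have swE : ∀ a b, D₁ (E a) * (D₂ (K (a + 1)) * D₂ (Kinv a)) * D₂ (E b) =
      q ^ (-cartan a b) • (D₂ (E b) * (D₁ (E a) * (D₂ (K (a + 1)) * D₂ (Kinv a)))) := by
    intro a b
    rw [mul_assoc, h₂.K_E', mul_smul_comm, ← mul_assoc, (hc _ _).eq, mul_assoc]
  have swF : ∀ a b, D₁ (K a) * D₁ (Kinv (a + 1)) * D₂ (F a) * D₁ (F b) =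
      q ^ (-cartan a b) • (D₁ (F b) * (D₁ (K a) * D₁ (Kinv (a + 1)) * D₂ (F a))) := by
    intro a b
    rw [mul_assoc, ← (hc _ _).eq, ← mul_assoc, h₁.K_F, smul_mul_assoc, mul_assoc]
  have cross : ∀ a b, D₁ (E a) * (D₂ (K (a + 1)) * D₂ (Kinv a)) *
      (D₁ (K b) * D₁ (Kinv (b + 1)) * D₂ (F b)) =
      D₁ (K b) * D₁ (Kinv (b + 1)) * D₂ (F b) *
      (D₁ (E a) * (D₂ (K (a + 1)) * D₂ (Kinv a))) := by
    intro a b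
    rw [mul_pair ((hck _ _).symm.mul_right (hck _ _).symm), h₂.K_F',
      mul_pair (hc _ _).symm, h₁.K_E, cartan_comm b a, mul_smul_comm, smul_mul_assoc]
  have c1 : ∀ a b, |a - b| = 1 → q ^ (-cartan a b) = q := by
    intro a b h
    have : a ≠ b := by rintro rfl; simp at h
    simp [cartan, h, this]
  have c0 : ∀ a b, 1 < |a - b| → q ^ (-cartan a b) = 1 := by
    intro a b h
    have h1 : a ≠ b := by rintro rfl; simp at h
    have h2 : ¬ |a - b| = 1 := by omega
    simp [cartan, h1, h2]
  have c2 : ∀ a, -cartan a a = -2 := by intro a; simp [cartan]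
  intro x y h
  cases h with
  | K_Kinv a =>
    simp only [tensorFamily]
    rw [mul_pair (hc _ _).symm, h₁ _ _ (.K_Kinv a), h₂ _ _ (.K_Kinv a), one_mul]
  | Kinv_K a =>
    simp only [tensorFamily]
    rw [mul_pair (hc _ _).symm, h₁ _ _ (.Kinv_K a), h₂ _ _ (.Kinv_K a), one_mul]
  | K_K a b =>
    simp only [tensorFamily]
    rw [mul_pair (hc _ _).symm, mul_pair (hc _ _).symm, h₁ _ _ (.K_K a b), h₂ _ _ (.K_K a b)]
  | K_E a b =>
    have e1 := h₁ _ _ (.K_E a b)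
    have e2 := h₂ _ _ (.K_E a b)
    simp only [tensorFamily]
    rw [mul_add, add_mul, smul_add]
    congr 1
    · have : D₁ (K a) * D₂ (K a) * D₂ (E b) * (D₁ (Kinv a) * D₂ (Kinv a)) =
          (D₁ (K a) * D₁ (Kinv a)) * (D₂ (K a) * D₂ (E b) * D₂ (Kinv a)) := by
        rw [mul_assoc (D₁ (K a)), mul_pair ((hc _ _).symm.mul_left (hc _ _).symm)]
      rw [this, h₁ _ _ (.K_Kinv a), e2, one_mul]
    · rw [mul_pair (hc _ _).symm, mul_pair ((hc _ _).symm.mul_left (hck _ _).symm), e1,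
        smul_mul_assoc, ((h₂.commute_K_K _ _).mul_right (h₂.commute_K_Kinv _ _)).eq,
        mul_assoc _ (D₂ (K a)), h₂ _ _ (.K_Kinv a), mul_one]
  | K_F a b =>
    have e1 := h₁ _ _ (.K_F a b)
    have e2 := h₂ _ _ (.K_F a b)
    simp only [tensorFamily]
    rw [mul_add, add_mul, smul_add]
    congr 1
    · have : D₁ (K a) * D₂ (K a) * D₁ (F b) * (D₁ (Kinv a) * D₂ (Kinv a)) =
          (D₁ (K a) * D₁ (F b) * D₁ (Kinv a)) * (D₂ (K a) * D₂ (Kinv a)) := by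
        rw [mul_assoc (D₁ (K a)), ← (hc (F b) (K a)).eq, ← mul_assoc (D₁ (K a)),
          mul_pair (hc _ _).symm]
      rw [this, h₂ _ _ (.K_Kinv a), e1, mul_one]
    · rw [mul_pair (hcl _ _).symm, mul_pair ((hc _ _).symm.mul_left (hc _ _).symm), e2,
        mul_smul_comm, ((h₁.commute_K_K _ _).mul_right (h₁.commute_K_Kinv _ _)).eq,
        mul_assoc _ (D₁ (K a)), h₁ _ _ (.K_Kinv a), mul_one]
  | E_F_same a =>
    have e1 := h₁ _ _ (.E_F_same a)
    have e2 := h₂ _ _ (.E_F_same a)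
    have e3 : ∀ b c, D₁ (K b) * D₂ (K b) * (D₁ (Kinv c) * D₂ (Kinv c)) =
      (D₁ (K b) * D₁ (Kinv c)) * (D₂ (K b) * D₂ (Kinv c)) := fun b c => mul_pair (hc _ _).symm
    simp only [tensorFamily]
    rw [e3, e3]
    have : ∀ x X y Y : B, X * Y = Y * X → x * y = y * x →
        (x + X) * (y + Y) - (y + Y) * (x + X) = (x * Y - Y * x) + (X * y - y * X) := by
      intro x X y Y h1 h2
      simp only [add_mul, mul_add, h1, h2]
      abel
    rw [this _ _ _ _ (cross a a) (hc _ _).symm.eq]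
    have f1 : D₂ (E a) * (D₁ (K a) * D₁ (Kinv (a + 1)) * D₂ (F a)) -
        D₁ (K a) * D₁ (Kinv (a + 1)) * D₂ (F a) * D₂ (E a) =
        D₁ (K a) * D₁ (Kinv (a + 1)) * (D₂ (E a) * D₂ (F a) - D₂ (F a) * D₂ (E a)) := by
      rw [← mul_assoc, ← (hcl _ _).eq, mul_sub]; simp only [mul_assoc]
    have f2 : D₁ (E a) * (D₂ (K (a + 1)) * D₂ (Kinv a)) * D₁ (F a) -
        D₁ (F a) * (D₁ (E a) * (D₂ (K (a + 1)) * D₂ (Kinv a))) =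
        (D₁ (E a) * D₁ (F a) - D₁ (F a) * D₁ (E a)) * (D₂ (K (a + 1)) * D₂ (Kinv a)) := by
      rw [mul_assoc, ← (hck _ _).eq, sub_mul]; simp only [mul_assoc]
    rw [f1, f2, e1, e2, mul_smul_comm, smul_mul_assoc, ← smul_add, mul_sub, sub_mul]
    congr 1
    abel
  | E_F_ne a b h =>
    have e1 := h₁ _ _ (.E_F_ne a b h)
    have e2 := h₂ _ _ (.E_F_ne a b h)
    simp only [tensorFamily]
    have f1 : D₂ (E a) * (D₁ (K b) * D₁ (Kinv (b + 1)) * D₂ (F b)) =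
        D₁ (K b) * D₁ (Kinv (b + 1)) * D₂ (F b) * D₂ (E a) := by
      rw [← mul_assoc, ← (hcl _ _).eq, mul_assoc, sub_eq_zero.mp e2]; simp only [mul_assoc]
    have f2 : D₁ (E a) * (D₂ (K (a + 1)) * D₂ (Kinv a)) * D₁ (F b) =
        D₁ (F b) * (D₁ (E a) * (D₂ (K (a + 1)) * D₂ (Kinv a))) := by
      rw [mul_assoc, ← (hck _ _).eq, ← mul_assoc, sub_eq_zero.mp e1]; simp only [mul_assoc]
    simp only [add_mul, mul_add]
    rw [cross a b, f1, f2, (hc _ _).symm.eq]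
    abel
  | E_E_far a b h =>
    have h' : 1 < |b - a| := by rwa [abs_sub_comm]
    have e1 := h₁ _ _ (.E_E_far a b h)
    have e2 := h₂ _ _ (.E_E_far a b h)
    simp only [tensorFamily]
    simp only [add_mul, mul_add]
    rw [swE a b, swE b a, c0 a b h, c0 b a h', one_smul, one_smul, e2,
      mul_pair (hck _ _).symm, mul_pair (hck _ _).symm, e1, (hkk a b).eq]
    abel
  | F_F_far a b h =>
    have h' : 1 < |b - a| := by rwa [abs_sub_comm]
    have e1 := h₁ _ _ (.F_F_far a b h)
    have e2 := h₂ _ _ (.F_F_far a b h)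
    simp only [tensorFamily]
    simp only [add_mul, mul_add]
    rw [swF a b, swF b a, c0 a b h, c0 b a h', one_smul, one_smul, e1,
      mul_pair (hcl _ _).symm, mul_pair (hcl _ _).symm, e2, (hll a b).eq]
    abel
  | E_serre a b h =>
    have h' : |b - a| = 1 := by rwa [abs_sub_comm]
    simp only [tensorFamily]
    refine serre_add q_ne_zero ?_ ?_ ?_ (h₂ _ _ (.E_serre a b h)) ?_
    · rw [swE, c2]
    · rw [swE, c1 a b h]
    · rw [swE, c1 b a h']
    · exact serre_mul _ (hck _ _) (hck _ _) (hck _ _) (hkk a b) (h₁ _ _ (.E_serre a b h))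
  | F_serre a b h =>
    have h' : |b - a| = 1 := by rwa [abs_sub_comm]
    simp only [tensorFamily]
    refine serre_add q_ne_zero ?_ ?_ ?_ (h₁ _ _ (.F_serre a b h)) ?_
    · rw [swF, c2]
    · rw [swF, c1 a b h]
    · rw [swF, c1 b a h']
    · rw [(hcl (F a) a).eq, (hcl (F b) b).eq]
      exact serre_mul _ (hcl _ _).symm (hcl _ _).symm (hcl _ _).symm (hll a b)
        (h₂ _ _ (.F_serre a b h))


/-! ### The index sets -/

/-- The index set `I(m|∞) = {-m, …, -1} ∪ {1, 2, …}`, where `m = m_1 + ⋯ + m_s`: the negative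
positions are listed block by block (`inl ⟨t, k⟩` is the `k`-th position of the `t`-th block,
i.e. `-m + m_1 + ⋯ + m_{t-1} + k` counting `t` from `1` and `k` from `0`), and `inr j` is the
positive position `j + 1`. -/
abbrev Idx {s : ℕ} (m : Fin s → ℕ) : Type := (Σ t : Fin s, Fin (m t)) ⊕ ℕ

/-- The number (from `0` to `s`) of the block containing a position. -/
def block {s : ℕ} {m : Fin s → ℕ} : Idx m → ℕ
  | .inl p => p.1
  | .inr _ => s

/-- The order of the positions: `Before i j` means `i < j` in `I(m|∞)`. -/
def Before {s : ℕ} {m : Fin s → ℕ} : Idx m → Idx m → Prop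
  | .inl p, .inl r => p.1 < r.1 ∨ (p.1 = r.1 ∧ (p.2 : ℕ) < r.2)
  | .inl _, .inr _ => True
  | .inr _, .inl _ => False
  | .inr i, .inr j => i < j

/-- `ord` for the Fock space `ℰ^{m+∞}`, `sup` for the Fock space `ℰ^{m|∞}`. -/
inductive Kind : Type
  | ord
  | sup

/-- The sets `ℤ_+^{m+∞}` (for `ord`) and `ℤ_+^{m|∞}` (for `sup`). -/
def IsLabel {s : ℕ} {m : Fin s → ℕ} (κ : Kind) (f : Idx m → ℤ) : Prop :=
  (∀ t, StrictAnti fun k : Fin (m t) => f (.inl ⟨t, k⟩)) ∧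
  match κ with
  | .ord => (StrictAnti fun j : ℕ => f (.inr j)) ∧ ∃ N : ℕ, ∀ j : ℕ, N ≤ j → f (.inr j) = -(j : ℤ)
  | .sup => (StrictMono fun j : ℕ => f (.inr j)) ∧ ∃ N : ℕ, ∀ j : ℕ, N ≤ j → f (.inr j) = j + 1

/-- The elements of `ℤ_+^{m+∞}` or `ℤ_+^{m|∞}`. -/
abbrev Label {s : ℕ} (κ : Kind) (m : Fin s → ℕ) : Type := {f : Idx m → ℤ // IsLabel κ f}

/-- The value `a` occurs in the block `t` of `f`. -/
def Occ {s : ℕ} {m : Fin s → ℕ} (t : ℕ) (a : ℤ) (f : Idx m → ℤ) : Prop :=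
  ∃ i, block i = t ∧ f i = a

/-- Replace the value `a` by the value `b` in the block `t` of `f`. -/
def repl {s : ℕ} {m : Fin s → ℕ} (t : ℕ) (a b : ℤ) (f : Idx m → ℤ) : Idx m → ℤ :=
  fun i => if block i = t ∧ f i = a then b else f i

theorem IsLabel.inj {s : ℕ} {m : Fin s → ℕ} {κ : Kind} {f : Idx m → ℤ} (hf : IsLabel κ f)
    {i j : Idx m} (hb : block i = block j) (h : f i = f j) : i = j := by
  obtain ⟨h1, h2⟩ := hf
  rcases i with ⟨t, k⟩ | i <;> rcases j with ⟨t', k'⟩ | j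
  · have : t = t' := Fin.ext hb
    subst this
    rw [(h1 t).injective h]
  · exact absurd hb (ne_of_lt t.2)
  · exact absurd hb.symm (ne_of_lt t'.2)
  · congr 1
    cases κ
    · exact h2.1.injective h
    · exact h2.1.injective h

theorem repl_repl {s : ℕ} {m : Fin s → ℕ} {κ : Kind} {t : ℕ} {a b : ℤ} {f : Idx m → ℤ}
    (ho : Occ t b f) (h : IsLabel κ (repl t b a f)) : repl t a b (repl t b a f) = f := by
  obtain ⟨i, hi, hib⟩ := ho
  funext j
  by_cases hj : block j = t
  · by_cases hjb : f j = b
    · simp [repl, hj, hjb]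
    · by_cases hja : f j = a
      · exfalso
        apply hjb
        have : i = j := h.inj (hi.trans hj.symm) (by simp [repl, hi, hib, hja])
        rw [← this, hib]
      · simp [repl, hja, hjb]
  · simp [repl, hj]

theorem isLabel_repl_iff {s : ℕ} {m : Fin s → ℕ} {κ : Kind} {t : ℕ} {a b : ℤ} {f : Idx m → ℤ}
    (hab : |a - b| = 1) (hf : IsLabel κ f) (ho : Occ t b f) :
    IsLabel κ (repl t b a f) ↔ ¬ Occ t a f := by
  constructor
  · rintro h ⟨j, hj, hja⟩
    obtain ⟨i, hi, hib⟩ := ho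
    have : i = j := h.inj (hi.trans hj.symm) (by simp [repl, hi, hib, hja])
    subst this
    rw [← hib, ← hja] at hab
    simp at hab
  · intro ha
    have ha' : ∀ i, block i = t → f i ≠ a := fun i hi h => ha ⟨i, hi, h⟩
    have hab' : a - b = 1 ∨ a - b = -1 := by grind
    obtain ⟨h1, h2⟩ := hf
    refine ⟨fun t' k k' hk => ?_, ?_⟩
    · have e1 := h1 t' hk
      have e2 := ha' (.inl ⟨t', k⟩)
      have e3 := ha' (.inl ⟨t', k'⟩)
      simp only [repl, block] at e1 e2 e3 ⊢
      grind
    · cases κ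
      · obtain ⟨h3, N, hN⟩ := h2
        refine ⟨fun k k' hk => ?_, N + b.natAbs + 1, fun j hj => ?_⟩
        · have e1 := h3 hk
          have e2 := ha' (.inr k)
          have e3 := ha' (.inr k')
          simp only [repl, block] at e1 e2 e3 ⊢
          grind
        · have := hN j (by omega)
          simp only [repl]
          rw [if_neg, this]
          rintro ⟨-, h⟩
          omega
      · obtain ⟨h3, N, hN⟩ := h2
        refine ⟨fun k k' hk => ?_, N + b.natAbs + 1, fun j hj => ?_⟩
        · have e1 := h3 hk
          have e2 := ha' (.inr k)
          have e3 := ha' (.inr k')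
          simp only [repl, block] at e1 e2 e3 ⊢
          grind
        · have := hN j (by omega)
          simp only [repl]
          rw [if_neg, this]
          rintro ⟨-, h⟩
          omega

/-! ### The completed Fock spaces -/

/-- For `ord`: the condition `f(i+1) = -i` for all `i ≥ n`, under which the truncation map
`Tr_{∞,n}` does not kill the monomial of `f`. For `sup`: the condition `f(i) ≥ -n` for all
`i > 0`, under which the monomial of `f` lies in `ℰ^{m|∞}_{≥ -n}`. -/
def Level {s : ℕ} {m : Fin s → ℕ} (κ : Kind) (n : ℕ) (f : Idx m → ℤ) : Prop :=
  match κ with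
  | .ord => ∀ j : ℕ, n ≤ j → f (.inr j) = -(j : ℤ)
  | .sup => ∀ j : ℕ, -(n : ℤ) ≤ f (.inr j)

/-- The completed Fock spaces `ℰ̂^{m+∞}` (for `ord`) and `ℰ̂^{m|∞}` (for `sup`). An element is a
possibly infinite linear combination `∑ c(f) K_f` of monomials, given by its coefficients `c`,
such that for every `n` only finitely many monomials of level `n` occur. -/
def fockSpace {s : ℕ} (κ : Kind) (m : Fin s → ℕ) : Submodule Qq (Label κ m → Qq) where
  carrier := {c | ∀ n, {f | c f ≠ 0 ∧ Level κ n f.1}.Finite}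
  zero_mem' n := by simp
  add_mem' {c d} hc hd n := by
    refine ((hc n).union (hd n)).subset ?_
    rintro f ⟨h1, h2⟩
    by_cases h : c f = 0
    · exact Or.inr ⟨fun h' => h1 (by simp [h, h']), h2⟩
    · exact Or.inl ⟨h, h2⟩
  smul_mem' r c hc n := by
    refine (hc n).subset ?_
    rintro f ⟨h1, h2⟩
    exact ⟨fun h => h1 (by simp [h]), h2⟩

/-- The monomial `𝒦_f` or `K_f`. -/
def monomial {s : ℕ} {κ : Kind} {m : Fin s → ℕ} (f : Label κ m) : fockSpace κ m := by
  classical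
  exact ⟨Pi.single f 1, fun n => (Set.finite_singleton f).subset fun g hg => by
    by_contra h
    exact hg.1 (Pi.single_eq_of_ne h _)⟩

open Classical in
/-- The operator moving an entry `a` of the block `t` to `b`, where `|a - b| = 1`: a monomial with
entry `a` in block `t` goes to the monomial with that entry replaced by `b`; it goes to `0` if `a`
does not occur in block `t`, or if `b` occurs already (a `q`-wedge with two equal neighbouring
entries is `0`). -/
def hop {s : ℕ} (κ : Kind) (m : Fin s → ℕ) (t : ℕ) (a b : ℤ) :
    Module.End Qq (fockSpace κ m) where
  toFun c := ⟨fun g => if h : Occ t b g.1 ∧ IsLabel κ (repl t b a g.1) then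
      c.1 ⟨repl t b a g.1, h.2⟩ else 0, fun n => by
    refine Set.Finite.of_finite_image (f := fun g : Label κ m => repl t b a g.1)
      (((c.2 (n + a.natAbs + b.natAbs + 1)).image Subtype.val).subset ?_) ?_
    · rintro _ ⟨g, ⟨h1, h2⟩, rfl⟩
      rw [dite_ne_right_iff] at h1
      obtain ⟨h, h1⟩ := h1
      refine ⟨_, ⟨h1, ?_⟩, rfl⟩
      cases κ
      · intro j hj
        have := h2 j (by omega)
        simp only [repl]
        rw [if_neg, this]
        rintro ⟨-, h⟩
        omega
      · intro j
        have := h2 j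
        simp only [repl]
        split_ifs <;> omega
    · rintro g ⟨h1, h2⟩ g' ⟨h1', h2'⟩ he
      rw [dite_ne_right_iff] at h1 h1'
      obtain ⟨h, -⟩ := h1
      obtain ⟨h', -⟩ := h1'
      apply Subtype.ext
      rw [← repl_repl h.1 h.2, ← repl_repl h'.1 h'.2]
      exact congrArg _ he⟩
  map_add' c d := by
    apply Subtype.ext
    funext g
    by_cases h : Occ t b g.1 ∧ IsLabel κ (repl t b a g.1) <;> simp [h]
  map_smul' r c := by
    apply Subtype.ext
    funext g
    by_cases h : Occ t b g.1 ∧ IsLabel κ (repl t b a g.1) <;> simp [h]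

/-- The operator multiplying every monomial `K_f` by `w f`. -/
def diag {s : ℕ} {κ : Kind} {m : Fin s → ℕ} (w : Label κ m → Qq) :
    Module.End Qq (fockSpace κ m) where
  toFun c := ⟨fun g => w g * c.1 g, fun n => (c.2 n).subset fun f ⟨h1, h2⟩ =>
    ⟨fun h => h1 (mul_eq_zero_of_right _ h), h2⟩⟩
  map_add' c d := Subtype.ext (funext fun g => mul_add _ _ _)
  map_smul' r c := Subtype.ext (funext fun g => mul_left_comm _ _ _)

open Classical in
/-- The action of the generators on the factor `Λ^k 𝕍` or `Λ^∞ 𝕍` in block `t`: as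
`E_a v_{a+1} = v_a`, `F_a v_a = v_{a+1}` and `K_a v_b = q^{δ_{ab}} v_b`, on a `q`-wedge with
decreasing entries the comultiplication makes `E_a` replace the entry `a+1` by `a`, `F_a` replace
`a` by `a+1` (the extra factors `K` act by `1` wherever the result is not `0`), and `K_a` multiply
by `q` if the entry `a` occurs. -/
def vFamily {s : ℕ} (κ : Kind) (m : Fin s → ℕ) (t : ℕ) : Gen → Module.End Qq (fockSpace κ m)
  | E a => hop κ m t (a + 1) a
  | F a => hop κ m t a (a + 1)
  | K a => diag fun f => if Occ t a f.1 then q else 1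
  | Kinv a => diag fun f => if Occ t a f.1 then q⁻¹ else 1

open Classical in
/-- The action of the generators on the factor `Λ^∞ 𝕎` in block `t`: as `E_a w_a = w_{a+1}`,
`F_a w_{a+1} = w_a` and `K_a w_b = q^{-δ_{ab}} w_b`, on a `q`-wedge with increasing entries `E_a`
replaces the entry `a` by `a+1`, `F_a` replaces `a+1` by `a`, and `K_a` multiplies by `q⁻¹` if the
entry `a` occurs. -/
def wFamily {s : ℕ} (κ : Kind) (m : Fin s → ℕ) (t : ℕ) : Gen → Module.End Qq (fockSpace κ m)
  | E a => hop κ m t a (a + 1)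
  | F a => hop κ m t (a + 1) a
  | K a => diag fun f => if Occ t a f.1 then q⁻¹ else 1
  | Kinv a => diag fun f => if Occ t a f.1 then q else 1

/-- The action of the generators on the tensor factor in block `t`. -/
def blockFamily {s : ℕ} (κ : Kind) (m : Fin s → ℕ) (t : ℕ) : Gen → Module.End Qq (fockSpace κ m) :=
  match κ with
  | .ord => vFamily .ord m t
  | .sup => if t = s then wFamily .sup m t else vFamily .sup m t

/-- The action of the generators, by the iterated comultiplication, on the tensor product of the
first `k` factors of the Fock space. -/
def fockFamily {s : ℕ} (κ : Kind) (m : Fin s → ℕ) : ℕ → Gen → Module.End Qq (fockSpace κ m)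
  | 0 => counitFamily
  | k + 1 => tensorFamily (fockFamily κ m k) (blockFamily κ m k)

/-! ### The relations -/

theorem hop_apply {s : ℕ} {κ : Kind} {m : Fin s → ℕ} {t : ℕ} {a b : ℤ} (hab : |a - b| = 1)
    (c : fockSpace κ m) (g g' : Label κ m) (ho : Occ t b g.1) (ha : ¬ Occ t a g.1)
    (hg : g'.1 = repl t b a g.1) : (hop κ m t a b c).1 g = c.1 g' := by
  have h : Occ t b g.1 ∧ IsLabel κ (repl t b a g.1) :=
    ⟨ho, (isLabel_repl_iff hab g.2 ho).mpr ha⟩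
  have : g' = ⟨repl t b a g.1, h.2⟩ := Subtype.ext hg
  subst this
  exact dif_pos h

theorem hop_apply_zero {s : ℕ} {κ : Kind} {m : Fin s → ℕ} {t : ℕ} {a b : ℤ} (hab : |a - b| = 1)
    (c : fockSpace κ m) (g : Label κ m) (h : Occ t b g.1 → Occ t a g.1) :
    (hop κ m t a b c).1 g = 0 := by
  refine dif_neg ?_
  rintro ⟨h1, h2⟩
  exact (isLabel_repl_iff hab g.2 h1).mp h2 (h h1)

theorem occ_repl {s : ℕ} {m : Fin s → ℕ} {t t' : ℕ} {a b x : ℤ} {f : Idx m → ℤ}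
    (ho : Occ t b f) (hab : |a - b| = 1) : Occ t' x (repl t b a f) ↔
      (t' = t ∧ x = a) ∨ (Occ t' x f ∧ ¬ (t' = t ∧ x = b)) := by
  have hne : a ≠ b := by rintro rfl; simp at hab
  constructor
  · rintro ⟨i, hi, hx⟩
    by_cases h : block i = t ∧ f i = b
    · simp only [repl, h, and_self, if_true] at hx
      exact Or.inl ⟨hi.symm.trans h.1, hx.symm⟩
    · simp only [repl, h, if_false] at hx
      exact Or.inr ⟨⟨i, hi, hx⟩, fun h' => h ⟨hi.trans h'.1, hx.trans h'.2⟩⟩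
  · rintro (⟨rfl, rfl⟩ | ⟨⟨i, hi, hx⟩, h⟩)
    · obtain ⟨i, hi, hb⟩ := ho
      exact ⟨i, hi, by simp [repl, hi, hb]⟩
    · refine ⟨i, hi, ?_⟩
      simp only [repl]
      rw [if_neg, hx]
      rintro ⟨h1, h2⟩
      exact h ⟨hi.symm.trans h1, hx.symm.trans h2⟩

/-- The matrix coefficients of a hop, by cases. -/
theorem hop_cases {s : ℕ} {κ : Kind} {m : Fin s → ℕ} {t : ℕ} {a b : ℤ} (hab : |a - b| = 1)
    (g : Label κ m) :
    (∃ g' : Label κ m, g'.1 = repl t b a g.1 ∧ Occ t b g.1 ∧ ¬ Occ t a g.1 ∧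
      ∀ c, (hop κ m t a b c).1 g = c.1 g') ∨
    ((Occ t b g.1 → Occ t a g.1) ∧ ∀ c, (hop κ m t a b c).1 g = 0) := by
  by_cases h : Occ t b g.1 → Occ t a g.1
  · exact Or.inr ⟨h, fun c => hop_apply_zero hab c g h⟩
  · push Not at h
    exact Or.inl ⟨⟨_, (isLabel_repl_iff hab g.2 h.1).mpr h.2⟩, rfl, h.1, h.2,
      fun c => hop_apply hab c g _ h.1 h.2 rfl⟩

theorem end_ext {s : ℕ} {κ : Kind} {m : Fin s → ℕ} {X Y : Module.End Qq (fockSpace κ m)}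
    (h : ∀ c g, (X c).1 g = (Y c).1 g) : X = Y :=
  LinearMap.ext fun c => Subtype.ext (funext (h c))

theorem hop_comm {s : ℕ} {κ : Kind} {m : Fin s → ℕ} {t t' : ℕ} {a b a' b' : ℤ}
    (hab : |a - b| = 1) (hab' : |a' - b'| = 1)
    (h : t = t' → a ≠ a' ∧ a ≠ b' ∧ b ≠ a' ∧ b ≠ b') :
    Commute (hop κ m t a b) (hop κ m t' a' b') := by
  refine end_ext fun c g => ?_
  simp only [Module.End.mul_apply]
  rcases hop_cases (κ := κ) (m := m) (t := t) hab g with ⟨g1, e1, o1, n1, h1⟩ | ⟨n1, h1⟩ <;>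
  rcases hop_cases (κ := κ) (m := m) (t := t') hab' g with ⟨g2, e2, o2, n2, h2⟩ | ⟨n2, h2⟩ <;>
  simp only [h1, h2]
  · rcases hop_cases (κ := κ) (m := m) (t := t') hab' g1 with ⟨g3, e3, o3, n3, h3⟩ | ⟨n3, h3⟩ <;>
    rcases hop_cases (κ := κ) (m := m) (t := t) hab g2 with ⟨g4, e4, o4, n4, h4⟩ | ⟨n4, h4⟩ <;>
    simp only [h3, h4]
    · refine congrArg c.1 (Subtype.ext ?_)
      rw [e3, e4, e1, e2]
      funext i
      simp only [repl]
      grind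
    · exfalso
      rw [e2, occ_repl o2 hab', occ_repl o2 hab'] at n4
      grind
    · exfalso
      rw [e1, occ_repl o1 hab, occ_repl o1 hab] at n3
      grind
  · rcases hop_cases (κ := κ) (m := m) (t := t') hab' g1 with ⟨g3, e3, o3, n3, h3⟩ | ⟨n3, h3⟩ <;>
    simp only [h3]
    exfalso
    rw [e1, occ_repl o1 hab] at o3 n3
    grind
  · rcases hop_cases (κ := κ) (m := m) (t := t) hab g2 with ⟨g3, e3, o3, n3, h3⟩ | ⟨n3, h3⟩ <;>
    simp only [h3]
    exfalso
    rw [e2, occ_repl o2 hab'] at o3 n3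
    grind

/-- Two consecutive hops within one block, where the second cannot follow the first. -/
theorem hop_mul_eq_zero {s : ℕ} {κ : Kind} {m : Fin s → ℕ} {t : ℕ} {a b a' b' : ℤ}
    (hab : |a - b| = 1) (hab' : |a' - b'| = 1) (h : a = a' ∨ b = b') :
    hop κ m t a b * hop κ m t a' b' = 0 := by
  refine end_ext fun c g => ?_
  simp only [Module.End.mul_apply]
  rcases hop_cases (κ := κ) (m := m) (t := t) hab g with ⟨g1, e1, o1, n1, h1⟩ | ⟨n1, h1⟩ <;>
  simp only [h1]
  · rcases hop_cases (κ := κ) (m := m) (t := t) hab' g1 with ⟨g3, e3, o3, n3, h3⟩ | ⟨n3, h3⟩ <;>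
    simp only [h3]
    · exfalso
      rw [e1, occ_repl o1 hab] at o3 n3
      grind
    · rfl
  · rfl

theorem hop_mul_mul_eq_zero {s : ℕ} {κ : Kind} {m : Fin s → ℕ} {t : ℕ} {a b a' b' : ℤ}
    (hab : |a - b| = 1) (hab' : |a' - b'| = 1) (h : a = b' ∨ b = a')
    (h' : ¬ (a = b' ∧ b = a')) :
    hop κ m t a b * hop κ m t a' b' * hop κ m t a b = 0 := by
  refine end_ext fun c g => ?_
  simp only [Module.End.mul_apply]
  rcases hop_cases (κ := κ) (m := m) (t := t) hab g with ⟨g1, e1, o1, n1, h1⟩ | ⟨n1, h1⟩ <;>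
  simp only [h1]
  · rcases hop_cases (κ := κ) (m := m) (t := t) hab' g1 with ⟨g3, e3, o3, n3, h3⟩ | ⟨n3, h3⟩ <;>
    simp only [h3]
    · rcases hop_cases (κ := κ) (m := m) (t := t) hab g3 with ⟨g4, e4, o4, n4, h4⟩ | ⟨n4, h4⟩ <;>
      simp only [h4]
      · exfalso
        rw [e3, occ_repl o3 hab', e1, occ_repl o1 hab] at o4 n4
        rw [e1, occ_repl o1 hab] at o3 n3
        grind
      · rfl
    · rfl
  · rfl

theorem hop_mul_hop_back {s : ℕ} {κ : Kind} {m : Fin s → ℕ} {t : ℕ} {a b : ℤ}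
    (hab : |a - b| = 1) (c : fockSpace κ m) (g : Label κ m) (hb : Occ t b g.1)
    (ha : ¬ Occ t a g.1) : ((hop κ m t a b * hop κ m t b a) c).1 g = c.1 g := by
  have hba : |b - a| = 1 := by rwa [abs_sub_comm]
  have hl := (isLabel_repl_iff hab g.2 hb).mpr ha
  rw [Module.End.mul_apply, hop_apply hab _ g ⟨_, hl⟩ hb ha rfl]
  refine hop_apply hba c _ g ?_ ?_ (repl_repl hb hl).symm
  · exact (occ_repl hb hab).mpr (Or.inl ⟨rfl, rfl⟩)
  · change ¬ Occ t b (repl t b a g.1)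
    rw [occ_repl hb hab]
    have hne : b ≠ a := by rintro rfl; simp at hab
    simp [hne]

theorem hop_mul_hop_back_zero {s : ℕ} {κ : Kind} {m : Fin s → ℕ} {t : ℕ} {a b : ℤ}
    (hab : |a - b| = 1) (c : fockSpace κ m) (g : Label κ m) (h : Occ t b g.1 → Occ t a g.1) :
    ((hop κ m t a b * hop κ m t b a) c).1 g = 0 := by
  rw [Module.End.mul_apply, hop_apply_zero hab _ g h]

theorem diag_mul_hop {s : ℕ} {κ : Kind} {m : Fin s → ℕ} {t : ℕ} {a b : ℤ}
    (hab : |a - b| = 1) (w w' : Label κ m → Qq) (r : Qq)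
    (h : ∀ g g' : Label κ m, g'.1 = repl t b a g.1 → Occ t b g.1 → ¬ Occ t a g.1 →
      w g * w' g' = r) :
    diag w * hop κ m t a b * diag w' = r • hop κ m t a b := by
  refine end_ext fun c g => ?_
  change w g * (hop κ m t a b (diag w' c)).1 g = r * (hop κ m t a b c).1 g
  rcases hop_cases (κ := κ) (m := m) (t := t) hab g with ⟨g1, e1, o1, n1, h1⟩ | ⟨n1, h1⟩
  · rw [h1, h1, ← h g g1 e1 o1 n1]
    exact (mul_assoc _ _ _).symm
  · rw [h1, h1, mul_zero, mul_zero]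

theorem diag_mul_diag {s : ℕ} {κ : Kind} {m : Fin s → ℕ} (w w' : Label κ m → Qq) :
    diag w * diag w' = diag fun f => w f * w' f :=
  end_ext fun _ _ => (mul_assoc _ _ _).symm

theorem diag_one {s : ℕ} {κ : Kind} {m : Fin s → ℕ} :
    diag (fun _ : Label κ m => (1 : Qq)) = 1 :=
  end_ext fun _ _ => one_mul _

theorem diag_hop_comm {s : ℕ} {κ : Kind} {m : Fin s → ℕ} {t : ℕ} {a b : ℤ}
    (hab : |a - b| = 1) (w : Label κ m → Qq)
    (h : ∀ g g' : Label κ m, g'.1 = repl t b a g.1 → Occ t b g.1 → w g = w g') :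
    Commute (diag w) (hop κ m t a b) := by
  refine end_ext fun c g => ?_
  change w g * (hop κ m t a b c).1 g = (hop κ m t a b (diag w c)).1 g
  rcases hop_cases (κ := κ) (m := m) (t := t) hab g with ⟨g1, e1, o1, n1, h1⟩ | ⟨n1, h1⟩
  · rw [h1, h1, h g g1 e1 o1]
    rfl
  · rw [h1, h1, mul_zero]

theorem abs_succ_sub (a : ℤ) : |a + 1 - a| = 1 := by simp

theorem abs_sub_succ (a : ℤ) : |a - (a + 1)| = 1 := by simp

theorem q_sub_inv_ne_zero : q - q⁻¹ ≠ 0 := by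
  intro h
  have h1 : q * q = 1 := by
    have := sub_eq_zero.mp h
    nth_rewrite 2 [this]
    exact mul_inv_cancel₀ q_ne_zero
  have h2 := transcendental_q
  rw [transcendental_iff] at h2
  refine Polynomial.X_pow_sub_C_ne_zero (R := ℚ) two_pos 1 (h2 _ ?_)
  rw [map_sub, map_pow, Polynomial.aeval_X, pow_two, h1, map_one, map_one, sub_self]

theorem vFamily_isQuantum {s : ℕ} (κ : Kind) (m : Fin s → ℕ) (t : ℕ) :
    IsQuantum (vFamily κ m t) := by
  have hq := q_ne_zero
  intro x y h
  cases h with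
  | K_Kinv a =>
    simp only [vFamily, diag_mul_diag, ← diag_one]
    congr 1; funext f; split_ifs <;> simp [hq]
  | Kinv_K a =>
    simp only [vFamily, diag_mul_diag, ← diag_one]
    congr 1; funext f; split_ifs <;> simp [hq]
  | K_K a b =>
    simp only [vFamily, diag_mul_diag]
    congr 1; funext f; exact mul_comm _ _
  | K_E a b =>
    refine diag_mul_hop (abs_succ_sub b) _ _ _ fun g g' e o n => ?_
    rw [e, occ_repl o (abs_succ_sub b)]
    by_cases h1 : a = b
    · subst h1; simp [o]
    · by_cases h2 : a = b + 1
      · subst h2; simp [n]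
      · by_cases h3 : Occ t a g.1 <;> simp [h1, h2, h3, hq]
  | K_F a b =>
    refine diag_mul_hop (abs_sub_succ b) _ _ _ fun g g' e o n => ?_
    rw [e, occ_repl o (abs_sub_succ b)]
    by_cases h1 : a = b
    · subst h1; simp [n]
    · by_cases h2 : a = b + 1
      · subst h2; simp [o]
      · by_cases h3 : Occ t a g.1 <;> simp [h1, h2, h3, hq]
  | E_F_same a =>
    have hq2 := q_sub_inv_ne_zero
    refine end_ext fun c g => ?_
    change ((hop κ m t (a + 1) a * hop κ m t a (a + 1)) c).1 g -
      ((hop κ m t a (a + 1) * hop κ m t (a + 1) a) c).1 g = _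
    simp only [vFamily, diag_mul_diag]
    change _ = (q - q⁻¹)⁻¹ * (_ * c.1 g - _ * c.1 g)
    by_cases h1 : Occ t a g.1 <;> by_cases h2 : Occ t (a + 1) g.1
    · rw [hop_mul_hop_back_zero (abs_succ_sub a) _ _ (fun _ => h2),
        hop_mul_hop_back_zero (abs_sub_succ a) _ _ (fun _ => h1)]
      simp [h1, h2, hq]
    · rw [hop_mul_hop_back (abs_succ_sub a) _ _ h1 h2,
        hop_mul_hop_back_zero (abs_sub_succ a) _ _ (fun _ => h1)]
      simp only [h1, h2, if_true, if_false, mul_one, one_mul, sub_zero, ← sub_mul]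
      rw [← mul_assoc, inv_mul_cancel₀ hq2, one_mul]
    · rw [hop_mul_hop_back_zero (abs_succ_sub a) _ _ (fun _ => h2),
        hop_mul_hop_back (abs_sub_succ a) _ _ h2 h1]
      simp only [h1, h2, if_true, if_false, mul_one, one_mul, zero_sub, ← sub_mul]
      rw [← mul_assoc, ← neg_sub q q⁻¹, mul_neg, inv_mul_cancel₀ hq2, neg_mul, one_mul]
    · rw [hop_mul_hop_back_zero (abs_succ_sub a) _ _ (fun h => absurd h h1),
        hop_mul_hop_back_zero (abs_sub_succ a) _ _ (fun h => absurd h h2)]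
      simp [h1, h2]
  | E_F_ne a b h =>
    simp only [vFamily]
    by_cases h1 : a = b + 1
    · subst h1
      rw [hop_mul_eq_zero (abs_succ_sub _) (abs_sub_succ _) (by grind),
        hop_mul_eq_zero (abs_sub_succ _) (abs_succ_sub _) (by grind)]
      exact sub_self _
    · by_cases h2 : b = a + 1
      · subst h2
        rw [hop_mul_eq_zero (abs_succ_sub _) (abs_sub_succ _) (by grind),
          hop_mul_eq_zero (abs_sub_succ _) (abs_succ_sub _) (by grind)]
        exact sub_self _
      · rw [(hop_comm (abs_succ_sub a) (abs_sub_succ b) (by grind)).eq]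
        exact sub_self _
  | E_E_far a b h => exact hop_comm (abs_succ_sub a) (abs_succ_sub b) (by grind)
  | F_F_far a b h => exact hop_comm (abs_sub_succ a) (abs_sub_succ b) (by grind)
  | E_serre a b h =>
    simp only [vFamily]
    rw [mul_assoc (hop κ m t (b + 1) b), hop_mul_eq_zero (abs_succ_sub _) (abs_succ_sub _) (by simp),
      hop_mul_mul_eq_zero (abs_succ_sub _) (abs_succ_sub _) (by grind) (by grind)]
    simp
  | F_serre a b h =>
    simp only [vFamily]
    rw [mul_assoc (hop κ m t b (b + 1)), hop_mul_eq_zero (abs_sub_succ _) (abs_sub_succ _) (by simp),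
      hop_mul_mul_eq_zero (abs_sub_succ _) (abs_sub_succ _) (by grind) (by grind)]
    simp

/-- Exchanging `E` with `F` and `K` with its inverse. -/
def flip {B : Type} (D : Gen → B) : Gen → B
  | E a => D (F a)
  | F a => D (E a)
  | K a => D (Kinv a)
  | Kinv a => D (K a)

theorem flip_isQuantum {B : Type} [Ring B] [Algebra Qq B] {D : Gen → B} (h : IsQuantum D) :
    IsQuantum (flip D) := by
  intro x y hxy
  cases hxy with
  | K_Kinv a => exact h _ _ (.Kinv_K a)
  | Kinv_K a => exact h _ _ (.K_Kinv a)
  | K_K a b => exact h.commute_Kinv_Kinv a b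
  | K_E a b =>
    refine (conj_inv (zpow_ne_zero _ q_ne_zero) (h _ _ (.Kinv_K a)) (h _ _ (.K_F a b))).trans ?_
    rw [← zpow_neg, neg_sub]
    rfl
  | K_F a b =>
    refine (conj_inv (zpow_ne_zero _ q_ne_zero) (h _ _ (.Kinv_K a)) (h _ _ (.K_E a b))).trans ?_
    rw [← zpow_neg, neg_sub]
    rfl
  | E_F_same a =>
    have e := h _ _ (.E_F_same a)
    simp only [flip]
    rw [← (h.commute_K_Kinv (a + 1) a).eq, ← (h.commute_K_Kinv a (a + 1)).eq,
      ← neg_sub (D (K a) * _), smul_neg, ← e, neg_sub]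
  | E_F_ne a b hab =>
    have e := h _ _ (.E_F_ne b a hab.symm)
    simp only [flip]
    rw [← neg_sub, e, neg_zero]
  | E_E_far a b hab => exact h _ _ (.F_F_far a b hab)
  | F_F_far a b hab => exact h _ _ (.E_E_far a b hab)
  | E_serre a b hab => exact h _ _ (.F_serre a b hab)
  | F_serre a b hab => exact h _ _ (.E_serre a b hab)

theorem wFamily_eq_flip {s : ℕ} (κ : Kind) (m : Fin s → ℕ) (t : ℕ) :
    wFamily κ m t = flip (vFamily κ m t) := by
  funext x
  cases x <;> rfl

theorem blockFamily_isQuantum {s : ℕ} (κ : Kind) (m : Fin s → ℕ) (t : ℕ) :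
    IsQuantum (blockFamily κ m t) := by
  unfold blockFamily
  cases κ
  · exact vFamily_isQuantum _ m t
  · by_cases h : t = s
    · simp only [h, if_true, wFamily_eq_flip]
      exact flip_isQuantum (vFamily_isQuantum _ m s)
    · simp only [h, if_false]
      exact vFamily_isQuantum _ m t

open Classical in
theorem vFamily_comm {s : ℕ} (κ : Kind) (m : Fin s → ℕ) {t t' : ℕ} (h : t ≠ t') (x y : Gen) :
    Commute (vFamily κ m t x) (vFamily κ m t' y) := by
  have hd : ∀ w w' : Label κ m → Qq, Commute (diag w) (diag w') := fun w w' => by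
    refine (diag_mul_diag w w').trans (Eq.trans ?_ (diag_mul_diag w' w).symm)
    congr 1
    funext f
    exact mul_comm _ _
  have hdh : ∀ {t t' : ℕ}, t ≠ t' → ∀ (a b c : ℤ) (u : Qq) (_ : |a - b| = 1),
      Commute (diag fun f : Label κ m => if Occ t' c f.1 then u else 1) (hop κ m t a b) := by
    intro t t' h a b c u hab
    refine diag_hop_comm hab _ fun g g' e o => ?_
    rw [e, occ_repl o hab]
    simp [h.symm]
  cases x <;> cases y <;> first
    | exact hd _ _
    | exact hop_comm (by simp) (by simp) (fun h' => absurd h' h)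
    | exact hdh h.symm _ _ _ _ (by simp)
    | exact (hdh h _ _ _ _ (by simp)).symm

theorem flip_comm {B : Type} [Ring B] {D : Gen → B} {b : B} (h : ∀ x, Commute (D x) b) (x : Gen) :
    Commute (flip D x) b := by
  cases x <;> exact h _

theorem blockFamily_comm {s : ℕ} (κ : Kind) (m : Fin s → ℕ) {t t' : ℕ} (h : t ≠ t') (x y : Gen) :
    Commute (blockFamily κ m t x) (blockFamily κ m t' y) := by
  unfold blockFamily
  cases κ
  · exact vFamily_comm _ m h x y
  · by_cases h1 : t = s <;> by_cases h2 : t' = s <;>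
      simp only [h1, h2, if_true, if_false, wFamily_eq_flip]
    · exact absurd (h1.trans h2.symm) h
    · exact flip_comm (D := vFamily .sup m s) (b := vFamily .sup m t' y)
        (fun x => vFamily_comm _ m (h1 ▸ h) x y) x
    · exact (flip_comm (D := vFamily .sup m s) (b := vFamily .sup m t x)
        (fun y => (vFamily_comm _ m (h2 ▸ h) x y).symm) y).symm
    · exact vFamily_comm _ m h x y

theorem fockFamily_comm {s : ℕ} (κ : Kind) (m : Fin s → ℕ) (k t : ℕ) (h : k ≤ t) (x y : Gen) :
    Commute (fockFamily κ m k x) (blockFamily κ m t y) := by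
  induction k generalizing x with
  | zero =>
    cases x
    · exact Commute.zero_left _
    · exact Commute.zero_left _
    · exact Commute.one_left _
    · exact Commute.one_left _
  | succ k ih =>
    have h1 : ∀ x, Commute (fockFamily κ m k x) (blockFamily κ m t y) := ih (by omega)
    have h2 : ∀ x, Commute (blockFamily κ m k x) (blockFamily κ m t y) :=
      fun x => blockFamily_comm κ m (by omega) x y
    cases x
    · exact (h2 _).add_left ((h1 _).mul_left ((h2 _).mul_left (h2 _)))
    · exact (h1 _).add_left (((h1 _).mul_left (h1 _)).mul_left (h2 _))
    · exact (h1 _).mul_left (h2 _)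
    · exact (h1 _).mul_left (h2 _)

theorem fockFamily_isQuantum {s : ℕ} (κ : Kind) (m : Fin s → ℕ) (k : ℕ) :
    IsQuantum (fockFamily κ m k) := by
  induction k with
  | zero => exact counitFamily_isQuantum
  | succ k ih =>
    exact tensorFamily_isQuantum ih (blockFamily_isQuantum κ m k)
      (fun x y => fockFamily_comm κ m k k le_rfl x y)

/-- The action of the quantum group on the completed Fock space, by the iterated
comultiplication over all its `s + 1` factors. -/
def fockRep {s : ℕ} (κ : Kind) (m : Fin s → ℕ) : UqGl →ₐ[Qq] Module.End Qq (fockSpace κ m) :=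
  UqGl.lift (fockFamily κ m (s + 1)) (fockFamily_isQuantum κ m (s + 1))

/-! ### Topology and Bruhat orderings -/

open Classical in
/-- The projection of an element of the completion onto its monomials of level `n`: for `ord` the
truncation map `Tr_{∞,n}`, for `sup` the projection onto `ℰ^{m|∞}_{≥ -n}`. -/
def trunc {s : ℕ} {κ : Kind} {m : Fin s → ℕ} (n : ℕ) (u : fockSpace κ m) : Label κ m → Qq :=
  fun f => if Level κ n f.1 then u.1 f else 0

/-- The topology of the completions: the coarsest one for which all the projections `trunc n`
are continuous when their targets are discrete (the inverse limit topology). -/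
instance fockTopology {s : ℕ} (κ : Kind) (m : Fin s → ℕ) : TopologicalSpace (fockSpace κ m) :=
  ⨅ n : ℕ, TopologicalSpace.induced (trunc n) ⊥

/-- The elementary steps generating the Bruhat ordering on `ℤ^{m+∞}`: `g = f · τ_{ij}` for some
`i < j` with `f(i) > f(j)`. -/
def BruhatStep {s : ℕ} {m : Fin s → ℕ} (f g : Idx m → ℤ) : Prop :=
  ∃ i j, Before i j ∧ f j < f i ∧ g = f ∘ Equiv.swap i j

/-- The function `d_i`, which takes the value `-sgn(i)` at `i` and `0` elsewhere. -/
def dFun {s : ℕ} {m : Fin s → ℕ} : Idx m → Idx m → ℤ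
  | .inl p => Pi.single (.inl p) 1
  | .inr j => Pi.single (.inr j) (-1)

/-- The relation `f ↓ g` generating the super Bruhat ordering on `ℤ^{m|∞}`. -/
def SuperStep {s : ℕ} {m : Fin s → ℕ} (f g : Idx m → ℤ) : Prop :=
  (∃ p j, f (.inl p) = f (.inr j) ∧ g = f - dFun (.inl p) + dFun (.inr j)) ∨
  (∃ p r, Before (.inl p : Idx m) (.inl r) ∧ f (.inl r) < f (.inl p) ∧
    g = f ∘ Equiv.swap (.inl p) (.inl r)) ∨
  (∃ i j, i < j ∧ f (.inr i) < f (.inr j) ∧ g = f ∘ Equiv.swap (.inr i) (.inr j))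

/-- The Bruhat ordering `g ≤ f` (for `ord`) on `ℤ_+^{m+∞}` and the super Bruhat ordering `g ≼ f`
(for `sup`) on `ℤ_+^{m|∞}`, induced from all integer-valued functions. -/
def Below {s : ℕ} {κ : Kind} {m : Fin s → ℕ} (g f : Label κ m) : Prop :=
  match κ with
  | .ord => Relation.ReflTransGen BruhatStep f.1 g.1
  | .sup => Relation.ReflTransGen SuperStep f.1 g.1

/-- `f` is minimal in the (super) Bruhat ordering. -/
def IsMinimalLabel {s : ℕ} {κ : Kind} {m : Fin s → ℕ} (f : Label κ m) : Prop :=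
  ∀ g : Label κ m, Below g f → g = f

/-! ### Bar involutions and canonical bases -/

/-- `ψ` is a bar involution: a continuous anti-linear map of the completed Fock space fixing the
monomials of minimal labels, compatible with the bar involution of `𝒰`, of order two, and
unitriangular over `ℤ[q, q⁻¹]` on monomials. -/
structure IsBarInvolution {s : ℕ} {κ : Kind} {m : Fin s → ℕ}
    (ψ : fockSpace κ m →ₛₗ[qBar] fockSpace κ m) : Prop where
  continuous : Continuous ψ
  minimal : ∀ f : Label κ m, IsMinimalLabel f → ψ (monomial f) = monomial f
  equivariant : ∀ X ∈ UqSl, ∀ u, ψ (fockRep κ m X u) = fockRep κ m (barU X) (ψ u)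
  involutive : ∀ u, ψ (ψ u) = u
  triangular : ∀ f g : Label κ m, (ψ (monomial f) - monomial f).1 g ∈ laurentInt ∧
    ((ψ (monomial f) - monomial f).1 g ≠ 0 → Below g f ∧ g ≠ f)

/-- `B` is a topological basis of the completed Fock space consisting of elements fixed by the bar
involution `ψ`, with `B_f - K_f` a (possibly infinite) linear combination of monomials `K_g` with
coefficients in `P`, and also a `ℤ[q, q⁻¹]`-linear combination of `K_g`'s with `g` smaller than
`f`. The canonical basis is the case `P = q ℤ[q]`, the dual canonical basis the case
`P = q⁻¹ ℤ[q⁻¹]`. -/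
structure IsCanonicalBasis {s : ℕ} {κ : Kind} {m : Fin s → ℕ}
    (ψ : fockSpace κ m →ₛₗ[qBar] fockSpace κ m) (P : Set Qq)
    (B : Label κ m → fockSpace κ m) : Prop where
  basis : ∀ u, ∃! a : Label κ m → Qq, HasSum (fun f => a f • B f) u
  bar : ∀ f, ψ (B f) = B f
  coeff : ∀ f g, (B f - monomial f).1 g ∈ P
  triangular : ∀ f g, (B f - monomial f).1 g ∈ laurentInt ∧
    ((B f - monomial f).1 g ≠ 0 → Below g f ∧ g ≠ f)

/-- The coefficient of the monomial of `g` in `B_f`. For the canonical and the dual canonical basis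
these are the polynomials `𝔲_{g,f}(q)`, `𝔩_{g,f}(q)` (for `ord`: the parabolic Kazhdan–Lusztig
polynomials) and `u_{g,f}(q)`, `ℓ_{g,f}(q)` (for `sup`: the Brundan–Kazhdan–Lusztig
polynomials). -/
def klPoly {s : ℕ} {κ : Kind} {m : Fin s → ℕ} (B : Label κ m → fockSpace κ m) (g f : Label κ m) :
    Qq :=
  (B f).1 g

/-! ### The bijection of labels -/

/-- The function `f^♮` for `f ∈ ℤ_+^{m+∞}`: it agrees with `f` on the negative positions, and its
value at `j > 0` is `j - λ'_j`, where `λ'` is the conjugate of the partition `λ` with parts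
`λ_i = f(i) + i - 1`, `i > 0`, that is `λ'_j = #{i > 0 : λ_i ≥ j}`. -/
def naturalFun {s : ℕ} {m : Fin s → ℕ} (f : Idx m → ℤ) : Idx m → ℤ
  | .inl p => f (.inl p)
  | .inr j => (j : ℤ) + 1 - ({k : ℕ | (j : ℤ) + 1 ≤ f (.inr k) + k}.ncard : ℤ)

theorem isLabel_naturalFun {s : ℕ} {m : Fin s → ℕ} {f : Idx m → ℤ} (hf : IsLabel .ord f) :
    IsLabel .sup (naturalFun f) := by
  obtain ⟨h1, h2, N, hN⟩ := hf
  refine ⟨h1, ?_, ?_⟩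
  · refine strictMono_nat_of_lt_succ fun j => ?_
    have hfin : {k : ℕ | (j : ℤ) + 1 ≤ f (.inr k) + k}.Finite := by
      refine (Set.finite_lt_nat N).subset fun k hk => ?_
      by_contra h
      have e := hN k (not_lt.mp h)
      rw [Set.mem_ofPred_eq, e] at hk
      omega
    have hle : {k : ℕ | ((j + 1 : ℕ) : ℤ) + 1 ≤ f (.inr k) + k}.ncard ≤
        {k : ℕ | (j : ℤ) + 1 ≤ f (.inr k) + k}.ncard := by
      refine Set.ncard_le_ncard (fun k hk => ?_) hfin
      simp only [Set.mem_ofPred_eq] at hk ⊢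
      push_cast at hk
      omega
    simp only [naturalFun]
    push_cast at hle ⊢
    omega
  · have hbound : ∀ k : ℕ, f (.inr k) + k ≤ f (.inr 0) := by
      intro k
      induction k with
      | zero => simp
      | succ k ih =>
        have : f (.inr (k + 1)) < f (.inr k) := h2 (Nat.lt_succ_self k)
        push_cast
        omega
    refine ⟨(f (.inr 0)).natAbs, fun j hj => ?_⟩
    have he : {k : ℕ | (j : ℤ) + 1 ≤ f (.inr k) + k} = ∅ := by
      ext k
      have := hbound k
      simp only [Set.mem_ofPred_eq, Set.mem_empty_iff_false, iff_false]
      omega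
    simp only [naturalFun, he, Set.ncard_empty]
    simp

/-- The map `♮ : ℤ_+^{m+∞} → ℤ_+^{m|∞}`, `f ↦ f^♮`. -/
def naturalLabel {s : ℕ} {m : Fin s → ℕ} (f : Label .ord m) : Label .sup m :=
  ⟨naturalFun f.1, isLabel_naturalFun f.2⟩

end FockDuality

end

/-! ### Laurent polynomials in `q` and the decomposition into positive, constant and negative part.
-/

noncomputable section
namespace FockDuality

/-! A semi-infinite wedge of the `v_a` with set of entries A corresponds to the wedge of the `w_a`
with a outside A: the numbers j - λ'_j enumerate this complement (`mem_range_compl_iff`). When an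
entry moves from a+1 to a, the gap at a moves to a+1, so E_a and F_a act alike on both sides. The
eigenvalues of K_a differ by the factor q, which cancels in K_a K_{a+1}⁻¹. Relabelling coefficients
(`fockEquiv`) is therefore 𝒰-linear (`fockEquiv_fockRep`). It is a homeomorphism because the levels
on both sides agree up to a shift by one (`level_natural_iff`).

The bar map and the bases are built on the type A side and transported. For this, triangularity must
hold for both orderings at once (`BothBelow`), while uniqueness must use only what either ordering
implies, namely `DLe`: equal weight and termwise comparison of counting functions. A label has
finitely many labels above it for `DLe`, and finitely many of a given level below it. So every
coefficient is a finite sum, and induction from larger to smaller labels is available.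

Existence of the bar map: conjugate the coefficients by q ↦ q⁻¹ and rescale the monomials
(`revMap`). This carries the action to the barred action on the tensor product in the opposite
order. Then return by a composite of two-block intertwiners (`revIntertwiner`). The coefficients of
a two-block intertwiner are explicit products over the integers x, called columns (`pairMat`). The
relation for E_a or F_a involves only the columns a and a+1 and becomes a finite check (`wgt₂_E`,
`wgt₂_F`). A nonzero coefficient exchanges entries of the earlier block with smaller entries of the
later one, and this goes down in both orderings (`bothBelow_of_exch`).

Uniqueness: every label is the leading term of an element of the 𝒰-module generated by the monomial
of a seed, and seeds are minimal (`reached`, `IsSeed.eq_of_dle`). Hence a unitriangular 𝒰-linear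
operator fixing the seeds is the identity (`eq_id_of_equivariant`). Applied to composites of two bar
maps, this gives involutivity and uniqueness together. The canonical and dual canonical bases then
follow from Lusztig's recursion (`klCoeff_spec`), run once for any half `P` of the Laurent
polynomials (`IsHalf`). -/

theorem qBar_qBar (z : Qq) : qBar (qBar z) = z := by
  have : (qBar.comp qBar : Qq →+* Qq) = RingHom.id _ := by
    refine IsFractionRing.ringHom_ext (A := Polynomial ℚ) fun p => ?_
    have h : ((qBar.comp qBar : Qq →+* Qq).comp (algebraMap (Polynomial ℚ) Qq)) =
        (RingHom.id Qq).comp (algebraMap (Polynomial ℚ) Qq) := by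
      refine Polynomial.ringHom_ext' (Subsingleton.elim _ _) ?_
      have : algebraMap (Polynomial ℚ) Qq Polynomial.X = q := RatFunc.algebraMap_X
      simp [this, qBar_q]
    exact congrArg (fun φ : Polynomial ℚ →+* Qq => φ p) h
  exact congrArg (fun φ : Qq →+* Qq => φ z) this

theorem qBar_q_zpow (n : ℤ) : qBar (q ^ n) = q ^ (-n) := by
  rw [map_zpow₀, qBar_q, inv_zpow, zpow_neg]

theorem q_mem_laurentInt : q ∈ laurentInt := Subring.subset_closure (by simp)

theorem q_inv_mem_laurentInt : q⁻¹ ∈ laurentInt := Subring.subset_closure (by simp)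

theorem q_zpow_mem_laurentInt (n : ℤ) : q ^ n ∈ laurentInt := by
  obtain ⟨n, rfl | rfl⟩ := n.eq_nat_or_neg
  · rw [zpow_natCast]; exact pow_mem q_mem_laurentInt n
  · rw [zpow_neg, zpow_natCast, ← inv_pow]; exact pow_mem q_inv_mem_laurentInt n

theorem qBar_mem_laurentInt {z : Qq} (hz : z ∈ laurentInt) : qBar z ∈ laurentInt := by
  have h : laurentInt ≤ laurentInt.comap qBar := by
    refine Subring.closure_le.mpr ?_
    rintro x (rfl | rfl)
    · change qBar q ∈ laurentInt
      rw [qBar_q]; exact q_inv_mem_laurentInt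
    · change qBar q⁻¹ ∈ laurentInt
      rw [map_inv₀, qBar_q, inv_inv]; exact q_mem_laurentInt
  exact h hz

theorem aeval_mem_laurentInt {x : Qq} (hx : x ∈ laurentInt) (p : Polynomial ℤ) :
    Polynomial.aeval x p ∈ laurentInt := by
  rw [Polynomial.aeval_eq_sum_range]
  refine sum_mem fun i _ => ?_
  rw [Algebra.smul_def, eq_intCast]
  exact mul_mem (intCast_mem _ _) (pow_mem hx i)

theorem qBar_aeval (x : Qq) (p : Polynomial ℤ) :
    qBar (Polynomial.aeval x p) = Polynomial.aeval (qBar x) p := by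
  have := Polynomial.map_aeval_eq_aeval_map (R := ℤ) (S := Qq) (T := ℤ) (U := Qq)
    (φ := RingHom.id ℤ) (ψ := qBar) (RingHom.ext_int _ _) p x
  simpa using this

theorem qZq_subset_laurentInt {z : Qq} (hz : z ∈ qZq) : z ∈ laurentInt := by
  obtain ⟨p, rfl⟩ := hz
  exact mul_mem q_mem_laurentInt (aeval_mem_laurentInt q_mem_laurentInt p)

theorem qBar_mem_qInvZqInv {z : Qq} (hz : z ∈ qZq) : qBar z ∈ qInvZqInv := by
  obtain ⟨p, rfl⟩ := hz
  exact ⟨p, by rw [map_mul, qBar_q, qBar_aeval, qBar_q]⟩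

theorem qBar_mem_qZq {z : Qq} (hz : z ∈ qInvZqInv) : qBar z ∈ qZq := by
  obtain ⟨p, rfl⟩ := hz
  exact ⟨p, by rw [map_mul, map_inv₀, qBar_q, inv_inv, qBar_aeval, map_inv₀, qBar_q, inv_inv]⟩

theorem qZq_add {x y : Qq} (hx : x ∈ qZq) (hy : y ∈ qZq) : x + y ∈ qZq := by
  obtain ⟨p, rfl⟩ := hx
  obtain ⟨r, rfl⟩ := hy
  exact ⟨p + r, by rw [map_add]; ring⟩

theorem qZq_neg {x : Qq} (hx : x ∈ qZq) : -x ∈ qZq := by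
  obtain ⟨p, rfl⟩ := hx
  exact ⟨-p, by rw [map_neg]; ring⟩

theorem qZq_zero : (0 : Qq) ∈ qZq := ⟨0, by simp⟩

theorem aeval_q_int_injective : Function.Injective (Polynomial.aeval q : Polynomial ℤ →ₐ[ℤ] Qq) := by
  have h := transcendental_q
  rw [transcendental_iff_injective] at h
  intro a b hab
  have e : ∀ p : Polynomial ℤ, Polynomial.aeval q (p.map (Int.castRingHom ℚ)) =
      Polynomial.aeval q p := fun p => by
    rw [Polynomial.aeval_def, Polynomial.aeval_def, Polynomial.eval₂_map]
    congr 1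
    exact RingHom.ext_int _ _
  refine Polynomial.map_injective _ (RingHom.injective_int (Int.castRingHom ℚ)) (h ?_)
  rw [e, e, hab]

/-- The summands of `ℤ[q,q⁻¹] = qℤ[q] ⊕ ℤ ⊕ q⁻¹ℤ[q⁻¹]` are independent. -/
theorem eq_zero_of_add_add {x y : Qq} {n : ℤ} (hx : x ∈ qZq) (hy : y ∈ qZq)
    (h : x + n + qBar y = 0) : x = 0 := by
  obtain ⟨A, rfl⟩ := hx
  obtain ⟨B, rfl⟩ := hy
  -- The bar of q B(q) is q⁻¹ B(q⁻¹). Clearing denominators turns it into the reversed polynomial at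
  -- q.
  have e : q ^ (B.natDegree + 1) * qBar (q * Polynomial.aeval q B) =
      Polynomial.aeval q B.reverse := by
    let u : Qqˣ := Units.mk0 q q_ne_zero
    have := Polynomial.eval₂_reverse_mul_pow (algebraMap ℤ Qq) (u⁻¹ : Qqˣ) (f := B)
    rw [map_mul, qBar_q, qBar_aeval, qBar_q]
    simp only [Polynomial.aeval_def]
    have h2 : ((u⁻¹ : Qqˣ) : Qq) = q⁻¹ := by simp [u]
    rw [← h2, ← this]
    simp only [invOf_units, inv_inv]
    have h3 : (u : Qq) = q := rfl
    rw [h2, h3, pow_succ]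
    have hq : q ^ B.natDegree * q⁻¹ ^ B.natDegree = 1 := by
      rw [← mul_pow, mul_inv_cancel₀ q_ne_zero, one_pow]
    have hq1 : q * q⁻¹ = 1 := mul_inv_cancel₀ q_ne_zero
    linear_combination (Polynomial.eval₂ (algebraMap ℤ Qq) q B.reverse) *
      (hq + q ^ B.natDegree * q⁻¹ ^ B.natDegree * hq1)
  have h1 : Polynomial.aeval q (Polynomial.X ^ (B.natDegree + 2) * A +
      Polynomial.C n * Polynomial.X ^ (B.natDegree + 1) + B.reverse) =
      Polynomial.aeval q (0 : Polynomial ℤ) := by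
    have h2 := congrArg (fun z => q ^ (B.natDegree + 1) * z) h
    simp only [mul_add, e, mul_zero] at h2
    simp only [map_add, map_mul, map_pow, Polynomial.aeval_X, map_zero, Polynomial.aeval_C]
    rw [← h2]
    simp only [eq_intCast]
    ring
  have h3 := aeval_q_int_injective h1
  -- The degrees separate the summands: A is shifted to degrees at least deg B + 2, while the
  -- constant sits in degree deg B + 1 and the reversal of B in degrees at most deg B.
  have hA : A = 0 := by
    ext k
    have h4 := congrArg (fun p : Polynomial ℤ => p.coeff (k + (B.natDegree + 2))) h3
    simp only [Polynomial.coeff_add, Polynomial.coeff_X_pow_mul, Polynomial.coeff_C_mul,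
      Polynomial.coeff_X_pow, Polynomial.coeff_zero] at h4
    rw [Polynomial.coeff_eq_zero_of_natDegree_lt (p := B.reverse), if_neg (by omega)] at h4
    · simpa using h4
    · have := Polynomial.reverse_natDegree_le B
      omega
  rw [hA]; simp

/-- `laurentInt` is additively generated by the powers q ^ k, and the sign of k decides the summand
containing such a power. -/
theorem exists_decomp {z : Qq} (hz : z ∈ laurentInt) :
    ∃ x ∈ qZq, ∃ n : ℤ, ∃ y ∈ qZq, z = x + n + qBar y := by
  have hz' := Subring.mem_closure_iff.mp hz
  clear hz
  induction hz' using AddSubgroup.closure_induction with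
  | mem w hw =>
    have : ∃ k : ℤ, w = q ^ k := by
      induction hw using Submonoid.closure_induction with
      | mem w hw =>
        rcases hw with rfl | rfl
        · exact ⟨1, by simp⟩
        · exact ⟨-1, by simp⟩
      | one => exact ⟨0, by simp⟩
      | mul a b _ _ ha hb =>
        obtain ⟨k, rfl⟩ := ha
        obtain ⟨l, rfl⟩ := hb
        exact ⟨k + l, by rw [zpow_add₀ q_ne_zero]⟩
    obtain ⟨k, rfl⟩ := this
    have hpos : ∀ j : ℕ, q ^ (j + 1) ∈ qZq := fun j =>
      ⟨Polynomial.X ^ j, by rw [map_pow, Polynomial.aeval_X, pow_succ']⟩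
    obtain ⟨j, rfl⟩ | rfl | ⟨j, rfl⟩ : (∃ j : ℕ, k = (j + 1 : ℕ)) ∨ k = 0 ∨
        ∃ j : ℕ, k = -((j + 1 : ℕ) : ℤ) := by
      rcases lt_trichotomy k 0 with h | h | h
      · exact Or.inr (Or.inr ⟨(-k - 1).toNat, by omega⟩)
      · exact Or.inr (Or.inl h)
      · exact Or.inl ⟨(k - 1).toNat, by omega⟩
    · exact ⟨_, hpos j, 0, 0, qZq_zero, by rw [zpow_natCast]; simp⟩
    · exact ⟨0, qZq_zero, 1, 0, qZq_zero, by simp⟩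
    · exact ⟨0, qZq_zero, 0, _, hpos j, by
        rw [map_pow, qBar_q, zpow_neg, zpow_natCast, inv_pow]; simp⟩
  | zero => exact ⟨0, qZq_zero, 0, 0, qZq_zero, by simp⟩
  | add a b _ _ ha hb =>
    obtain ⟨x, hx, n, y, hy, rfl⟩ := ha
    obtain ⟨x', hx', n', y', hy', rfl⟩ := hb
    exact ⟨_, qZq_add hx hx', n + n', _, qZq_add hy hy', by rw [map_add]; push_cast; ring⟩
  | neg a _ ha =>
    obtain ⟨x, hx, n, y, hy, rfl⟩ := ha
    exact ⟨_, qZq_neg hx, -n, _, qZq_neg hy, by rw [map_neg]; push_cast; ring⟩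

/-- The properties of the sets `qℤ[q]` and `q⁻¹ℤ[q⁻¹]` used in the construction of the canonical
and the dual canonical basis. -/
structure IsHalf (P : Set Qq) : Prop where
  sub_mem : ∀ x ∈ P, ∀ y ∈ P, x - y ∈ P
  zero_mem : (0 : Qq) ∈ P
  laurent : ∀ x ∈ P, x ∈ laurentInt
  eq_zero : ∀ x ∈ P, qBar x = x → x = 0
  solve : ∀ z ∈ laurentInt, qBar z = -z → ∃ x ∈ P, x - qBar x = z

/-- For a skew-invariant z = x + n + ȳ, adding z and its conjugate gives (x + y) + 2n + conj(x + y)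
= 0. Independence of the summands forces y = -x and n = 0, so z = x - x̄. -/
theorem isHalf_qZq : IsHalf qZq where
  sub_mem x hx y hy := by rw [sub_eq_add_neg]; exact qZq_add hx (qZq_neg hy)
  zero_mem := qZq_zero
  laurent x hx := qZq_subset_laurentInt hx
  eq_zero x hx h := eq_zero_of_add_add (n := 0) hx (qZq_neg hx) (by rw [map_neg, h]; simp)
  solve z hz h := by
    obtain ⟨x, hx, n, y, hy, rfl⟩ := exists_decomp hz
    refine ⟨x, hx, ?_⟩
    simp only [map_add, qBar_qBar, map_intCast] at h
    have h0 : x + y = 0 := by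
      refine eq_zero_of_add_add (n := 2 * n) (qZq_add hx hy) (qZq_add hx hy) ?_
      rw [map_add]; push_cast
      linear_combination h
    have hy' : y = -x := by linear_combination h0
    subst hy'
    simp only [map_neg] at h ⊢
    have h2 : (2 : Qq) * n = 0 := by linear_combination h
    have h3 : (n : Qq) = 0 := by simpa using h2
    rw [h3]; ring

/-- Everything is obtained from the half q ℤ[q] by conjugation. A solution x there gives the
solution -x̄ here. -/
theorem isHalf_qInvZqInv : IsHalf qInvZqInv where
  sub_mem x hx y hy := by
    have := qBar_mem_qInvZqInv (isHalf_qZq.sub_mem _ (qBar_mem_qZq hx) _ (qBar_mem_qZq hy))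
    simpa only [map_sub, qBar_qBar] using this
  zero_mem := by simpa using qBar_mem_qInvZqInv qZq_zero
  laurent x hx := by
    have := qBar_mem_laurentInt (qZq_subset_laurentInt (qBar_mem_qZq hx))
    rwa [qBar_qBar] at this
  eq_zero x hx h := isHalf_qZq.eq_zero x (by rw [← h]; exact qBar_mem_qZq hx) h
  solve z hz h := by
    obtain ⟨x, hx, h⟩ := isHalf_qZq.solve z hz h
    refine ⟨-qBar x, ?_, by rw [map_neg, qBar_qBar, ← h]; ring⟩
    rw [← map_neg]
    exact qBar_mem_qInvZqInv (qZq_neg hx)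

end FockDuality

end

/-! ### Labels as families of sets, counting functions, and finiteness of the order `DLe`. -/

noncomputable section
namespace FockDuality

theorem occ_lt_iff {s : ℕ} {m : Fin s → ℕ} {t : Fin s} {x : ℤ} {f : Idx m → ℤ} :
    Occ t x f ↔ ∃ k, f (.inl ⟨t, k⟩) = x := by
  constructor
  · rintro ⟨⟨t', k⟩ | j, hi, hx⟩
    · have : t' = t := Fin.ext hi
      subst this
      exact ⟨k, hx⟩
    · exact absurd hi (ne_of_gt t.2)
  · rintro ⟨k, hk⟩
    exact ⟨.inl ⟨t, k⟩, rfl, hk⟩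

theorem occ_last_iff {s : ℕ} {m : Fin s → ℕ} {x : ℤ} {f : Idx m → ℤ} :
    Occ s x f ↔ ∃ j, f (.inr j) = x := by
  constructor
  · rintro ⟨⟨t, k⟩ | j, hi, hx⟩
    · exact absurd hi (ne_of_lt t.2)
    · exact ⟨j, hx⟩
  · rintro ⟨j, hj⟩
    exact ⟨.inr j, rfl, hj⟩

theorem not_occ_of_gt {s : ℕ} {m : Fin s → ℕ} {x : ℤ} {f : Idx m → ℤ} {t : ℕ} (h : s < t) :
    ¬ Occ t x f := by
  rintro ⟨⟨t', k⟩ | j, hi, hx⟩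
  · have := t'.2
    simp only [block] at hi
    omega
  · simp only [block] at hi
    omega

theorem strictAnti_range_inj {α : Type} [LinearOrder α] [WellFoundedLT α] {u v : α → ℤ}
    (hu : StrictAnti u) (hv : StrictAnti v) (h : Set.range u = Set.range v) : u = v := by
  have := (StrictMono.range_inj hu.dual_right hv.dual_right).mp (by
    rw [Set.range_comp, Set.range_comp, h])
  funext a
  exact OrderDual.toDual.injective (congrFun this a)

/-- A label is determined by the sets of values in its blocks. -/
theorem label_ext {s : ℕ} {m : Fin s → ℕ} {κ : Kind} {f g : Label κ m}
    (h : ∀ t x, Occ t x f.1 ↔ Occ t x g.1) : f = g := by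
  apply Subtype.ext
  funext i
  rcases i with ⟨t, k⟩ | j
  · refine congrFun (strictAnti_range_inj (f.2.1 t) (g.2.1 t) ?_) k
    ext x
    have := h t x
    rwa [occ_lt_iff, occ_lt_iff] at this
  · have hr : Set.range (fun j => f.1 (.inr j)) = Set.range (fun j => g.1 (.inr j)) := by
      ext x
      have := h s x
      rwa [occ_last_iff, occ_last_iff] at this
    cases κ
    · exact congrFun (strictAnti_range_inj f.2.2.1 g.2.2.1 hr) j
    · exact congrFun ((StrictMono.range_inj f.2.2.1 g.2.2.1).mp hr) j

/-! ### Counting functions -/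

/-- The number of entries `≥ x` in the blocks before block `t`. -/
def cnt {s : ℕ} {m : Fin s → ℕ} (t : ℕ) (x : ℤ) (f : Idx m → ℤ) : ℕ :=
  (Finset.univ.filter fun p : Σ t : Fin s, Fin (m t) => (p.1 : ℕ) < t ∧ x ≤ f (.inl p)).card

/-- The number of entries `≥ x` in the finite block `t`. -/
def blockCnt {s : ℕ} {m : Fin s → ℕ} (t : ℕ) (x : ℤ) (f : Idx m → ℤ) : ℕ :=
  (Finset.univ.filter fun p : Σ t : Fin s, Fin (m t) => (p.1 : ℕ) = t ∧ x ≤ f (.inl p)).card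

/-- The number of entries equal to `x` in the finite blocks. -/
def mult {s : ℕ} {m : Fin s → ℕ} (x : ℤ) (f : Idx m → ℤ) : ℕ :=
  (Finset.univ.filter fun p : Σ t : Fin s, Fin (m t) => f (.inl p) = x).card

open Classical in
/-- The number of blocks in which `x` occurs. -/
def col {s : ℕ} {m : Fin s → ℕ} (x : ℤ) (f : Idx m → ℤ) : ℕ :=
  mult x f + if Occ s x f then 1 else 0

/-- The partial order on labels by weight and counting functions. -/
def DLe {s : ℕ} {m : Fin s → ℕ} (g f : Label .ord m) : Prop :=
  (∀ x, col x g.1 = col x f.1) ∧ ∀ t x, cnt t x g.1 ≤ cnt t x f.1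

theorem DLe.refl {s : ℕ} {m : Fin s → ℕ} (f : Label .ord m) : DLe f f :=
  ⟨fun _ => rfl, fun _ _ => le_rfl⟩

theorem DLe.trans {s : ℕ} {m : Fin s → ℕ} {f g h : Label .ord m} (h1 : DLe f g) (h2 : DLe g h) :
    DLe f h :=
  ⟨fun x => (h1.1 x).trans (h2.1 x), fun t x => (h1.2 t x).trans (h2.2 t x)⟩

theorem cnt_succ {s : ℕ} {m : Fin s → ℕ} (t : ℕ) (x : ℤ) (f : Idx m → ℤ) :
    cnt (t + 1) x f = cnt t x f + blockCnt t x f := by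
  unfold cnt blockCnt
  rw [← Finset.card_union_of_disjoint]
  · congr 1
    ext p
    simp only [Finset.mem_union, Finset.mem_filter, Finset.mem_univ, true_and]
    grind
  · rw [Finset.disjoint_left]
    intro p
    simp only [Finset.mem_filter, Finset.mem_univ, true_and]
    grind

open Classical in
-- A block of a label contains each value at most once, so consecutive differences of its counting
-- function are the indicator of occurrence.
theorem blockCnt_succ {s : ℕ} {m : Fin s → ℕ} {κ : Kind} {t : ℕ} (ht : t < s) (x : ℤ)
    (f : Label κ m) :
    blockCnt t x f.1 = blockCnt t (x + 1) f.1 + if Occ t x f.1 then 1 else 0 := by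
  unfold blockCnt
  have hsplit : (Finset.univ.filter fun p : Σ t : Fin s, Fin (m t) =>
      (p.1 : ℕ) = t ∧ x ≤ f.1 (.inl p)) =
      (Finset.univ.filter fun p : Σ t : Fin s, Fin (m t) =>
        (p.1 : ℕ) = t ∧ x + 1 ≤ f.1 (.inl p)) ∪
      (Finset.univ.filter fun p : Σ t : Fin s, Fin (m t) =>
        (p.1 : ℕ) = t ∧ f.1 (.inl p) = x) := by
    ext p
    simp only [Finset.mem_union, Finset.mem_filter, Finset.mem_univ, true_and]
    grind
  rw [hsplit, Finset.card_union_of_disjoint]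
  · congr 1
    split_ifs with h
    · rw [Finset.card_eq_one]
      have h' : Occ (⟨t, ht⟩ : Fin s) x f.1 := h
      obtain ⟨k, hk⟩ := occ_lt_iff.mp h'
      refine ⟨⟨⟨t, ht⟩, k⟩, ?_⟩
      ext p
      simp only [Finset.mem_filter, Finset.mem_univ, true_and, Finset.mem_singleton]
      constructor
      · rintro ⟨h1, h2⟩
        have := f.2.inj (i := .inl p) (j := .inl ⟨⟨t, ht⟩, k⟩) h1 (h2.trans hk.symm)
        exact Sum.inl_injective this
      · rintro rfl
        exact ⟨rfl, hk⟩
    · rw [Finset.card_eq_zero, Finset.filter_eq_empty_iff]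
      rintro p - ⟨h1, h2⟩
      exact h ⟨.inl p, h1, h2⟩
  · rw [Finset.disjoint_left]
    intro p
    simp only [Finset.mem_filter, Finset.mem_univ, true_and]
    grind

theorem mult_eq_of_occ_iff {s : ℕ} {m : Fin s → ℕ} (x : ℤ) (f g : Label .ord m)
    (h : ∀ t, t < s → (Occ t x f.1 ↔ Occ t x g.1)) : mult x f.1 = mult x g.1 := by
  have key : ∀ f : Label .ord m, mult x f.1 =
      (Finset.univ.filter fun t : Fin s => ∃ k, f.1 (.inl ⟨t, k⟩) = x).card := by
    intro f
    unfold mult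
    refine Finset.card_bij (fun p _ => p.1) ?_ ?_ ?_
    · rintro ⟨t, k⟩ hp
      simp only [Finset.mem_filter, Finset.mem_univ, true_and] at hp ⊢
      exact ⟨k, hp⟩
    · intro p hp r hr hpr
      simp only [Finset.mem_filter, Finset.mem_univ, true_and] at hp hr
      exact Sum.inl_injective (f.2.inj (i := .inl p) (j := .inl r)
        (congrArg Fin.val hpr) (hp.trans hr.symm))
    · intro t ht
      simp only [Finset.mem_filter, Finset.mem_univ, true_and] at ht
      obtain ⟨k, hk⟩ := ht
      exact ⟨⟨t, k⟩, by simpa using hk, rfl⟩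
  rw [key, key]
  congr 1
  ext t
  simp only [Finset.mem_filter, Finset.mem_univ, true_and]
  have := h t t.2
  rwa [occ_lt_iff, occ_lt_iff] at this

open Classical in
/-- A label is determined by its counting functions and its weight. -/
theorem label_ext_of_cnt {s : ℕ} {m : Fin s → ℕ} {f g : Label .ord m}
    (h1 : ∀ x, col x f.1 = col x g.1) (h2 : ∀ t x, cnt t x f.1 = cnt t x g.1) : f = g := by
  have hlt : ∀ t, t < s → ∀ x, (Occ t x f.1 ↔ Occ t x g.1) := by
    intro t ht x
    have e : ∀ x, blockCnt t x f.1 = blockCnt t x g.1 := by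
      intro x
      have e1 := h2 (t + 1) x
      rw [cnt_succ, cnt_succ, h2 t x] at e1
      omega
    have e2 := e x
    rw [blockCnt_succ ht x f, blockCnt_succ ht x g, e (x + 1)] at e2
    by_cases ha : Occ t x f.1 <;> by_cases hb : Occ t x g.1 <;> simp_all
  refine label_ext fun t x => ?_
  rcases lt_trichotomy t s with h | rfl | h
  · exact hlt t h x
  · have e := h1 x
    unfold col at e
    rw [mult_eq_of_occ_iff x f g (fun u hu => hlt u hu x)] at e
    by_cases ha : Occ t x f.1 <;> by_cases hb : Occ t x g.1 <;> simp_all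
  · simp [not_occ_of_gt h]

theorem DLe.antisymm {s : ℕ} {m : Fin s → ℕ} {f g : Label .ord m} (h1 : DLe f g) (h2 : DLe g f) :
    f = g :=
  label_ext_of_cnt h1.1 fun t x => le_antisymm (h1.2 t x) (h2.2 t x)

/-! ### Levels -/

/-- The parts of the partition, f(j) + j with j counted from 0, decrease weakly and are eventually
0, so they are nonnegative. -/
theorem neg_le_ord {s : ℕ} {m : Fin s → ℕ} (f : Label .ord m) (j : ℕ) : -(j : ℤ) ≤ f.1 (.inr j) := by
  obtain ⟨-, h2, N, hN⟩ := f.2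
  have hanti : Antitone fun j : ℕ => f.1 (.inr j) + (j : ℤ) := antitone_nat_of_succ_le fun j => by
    have : f.1 (.inr (j + 1)) < f.1 (.inr j) := h2 (Nat.lt_succ_self j)
    push_cast
    omega
  have h := hanti (le_max_left j N)
  simp only [hN _ (le_max_right j N)] at h
  omega

theorem ord_le_zero {s : ℕ} {m : Fin s → ℕ} (f : Label .ord m) (j : ℕ) :
    f.1 (.inr j) ≤ f.1 (.inr 0) := f.2.2.1.antitone (Nat.zero_le j)

/-- The parts decrease weakly and are nonnegative, so one vanishing part forces all later ones to
vanish. -/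
theorem level_iff {s : ℕ} {m : Fin s → ℕ} (n : ℕ) (f : Label .ord m) :
    Level .ord n f.1 ↔ f.1 (.inr n) = -(n : ℤ) := by
  constructor
  · intro h
    exact h n le_rfl
  · intro h j hj
    have h1 := neg_le_ord f j
    have hanti : Antitone fun j : ℕ => f.1 (.inr j) + (j : ℤ) := antitone_nat_of_succ_le fun j => by
      have : f.1 (.inr (j + 1)) < f.1 (.inr j) := f.2.2.1 (Nat.lt_succ_self j)
      push_cast
      omega
    have := hanti hj
    simp only [h] at this
    omega

theorem exists_level {s : ℕ} {m : Fin s → ℕ} (f : Label .ord m) : ∃ n, Level .ord n f.1 :=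
  f.2.2.2

theorem occ_of_level {s : ℕ} {m : Fin s → ℕ} {n : ℕ} {f : Label .ord m} (h : Level .ord n f.1)
    {x : ℤ} (hx : x ≤ -(n : ℤ)) : Occ s x f.1 :=
  occ_last_iff.mpr ⟨(-x).toNat, by rw [h _ (by omega)]; omega⟩

/-- Converse of `occ_of_level`. If -n - i stands at position j(i), then j(i) ≥ j(0) + i. Far out a
label is -j at position j, so j(N) = n + N and j(0) ≤ n. Nonnegativity of the parts gives j(0) ≥ n.
-/
theorem level_of_occ {s : ℕ} {m : Fin s → ℕ} {n : ℕ} {f : Label .ord m}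
    (h : ∀ x : ℤ, x ≤ -(n : ℤ) → Occ s x f.1) : Level .ord n f.1 := by
  obtain ⟨N, hN⟩ := exists_level f
  have key : ∀ i : ℕ, ∃ j : ℕ, f.1 (.inr j) = -(n : ℤ) - i := fun i =>
    occ_last_iff.mp (h _ (by omega))
  choose j hj using key
  have hj' : ∀ i, j 0 + i ≤ j i := by
    intro i
    induction i with
    | zero => simp
    | succ i ih =>
      have : j i < j (i + 1) := by
        rw [← f.2.2.1.lt_iff_gt]
        simp only [hj]
        push_cast
        omega
      omega
  have h0 : n ≤ j 0 := by
    have := neg_le_ord f (j 0)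
    rw [hj 0] at this
    push_cast at this
    omega
  have h1 := hj' N
  have h2 := hN (j N) (by omega)
  rw [hj N] at h2
  have h3 : j 0 = n := by omega
  rw [level_iff]
  have := hj 0
  rw [h3] at this
  simpa using this

open Classical in
/-- The number of entries of the last block in an interval. -/
def lastCnt {s : ℕ} {m : Fin s → ℕ} (x Z : ℤ) (f : Idx m → ℤ) : ℕ :=
  ((Finset.Icc x Z).filter fun y => Occ s y f).card

theorem lastCnt_of_level {s : ℕ} {m : Fin s → ℕ} {n : ℕ} {f : Label .ord m}
    (h : Level .ord n f.1) (Z : ℤ) : lastCnt (-(n : ℤ) + 1) Z f.1 ≤ n := by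
  classical
  refine (Finset.card_le_card (t := (Finset.range n).image fun j => f.1 (.inr j)) ?_).trans
    (Finset.card_image_le.trans (Finset.card_range n).le)
  intro y hy
  simp only [Finset.mem_filter, Finset.mem_Icc, occ_last_iff] at hy
  obtain ⟨⟨h1, -⟩, j, rfl⟩ := hy
  refine Finset.mem_image_of_mem _ (Finset.mem_range.mpr ?_)
  by_contra hj
  have := h j (by omega)
  omega

/-- If the entry at position n exceeds -n, then so do all entries at the n + 1 positions 0, …, n.
With `lastCnt_of_level`, level n means that at most n entries of the last block exceed -n. -/
theorem level_of_lastCnt {s : ℕ} {m : Fin s → ℕ} {n : ℕ} {f : Label .ord m} {Z : ℤ}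
    (hZ : f.1 (.inr 0) ≤ Z) (h : lastCnt (-(n : ℤ) + 1) Z f.1 ≤ n) : Level .ord n f.1 := by
  classical
  rw [level_iff]
  by_contra hne
  have h1 := neg_le_ord f n
  have : ((Finset.range (n + 1)).image fun j => f.1 (.inr j)).card ≤
      lastCnt (-(n : ℤ) + 1) Z f.1 := by
    refine Finset.card_le_card fun y hy => ?_
    obtain ⟨j, hj, rfl⟩ := Finset.mem_image.mp hy
    have hj' : j ≤ n := by simpa [Nat.lt_succ_iff] using hj
    simp only [Finset.mem_filter, Finset.mem_Icc]
    have h2 : f.1 (.inr n) ≤ f.1 (.inr j) := f.2.2.1.antitone hj'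
    have h3 := ord_le_zero f j
    exact ⟨⟨by omega, by omega⟩, occ_last_iff.mpr ⟨j, rfl⟩⟩
  rw [Finset.card_image_of_injective _ f.2.2.1.injective, Finset.card_range] at this
  omega

/-- The entries with values in an interval, counted by value and by position. Labels of equal weight
have equal left sides, so what the finite blocks lose there the last block gains. -/
theorem sum_col {s : ℕ} {m : Fin s → ℕ} (x Z : ℤ) (f : Idx m → ℤ) (hZ : ∀ p, f (.inl p) ≤ Z) :
    ∑ y ∈ Finset.Icc x Z, col y f = cnt s x f + lastCnt x Z f := by
  classical
  unfold col
  rw [Finset.sum_add_distrib, ← Finset.card_filter]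
  congr 1
  · unfold cnt mult
    rw [Finset.card_eq_sum_card_fiberwise (f := fun p => f (.inl p)) (t := Finset.Icc x Z)]
    · refine Finset.sum_congr rfl fun y hy => ?_
      congr 1
      ext p
      simp only [Finset.mem_filter, Finset.mem_univ, true_and, Finset.mem_Icc] at hy ⊢
      have := p.1.2
      constructor
      · rintro rfl
        exact ⟨⟨this, hy.1⟩, rfl⟩
      · exact fun h => h.2
    · intro p hp
      simp only [Finset.coe_filter, Finset.mem_univ, true_and, Set.mem_ofPred_eq] at hp
      simp only [Finset.coe_Icc, Set.mem_Icc]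
      exact ⟨hp.2, hZ p⟩

theorem exists_bound {s : ℕ} {m : Fin s → ℕ} (f : Label .ord m) :
    ∃ Z₀ : ℤ, ∀ Z, Z₀ ≤ Z → (∀ p, f.1 (.inl p) ≤ Z) ∧ f.1 (.inr 0) ≤ Z := by
  obtain ⟨b, hb⟩ := (Set.finite_range fun p => f.1 (.inl p)).bddAbove
  refine ⟨max b (f.1 (.inr 0)), fun Z hZ => ⟨fun p => ?_, (le_max_right _ _).trans hZ⟩⟩
  exact (hb ⟨p, rfl⟩).trans ((le_max_left _ _).trans hZ)

/-- Larger labels have smaller levels. -/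
theorem DLe.level {s : ℕ} {m : Fin s → ℕ} {f g : Label .ord m} (h : DLe g f) {n : ℕ}
    (hg : Level .ord n g.1) : Level .ord n f.1 := by
  obtain ⟨Z₁, h1⟩ := exists_bound f
  obtain ⟨Z₂, h2⟩ := exists_bound g
  obtain ⟨h1, h1'⟩ := h1 (max Z₁ Z₂) (le_max_left _ _)
  obtain ⟨h2, h2'⟩ := h2 (max Z₁ Z₂) (le_max_right _ _)
  refine level_of_lastCnt h1' ?_
  -- The totals over [-n+1, Z] agree, and `g` has no more entries there in the finite blocks than
  -- `f`. So the last block of `f` has at most as many entries above -n as that of `g`, hence at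
  -- most n.
  have e1 := sum_col (-(n : ℤ) + 1) _ f.1 h1
  have e2 := sum_col (-(n : ℤ) + 1) _ g.1 h2
  rw [Finset.sum_congr rfl fun y _ => h.1 y, e1] at e2
  have e3 := lastCnt_of_level hg (max Z₁ Z₂)
  have e4 := h.2 s (-(n : ℤ) + 1)
  omega

theorem mult_pos_iff {s : ℕ} {m : Fin s → ℕ} {x : ℤ} {f : Idx m → ℤ} :
    0 < mult x f ↔ ∃ p, f (.inl p) = x := by
  unfold mult
  rw [Finset.card_pos]
  constructor
  · rintro ⟨p, hp⟩
    exact ⟨p, by simpa using hp⟩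
  · rintro ⟨p, hp⟩
    exact ⟨p, by simpa using hp⟩

theorem occ_last_iff_of_col {s : ℕ} {m : Fin s → ℕ} {f g : Label .ord m} {x : ℤ}
    (h1 : col x f.1 = col x g.1) (h2 : mult x f.1 = mult x g.1) : Occ s x f.1 ↔ Occ s x g.1 := by
  unfold col at h1
  rw [h2] at h1
  by_cases ha : Occ s x f.1 <;> by_cases hb : Occ s x g.1 <;> simp_all

theorem label_ext_of_inl {s : ℕ} {m : Fin s → ℕ} {f g : Label .ord m}
    (h1 : ∀ x, col x f.1 = col x g.1) (h2 : ∀ p, f.1 (.inl p) = g.1 (.inl p)) : f = g := by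
  have hlt : ∀ t, t < s → ∀ x, (Occ t x f.1 ↔ Occ t x g.1) := by
    intro t ht x
    have e1 := occ_lt_iff (t := ⟨t, ht⟩) (x := x) (f := f.1)
    have e2 := occ_lt_iff (t := ⟨t, ht⟩) (x := x) (f := g.1)
    simp only [h2] at e1
    exact e1.trans e2.symm
  refine label_ext fun t x => ?_
  rcases lt_trichotomy t s with h | rfl | h
  · exact hlt t h x
  · exact occ_last_iff_of_col (h1 x) (mult_eq_of_occ_iff x f g fun u hu => hlt u hu x)
  · simp [not_occ_of_gt h]

/-- An entry x of a finite block of `g` lies in [-n, f(1)] or is already an entry of a finite block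
of `f`. Otherwise either x has weight 0 in `f`, or x < -n, in which case the last block of `g`
contains x too and x has weight at least 2 in `g` but 1 in `f`. The finite blocks and the weight
determine a label. -/
theorem finite_level_col {s : ℕ} {m : Fin s → ℕ} (n : ℕ) (f : Label .ord m) :
    {g : Label .ord m | Level .ord n g.1 ∧ ∀ x, col x g.1 = col x f.1}.Finite := by
  classical
  have hV : (Set.Icc (-(n : ℤ)) (f.1 (.inr 0)) ∪ Set.range fun p => f.1 (.inl p)).Finite :=
    (Set.finite_Icc _ _).union (Set.finite_range _)
  refine Set.Finite.of_finite_image (f := fun g : Label .ord m => fun p => g.1 (.inl p))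
    ((Set.Finite.pi' fun _ : Σ t : Fin s, Fin (m t) => hV).subset ?_) ?_
  · rintro _ ⟨g, ⟨h1, h2⟩, rfl⟩ p
    by_contra hp
    simp only [Set.mem_union, Set.mem_Icc, Set.mem_range, not_or, ← mult_pos_iff] at hp
    have e := h2 (g.1 (.inl p))
    have h3 : 0 < mult (g.1 (.inl p)) g.1 := mult_pos_iff.mpr ⟨p, rfl⟩
    unfold col at e
    by_cases hs : Occ s (g.1 (.inl p)) f.1
    · obtain ⟨j, hj⟩ := occ_last_iff.mp hs
      have h4 := ord_le_zero f j
      have h5 := occ_of_level h1 (x := g.1 (.inl p)) (by omega)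
      rw [if_pos h5, if_pos hs] at e
      omega
    · rw [if_neg hs] at e
      omega
  · rintro g ⟨-, h1⟩ g' ⟨-, h2⟩ he
    exact label_ext_of_inl (fun x => (h1 x).trans (h2 x).symm) (congrFun he)

/-- Labels above `g` have the weight of `g` and every level that `g` has, by `DLe.level`. -/
theorem finite_up {s : ℕ} {m : Fin s → ℕ} (g : Label .ord m) : {f | DLe g f}.Finite := by
  obtain ⟨n, hn⟩ := exists_level g
  exact (finite_level_col n g).subset fun f hf => ⟨hf.level hn, fun x => (hf.1 x).symm⟩

/-- The finite set of labels above `g`. -/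
def Up {s : ℕ} {m : Fin s → ℕ} (g : Label .ord m) : Finset (Label .ord m) := (finite_up g).toFinset

theorem mem_Up {s : ℕ} {m : Fin s → ℕ} {f g : Label .ord m} : f ∈ Up g ↔ DLe g f := by simp [Up]

theorem card_Up_lt {s : ℕ} {m : Fin s → ℕ} {f g : Label .ord m} (h : DLe g f) (hne : f ≠ g) :
    (Up f).card < (Up g).card := by
  refine Finset.card_lt_card ⟨fun x hx => ?_, fun hs => ?_⟩
  · exact mem_Up.mpr (h.trans (mem_Up.mp hx))
  · exact hne ((mem_Up.mp (hs (mem_Up.mpr (DLe.refl g)))).antisymm h)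

/-- Induction from larger to smaller labels. -/
theorem up_induction {s : ℕ} {m : Fin s → ℕ} {C : Label .ord m → Prop}
    (h : ∀ g, (∀ f, DLe g f → f ≠ g → C f) → C g) (g : Label .ord m) : C g := by
  induction hn : (Up g).card using Nat.strong_induction_on generalizing g with
  | _ n ih =>
    subst hn
    exact h g fun f hf hne => ih _ (card_Up_lt hf hne) f rfl

theorem finite_down {s : ℕ} {m : Fin s → ℕ} (n : ℕ) (f : Label .ord m) :
    {g | Level .ord n g.1 ∧ DLe g f}.Finite :=
  (finite_level_col n f).subset fun _ hg => ⟨hg.1, hg.2.1⟩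

end FockDuality

end

noncomputable section
namespace FockDuality

/-! ### Complementary sequences -/

/-- For a strictly decreasing sequence `u` with `u k = -k` eventually, the sequence
`j ↦ j + 1 - #{k : u k + k ≥ j + 1}` enumerates the complement of the range of `u`. -/
theorem mem_range_compl_iff {u : ℕ → ℤ} (hu : StrictAnti u) {N : ℕ}
    (hN : ∀ j, N ≤ j → u j = -(j : ℤ)) (x : ℤ) :
    (∃ j : ℕ, (j : ℤ) + 1 - ({k : ℕ | (j : ℤ) + 1 ≤ u k + k}.ncard : ℤ) = x) ↔
      ¬ ∃ k, u k = x := by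
  have hanti : Antitone fun j : ℕ => u j + (j : ℤ) := antitone_nat_of_succ_le fun j => by
    have : u (j + 1) < u j := hu (Nat.lt_succ_self j)
    push_cast
    omega
  have hpos : ∀ k, 0 ≤ u k + k := by
    intro k
    have h := hanti (le_max_left k N)
    simp only [hN _ (le_max_right k N)] at h
    omega
  -- Weak monotonicity of u k + k makes the counted set an initial segment, so its cardinality is
  -- its end point.
  have hc : ∀ j : ℕ, ∀ c : ℕ, (∀ k : ℕ, (j : ℤ) + 1 ≤ u k + k ↔ k < c) →
      {k : ℕ | (j : ℤ) + 1 ≤ u k + k}.ncard = c := by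
    intro j c h
    have : {k : ℕ | (j : ℤ) + 1 ≤ u k + k} = ((Finset.range c : Finset ℕ) : Set ℕ) := by
      ext k
      simp [h]
    rw [this, Set.ncard_coe_finset, Finset.card_range]
  have hex : ∀ j : ℕ, ∃ c : ℕ, ∀ k : ℕ, (j : ℤ) + 1 ≤ u k + k ↔ k < c := by
    intro j
    have hne : ∃ k : ℕ, ¬ (j : ℤ) + 1 ≤ u k + k := ⟨N, by rw [hN N le_rfl]; omega⟩
    classical
    refine ⟨Nat.find hne, fun k => ⟨fun hk => ?_, fun hk => ?_⟩⟩
    · by_contra hlt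
      have := hanti (not_lt.mp hlt)
      exact Nat.find_spec hne (hk.trans this)
    · exact not_not.mp (Nat.find_min hne hk)
  constructor
  -- The value is x = j + 1 - c. For k < c one has u k ≥ j + 1 - k > x, and for k ≥ c one has u k ≤
  -- j - k < x, so x is missed.
  · rintro ⟨j, hj⟩ ⟨k, hk⟩
    obtain ⟨c, h⟩ := hex j
    rw [hc j c h] at hj
    have := h k
    by_cases hkc : k < c
    · have := this.mpr hkc
      omega
    · have h2 : ¬ (j : ℤ) + 1 ≤ u k + k := fun h' => hkc (this.mp h')
      omega
  · intro hx
    have hne : ∃ k : ℕ, u k < x := by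
      refine ⟨max N ((-x).toNat + 1), ?_⟩
      rw [hN _ (le_max_left _ _)]
      have := le_max_right N ((-x).toNat + 1)
      omega
    classical
    have hspec := Nat.find_spec hne
    have hmin : ∀ k, k < Nat.find hne → x < u k := by
      intro k hk
      refine lt_of_le_of_ne (not_lt.mp (Nat.find_min hne hk)) fun h => hx ⟨k, h.symm⟩
    set c := Nat.find hne
    have h0 := hpos c
    -- Here c is the number of entries exceeding x, so the equation j + 1 - c = x determines j. It
    -- is nonnegative because u c < x and u c + c ≥ 0.
    refine ⟨(x + c - 1).toNat, ?_⟩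
    have e : ((x + c - 1).toNat : ℤ) = x + c - 1 := by omega
    rw [hc _ c, e]
    · ring
    · intro k
      rw [e]
      constructor
      · intro hk
        by_contra hlt
        have := hanti (not_lt.mp hlt)
        simp only at this
        omega
      · intro hk
        have h1 : k ≤ c - 1 := by omega
        have h2 := hanti h1
        have h3 := hmin (c - 1) (by omega)
        simp only at h2
        have : ((c - 1 : ℕ) : ℤ) = c - 1 := by omega
        omega

theorem occ_natural_last {s : ℕ} {m : Fin s → ℕ} (f : Label .ord m) (x : ℤ) :
    Occ s x (naturalLabel f).1 ↔ ¬ Occ s x f.1 := by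
  obtain ⟨N, hN⟩ := f.2.2.2
  rw [occ_last_iff, occ_last_iff]
  exact mem_range_compl_iff f.2.2.1 hN x

theorem occ_natural_of_lt {s : ℕ} {m : Fin s → ℕ} (f : Label .ord m) {t : ℕ} (ht : t ≠ s) (x : ℤ) :
    Occ t x (naturalLabel f).1 ↔ Occ t x f.1 := by
  constructor
  · rintro ⟨p | j, h1, h2⟩
    · exact ⟨.inl p, h1, h2⟩
    · exact absurd h1.symm ht
  · rintro ⟨p | j, h1, h2⟩
    · exact ⟨.inl p, h1, h2⟩
    · exact absurd h1.symm ht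

/-- On the last block the map takes complements, hence it is injective. The reflection x ↦ 1 - x
exchanges the two kinds of sequences, so a preimage is found by reflecting, taking the complement
and reflecting back. -/
theorem naturalLabel_bijective {s : ℕ} {m : Fin s → ℕ} :
    Function.Bijective (naturalLabel (m := m)) := by
  constructor
  · intro f g h
    refine label_ext fun t x => ?_
    by_cases ht : t = s
    · subst ht
      rw [← not_iff_not, ← occ_natural_last, ← occ_natural_last, h]
    · rw [← occ_natural_of_lt f ht, ← occ_natural_of_lt g ht, h]
  · intro g
    obtain ⟨N, hN⟩ := g.2.2.2
    let u : Idx m → ℤ := Sum.elim (fun p => g.1 (.inl p)) fun j => 1 - g.1 (.inr j)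
    have hu : IsLabel .ord u := by
      refine ⟨g.2.1, fun j k hjk => ?_, N, fun j hj => ?_⟩
      · have : g.1 (.inr j) < g.1 (.inr k) := g.2.2.1 hjk
        simp only [u, Sum.elim_inr]
        omega
      · have := hN j hj
        simp only [u, Sum.elim_inr]
        omega
    have hv := isLabel_naturalFun hu
    obtain ⟨M, hM⟩ := hv.2.2
    let w : Idx m → ℤ := Sum.elim (fun p => g.1 (.inl p)) fun j => 1 - naturalFun u (.inr j)
    have hw : IsLabel .ord w := by
      refine ⟨g.2.1, fun j k hjk => ?_, M, fun j hj => ?_⟩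
      · have : naturalFun u (.inr j) < naturalFun u (.inr k) := hv.2.1 hjk
        simp only [w, Sum.elim_inr]
        omega
      · have := hM j hj
        simp only [w, Sum.elim_inr]
        omega
    refine ⟨⟨w, hw⟩, label_ext fun t x => ?_⟩
    by_cases ht : t = s
    · subst ht
      rw [occ_natural_last]
      have h1 := occ_natural_last ⟨u, hu⟩ (1 - x)
      rw [occ_last_iff, occ_last_iff] at *
      have h2 : (∃ j, w (.inr j) = x) ↔ ∃ j, (naturalLabel ⟨u, hu⟩).1 (.inr j) = 1 - x := by
        refine exists_congr fun j => ?_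
        simp only [w, Sum.elim_inr, naturalLabel]
        constructor <;> intro h <;> omega
      rw [h2, h1, not_not]
      refine exists_congr fun j => ?_
      simp only [u, Sum.elim_inr]
      constructor <;> intro h <;> omega
    · rw [occ_natural_of_lt _ ht]
      constructor
      · rintro ⟨p | j, h1, h2⟩
        · exact ⟨.inl p, h1, h2⟩
        · exact absurd h1.symm ht
      · rintro ⟨p | j, h1, h2⟩
        · exact ⟨.inl p, h1, h2⟩
        · exact absurd h1.symm ht

/-- The complement has no element below -n exactly when every integer ≤ -(n + 1) is an entry of the
last block. This accounts for the shift by one. -/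
theorem level_natural_iff {s : ℕ} {m : Fin s → ℕ} (n : ℕ) (f : Label .ord m) :
    Level .sup n (naturalLabel f).1 ↔ Level .ord (n + 1) f.1 := by
  constructor
  · intro h
    refine level_of_occ fun x hx => ?_
    by_contra hne
    rw [← occ_natural_last, occ_last_iff] at hne
    obtain ⟨j, hj⟩ := hne
    have := h j
    push_cast at hx
    omega
  · intro h j
    by_contra hne
    have h1 := (occ_natural_last f ((naturalLabel f).1 (.inr j))).mp (occ_last_iff.mpr ⟨j, rfl⟩)
    exact h1 (occ_of_level h (by push_cast; omega))

/-! ### The Bruhat orderings and the counting functions -/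

/-- If both positions lie in the first `t` blocks, the count does not change. Otherwise at most the
earlier position lies there, and its entry gets smaller. -/
theorem cnt_swap_le {s : ℕ} {m : Fin s → ℕ} {f : Idx m → ℤ} {i j : Idx m} (hij : Before i j)
    (hf : f j < f i) (t : ℕ) (x : ℤ) : cnt t x (f ∘ Equiv.swap i j) ≤ cnt t x f := by
  unfold cnt
  by_cases hj : ∃ r : Σ t, Fin (m t), j = .inl r ∧ (r.1 : ℕ) < t
  · obtain ⟨r, rfl, hr⟩ := hj
    rcases i with p | i
    · have hp : (p.1 : ℕ) < t := by
        have h : p.1 < r.1 ∨ (p.1 = r.1 ∧ (p.2 : ℕ) < r.2) := hij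
        rcases h with h | ⟨h, -⟩
        · exact lt_trans h hr
        · rw [h]; exact hr
      have hsw : ∀ k, Equiv.swap (Sum.inl p : Idx m) (.inl r) (.inl k) = .inl (Equiv.swap p r k) := by
        intro k
        by_cases h1 : k = p
        · subst h1; simp
        · by_cases h2 : k = r
          · subst h2; simp
          · rw [Equiv.swap_apply_of_ne_of_ne h1 h2, Equiv.swap_apply_of_ne_of_ne] <;> simpa
      refine le_of_eq (Finset.card_equiv (Equiv.swap p r) fun k => ?_)
      simp only [Finset.mem_filter, Finset.mem_univ, true_and, Function.comp_apply, hsw]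
      have : ((k.1 : ℕ) < t ↔ ((Equiv.swap p r k).1 : ℕ) < t) := by
        by_cases h1 : k = p
        · subst h1; simp [hp, hr]
        · by_cases h2 : k = r
          · subst h2; simp [hp, hr]
          · rw [Equiv.swap_apply_of_ne_of_ne h1 h2]
      rw [this]
    · exact absurd hij id
  · refine Finset.card_le_card fun k hk => ?_
    simp only [Finset.mem_filter, Finset.mem_univ, true_and, Function.comp_apply] at hk ⊢
    refine ⟨hk.1, hk.2.trans ?_⟩
    by_cases h1 : (.inl k : Idx m) = i
    · rw [h1, Equiv.swap_apply_left]; exact hf.le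
    · rw [Equiv.swap_apply_of_ne_of_ne h1]
      rintro rfl
      exact hj ⟨k, rfl, hk.1⟩

/-- In this form the weight makes sense for all functions, and it is visibly invariant under
permuting positions. -/
theorem mult_add_eq_ncard {s : ℕ} {m : Fin s → ℕ} (x : ℤ) (f : Label .ord m) :
    col x f.1 = {i | f.1 i = x}.ncard := by
  classical
  have h1 : {i | f.1 i = x} = Sum.inl '' {p | f.1 (.inl p) = x} ∪
      Sum.inr '' {j | f.1 (.inr j) = x} := by
    ext i
    rcases i with p | j <;> simp
  have hsub : {j | f.1 (.inr j) = x}.Subsingleton := fun j hj k hk =>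
    f.2.2.1.injective (hj.trans hk.symm)
  rw [h1, Set.ncard_union_eq (hs := Set.toFinite _) (ht := hsub.finite.image _), Set.ncard_image_of_injective _ Sum.inl_injective,
    Set.ncard_image_of_injective _ Sum.inr_injective]
  · unfold col mult
    congr 1
    · rw [Set.ncard_eq_toFinset_card', Set.toFinset_ofPred]
    · split_ifs with h
      · obtain ⟨j, hj⟩ := occ_last_iff.mp h
        symm
        rw [Set.ncard_eq_one]
        exact ⟨j, Set.eq_singleton_iff_unique_mem.mpr ⟨hj, fun k hk => hsub hk hj⟩⟩
      · symm
        rw [Set.ncard_eq_zero (hsub.finite)]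
        ext j
        simp only [Set.mem_ofPred_eq, Set.mem_empty_iff_false, iff_false]
        exact fun hj => h (occ_last_iff.mpr ⟨j, hj⟩)
  · rw [Set.disjoint_left]
    rintro _ ⟨p, -, rfl⟩ ⟨j, -, h⟩
    cases h

theorem Below.dle {s : ℕ} {m : Fin s → ℕ} {f g : Label .ord m} (h : Below g f) : DLe g f := by
  -- The intermediate functions of a chain need not be labels, so the induction runs over invariants
  -- of arbitrary functions.
  have key : ∀ h : Idx m → ℤ, Relation.ReflTransGen BruhatStep f.1 h →
      (∀ x, {i | h i = x}.ncard = {i | f.1 i = x}.ncard) ∧ ∀ t x, cnt t x h ≤ cnt t x f.1 := by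
    intro h hh
    induction hh with
    | refl => exact ⟨fun _ => rfl, fun _ _ => le_rfl⟩
    | tail _ hst ih =>
      obtain ⟨i, j, hij, hlt, rfl⟩ := hst
      refine ⟨fun x => ?_, fun t x => (cnt_swap_le hij hlt t x).trans (ih.2 t x)⟩
      rw [← ih.1 x, ← Set.ncard_image_of_injective _ (Equiv.swap i j).injective]
      congr 1
      ext k
      simp only [Set.mem_image, Set.mem_ofPred_eq, Function.comp_apply]
      constructor
      · rintro ⟨l, hl, rfl⟩
        exact hl
      · intro hk
        exact ⟨Equiv.swap i j k, by rwa [Equiv.swap_apply_self], Equiv.swap_apply_self _ _ _⟩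
  obtain ⟨h1, h2⟩ := key g.1 h
  exact ⟨fun x => by rw [mult_add_eq_ncard, mult_add_eq_ncard, h1], h2⟩

/-- The difference of the numbers of entries equal to `x` before and in the last block, the latter
taken over the first `n` positions. -/
def superCol {s : ℕ} {m : Fin s → ℕ} (n : ℕ) (x : ℤ) (f : Idx m → ℤ) : ℤ :=
  (∑ p, if f (.inl p) = x then 1 else 0) - ∑ j ∈ Finset.range n, if f (.inr j) = x then 1 else 0

/-- A step of type (i) changes equal entries on both sides of the difference in the same way, and a
transposition within one side permutes summands. The truncation only has to lie beyond the moved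
positions. -/
theorem superCol_step {s : ℕ} {m : Fin s → ℕ} {f g : Idx m → ℤ} (h : SuperStep f g) :
    ∃ N, ∀ n, N ≤ n → ∀ x, superCol n x g = superCol n x f := by
  rcases h with ⟨p, j, hpj, rfl⟩ | ⟨p, r, -, -, rfl⟩ | ⟨i, j, -, -, rfl⟩
  · refine ⟨j + 1, fun n hn x => ?_⟩
    have e1 : ∀ k, (f - dFun (.inl p) + dFun (.inr j) : Idx m → ℤ) (.inl k) =
        if k = p then f (.inl p) - 1 else f (.inl k) := by
      intro k
      by_cases hk : k = p
      · subst hk; simp [dFun]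
      · simp [dFun, hk]
    have e2 : ∀ k, (f - dFun (.inl p) + dFun (.inr j) : Idx m → ℤ) (.inr k) =
        if k = j then f (.inl p) - 1 else f (.inr k) := by
      intro k
      by_cases hk : k = j
      · subst hk; simp [dFun, hpj]; omega
      · simp [dFun, hk]
    unfold superCol
    simp only [e1, e2]
    rw [← Finset.add_sum_erase _ _ (Finset.mem_univ p),
      ← Finset.add_sum_erase _ _ (Finset.mem_range.mpr (by omega : j < n)),
      ← Finset.add_sum_erase Finset.univ (fun k => if f (.inl k) = x then (1 : ℤ) else 0)
        (Finset.mem_univ p),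
      ← Finset.add_sum_erase (Finset.range n) (fun k => if f (.inr k) = x then (1 : ℤ) else 0)
        (Finset.mem_range.mpr (by omega : j < n))]
    rw [Finset.sum_congr rfl fun k hk => by rw [if_neg (Finset.ne_of_mem_erase hk)],
      Finset.sum_congr (s₁ := (Finset.range n).erase j) rfl
        fun k hk => by rw [if_neg (Finset.ne_of_mem_erase hk)]]
    simp only [if_true, hpj]
    ring
  · refine ⟨0, fun n _ x => ?_⟩
    have hsw : ∀ k, Equiv.swap (Sum.inl p : Idx m) (.inl r) (.inl k) = .inl (Equiv.swap p r k) := by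
      intro k
      by_cases h1 : k = p
      · subst h1; simp
      · by_cases h2 : k = r
        · subst h2; simp
        · rw [Equiv.swap_apply_of_ne_of_ne h1 h2, Equiv.swap_apply_of_ne_of_ne] <;> simpa
    have hsw' : ∀ k, Equiv.swap (Sum.inl p : Idx m) (.inl r) (.inr k) = .inr k := fun k =>
      Equiv.swap_apply_of_ne_of_ne (by simp) (by simp)
    unfold superCol
    simp only [Function.comp_apply, hsw, hsw']
    congr 1
    exact Equiv.sum_comp (Equiv.swap p r) fun k => if f (.inl k) = x then (1 : ℤ) else 0
  · refine ⟨i + j + 1, fun n hn x => ?_⟩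
    have hsw : ∀ k, Equiv.swap (Sum.inr i : Idx m) (.inr j) (.inr k) = .inr (Equiv.swap i j k) := by
      intro k
      by_cases h1 : k = i
      · subst h1; simp
      · by_cases h2 : k = j
        · subst h2; simp
        · rw [Equiv.swap_apply_of_ne_of_ne h1 h2, Equiv.swap_apply_of_ne_of_ne] <;> simpa
    have hsw' : ∀ k, Equiv.swap (Sum.inr i : Idx m) (.inr j) (.inl k) = .inl k := fun k =>
      Equiv.swap_apply_of_ne_of_ne (by simp) (by simp)
    unfold superCol
    simp only [Function.comp_apply, hsw, hsw']
    congr 1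
    refine Finset.sum_equiv (Equiv.swap i j) (fun k => ?_) fun k _ => rfl
    simp only [Finset.mem_range]
    by_cases h1 : k = i
    · subst h1; simp; omega
    · by_cases h2 : k = j
      · subst h2; simp; omega
      · rw [Equiv.swap_apply_of_ne_of_ne h1 h2]

theorem cnt_super_le {s : ℕ} {m : Fin s → ℕ} {f g : Idx m → ℤ} (h : SuperStep f g) (t : ℕ) (x : ℤ) :
    cnt t x g ≤ cnt t x f := by
  rcases h with ⟨p, j, -, rfl⟩ | ⟨p, r, h1, h2, rfl⟩ | ⟨i, j, -, -, rfl⟩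
  · refine Finset.card_le_card fun k hk => ?_
    simp only [Finset.mem_filter, Finset.mem_univ, true_and] at hk ⊢
    refine ⟨hk.1, hk.2.trans ?_⟩
    by_cases h : k = p
    · subst h; simp [dFun]
    · simp [dFun, h]
  · exact cnt_swap_le h1 h2 t x
  · refine Finset.card_le_card fun k hk => ?_
    simpa [Equiv.swap_apply_of_ne_of_ne] using hk

open Classical in
-- The last block of f^♮ contains x exactly when that of `f` does not. Subtracting 1 - [x occurs]
-- from the multiplicity in the finite blocks leaves the weight minus 1.
theorem superCol_natural {s : ℕ} {m : Fin s → ℕ} (x : ℤ) (f : Label .ord m) :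
    ∃ N, ∀ n, N ≤ n → superCol n x (naturalLabel f).1 = (col x f.1 : ℤ) - 1 := by
  obtain ⟨M, hM⟩ := (naturalLabel f).2.2.2
  refine ⟨M + x.natAbs, fun n hn => ?_⟩
  have h1 : (∑ p, if (naturalLabel f).1 (.inl p) = x then (1 : ℤ) else 0) = mult x f.1 := by
    simp only [mult, Finset.card_filter]
    push_cast
    rfl
  have h2 : (∑ j ∈ Finset.range n, if (naturalLabel f).1 (.inr j) = x then (1 : ℤ) else 0) =
      1 - if Occ s x f.1 then 1 else 0 := by
    by_cases h : Occ s x f.1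
    · rw [if_pos h, sub_self]
      refine Finset.sum_eq_zero fun j _ => if_neg fun hj => ?_
      exact (occ_natural_last f x).mp (occ_last_iff.mpr ⟨j, hj⟩) h
    · rw [if_neg h, sub_zero]
      obtain ⟨j, hj⟩ := occ_last_iff.mp ((occ_natural_last f x).mpr h)
      have hjn : j ∈ Finset.range n := by
        rw [Finset.mem_range]
        by_contra hlt
        have := hM j (by omega)
        omega
      rw [Finset.sum_eq_single_of_mem j hjn, if_pos hj]
      intro k _ hk
      rw [if_neg]
      intro hk'
      exact hk ((naturalLabel f).2.2.1.injective (hk'.trans hj.symm))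
  unfold superCol col
  rw [h1, h2]
  split_ifs <;> push_cast <;> ring

/-- With `Below.dle`, this shows that `DLe` is a common coarsening of the Bruhat and the super
Bruhat ordering. -/
theorem Below.dle_of_natural {s : ℕ} {m : Fin s → ℕ} {f g : Label .ord m}
    (h : Below (naturalLabel g) (naturalLabel f)) : DLe g f := by
  have key : ∀ h : Idx m → ℤ, Relation.ReflTransGen SuperStep (naturalLabel f).1 h →
      (∃ N, ∀ n, N ≤ n → ∀ x, superCol n x h = superCol n x (naturalLabel f).1) ∧
      ∀ t x, cnt t x h ≤ cnt t x f.1 := by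
    intro h hh
    induction hh with
    | refl => exact ⟨⟨0, fun _ _ _ => rfl⟩, fun _ _ => le_rfl⟩
    | tail _ hst ih =>
      obtain ⟨⟨N, hN⟩, ih⟩ := ih
      obtain ⟨M, hM⟩ := superCol_step hst
      refine ⟨⟨N + M, fun n hn x => ?_⟩, fun t x => (cnt_super_le hst t x).trans (ih t x)⟩
      rw [hM n (by omega), hN n (by omega)]
  obtain ⟨⟨N, hN⟩, h2⟩ := key _ h
  refine ⟨fun x => ?_, h2⟩
  obtain ⟨N1, h1⟩ := superCol_natural x f
  obtain ⟨N2, h3⟩ := superCol_natural x g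
  have e := hN (N + N1 + N2) (by omega) x
  rw [h1 _ (by omega), h3 _ (by omega)] at e
  omega

end FockDuality

end

noncomputable section
namespace FockDuality
open Filter Topology

/-! ### Convergence and continuity -/

theorem tendsto_fock_iff {s : ℕ} {κ : Kind} {m : Fin s → ℕ} {ι : Type*} {F : ι → fockSpace κ m}
    {l : Filter ι} {u : fockSpace κ m} : Tendsto F l (𝓝 u) ↔
      ∀ n, ∀ᶠ i in l, ∀ g : Label κ m, Level κ n g.1 → (F i).1 g = u.1 g := by
  have h1 : 𝓝 u = ⨅ n : ℕ, Filter.comap (trunc n) (pure (trunc n u)) := by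
    rw [fockTopology, nhds_iInf]
    refine iInf_congr fun n => ?_
    rw [@nhds_induced _ _ ⊥, @nhds_discrete _ ⊥ (@DiscreteTopology.mk _ ⊥ rfl)]
  rw [h1, tendsto_iInf]
  refine forall_congr' fun n => ?_
  rw [tendsto_comap_iff, tendsto_pure]
  refine eventually_congr (Eventually.of_forall fun i => ?_)
  constructor
  · intro h g hg
    have := congrFun h g
    simpa [trunc, hg] using this
  · intro h
    funext g
    by_cases hg : Level κ n g.1
    · simpa [trunc, hg] using h g hg
    · simp [trunc, hg]

theorem Level.mono {s : ℕ} {κ : Kind} {m : Fin s → ℕ} {n n' : ℕ} (h : n ≤ n') {f : Idx m → ℤ}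
    (hf : Level κ n f) : Level κ n' f := by
  cases κ
  · exact fun j hj => hf j (h.trans hj)
  · intro j
    have := hf j
    omega

/-- Every coefficient of `X u` of level `n` depends on finitely many coefficients of `u`, those of a
certain level. -/
def IsLocal {s : ℕ} {κ κ' : Kind} {m : Fin s → ℕ} (X : fockSpace κ m → fockSpace κ' m) : Prop :=
  ∀ n, ∃ n', ∀ u, (∀ f : Label κ m, Level κ n' f.1 → u.1 f = 0) →
    ∀ g : Label κ' m, Level κ' n g.1 → (X u).1 g = 0

/-- If locality fails at level n, there are u_i vanishing on level i with X u_i nonzero on level n.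
They tend to 0, contrary to continuity. Only additivity is used, so the criterion covers anti-linear
maps. -/
theorem continuous_iff_isLocal {s : ℕ} {κ κ' : Kind} {m : Fin s → ℕ}
    {X : fockSpace κ m → fockSpace κ' m} (hX : ∀ u v, X (u - v) = X u - X v) :
    Continuous X ↔ IsLocal X := by
  have h0 : X 0 = 0 := by simpa using hX 0 0
  constructor
  · intro h n
    have h1 := tendsto_fock_iff.mp (h.tendsto 0) n
    by_contra hne
    push Not at hne
    choose u hu g hg hne using hne
    have h2 : Tendsto u atTop (𝓝 0) := by
      refine tendsto_fock_iff.mpr fun k => ?_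
      filter_upwards [eventually_ge_atTop k] with i hi f hf
      exact hu i f (hf.mono hi)
    obtain ⟨i, hi⟩ := (h2.eventually h1).exists
    refine hne i ?_
    rw [hi _ (hg i), h0]
    rfl
  · intro h
    rw [continuous_iff_continuousAt]
    intro u
    refine tendsto_fock_iff.mpr fun n => ?_
    obtain ⟨n', hn'⟩ := h n
    have h1 := tendsto_fock_iff.mp (tendsto_id (x := 𝓝 u)) n'
    filter_upwards [h1] with v hv g hg
    have := hn' (v - u) (fun f hf => sub_eq_zero.mpr (hv f hf)) g hg
    rw [hX] at this
    exact sub_eq_zero.mp this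

theorem monomial_apply_self {s : ℕ} {κ : Kind} {m : Fin s → ℕ} (f : Label κ m) :
    (monomial f).1 f = 1 := by
  classical
  simp [monomial]

theorem monomial_apply_ne {s : ℕ} {κ : Kind} {m : Fin s → ℕ} {f g : Label κ m} (h : g ≠ f) :
    (monomial f).1 g = 0 := by
  classical
  simp [monomial, h]

open Classical in
theorem monomial_apply {s : ℕ} {κ : Kind} {m : Fin s → ℕ} (f g : Label κ m) :
    (monomial f).1 g = if g = f then 1 else 0 := by
  split_ifs with h
  · rw [h, monomial_apply_self]
  · exact monomial_apply_ne h

theorem fock_ext {s : ℕ} {κ : Kind} {m : Fin s → ℕ} {u v : fockSpace κ m}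
    (h : ∀ g, u.1 g = v.1 g) : u = v := Subtype.ext (funext h)

theorem sum_apply {s : ℕ} {κ : Kind} {m : Fin s → ℕ} {ι : Type*} (S : Finset ι)
    (u : ι → fockSpace κ m) (g : Label κ m) : (∑ i ∈ S, u i).1 g = ∑ i ∈ S, (u i).1 g := by
  rw [AddSubmonoidClass.coe_finsetSum, Finset.sum_apply]

/-- A coefficient of `X u` is a finite sum over the coefficients of `u`. -/
theorem apply_eq_sum_of_isLocal {s : ℕ} {κ κ' : Kind} {m : Fin s → ℕ} {σ : Qq →+* Qq}
    (X : fockSpace κ m →ₛₗ[σ] fockSpace κ' m) (hX : IsLocal X) (u : fockSpace κ m)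
    (g : Label κ' m) : ∃ S : Finset (Label κ m), (∀ f ∈ S, u.1 f ≠ 0) ∧
      ∀ S', S ⊆ S' → (X u).1 g = ∑ f ∈ S', σ (u.1 f) * (X (monomial f)).1 g := by
  classical
  have hlev : ∃ n, Level κ' n g.1 := by
    cases κ'
    · exact exists_level g
    · refine ⟨(g.1 (.inr 0)).natAbs, fun j => ?_⟩
      have : g.1 (.inr 0) ≤ g.1 (.inr j) := g.2.2.1.monotone (Nat.zero_le j)
      omega
  obtain ⟨n, hn⟩ := hlev
  obtain ⟨n', hn'⟩ := hX n
  -- The support of `u` on level n' is finite. Subtracting the corresponding monomials leaves an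
  -- element whose image has coefficient 0 at `g`, by locality. Larger sets change nothing, since
  -- this uses only that they contain that support.
  refine ⟨(u.2 n').toFinset, fun f hf => ?_, fun S' hS' => ?_⟩
  · simp only [Set.Finite.mem_toFinset] at hf
    exact hf.1
  · have h1 := hn' (u - ∑ f ∈ S', u.1 f • monomial f) (fun f hf => ?_) g hn
    · rw [map_sub, map_sum] at h1
      have h2 : (X u).1 g - (∑ f ∈ S', X (u.1 f • monomial f)).1 g = 0 := h1
      rw [sum_apply] at h2
      rw [sub_eq_zero.mp h2]
      refine Finset.sum_congr rfl fun f _ => ?_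
      rw [map_smulₛₗ]
      rfl
    · change u.1 f - (∑ f ∈ S', u.1 f • monomial f).1 f = 0
      rw [sum_apply]
      have h3 : ∀ h ∈ S', (u.1 h • monomial h).1 f = if h = f then u.1 f else 0 := by
        intro h _
        change u.1 h * (monomial h).1 f = _
        rw [monomial_apply]
        by_cases e : f = h
        · subst e; simp
        · simp [e, Ne.symm e]
      rw [Finset.sum_congr rfl h3, Finset.sum_ite_eq']
      split_ifs with h4
      · exact sub_self _
      · rw [sub_zero]
        by_contra hne
        exact h4 (hS' ((Set.Finite.mem_toFinset _).mpr ⟨hne, hf⟩))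

/-- Topological form of linear extension: identities between local operators need only be checked on
monomials. -/
theorem ext_of_isLocal {s : ℕ} {κ κ' : Kind} {m : Fin s → ℕ} {σ : Qq →+* Qq}
    {X Y : fockSpace κ m →ₛₗ[σ] fockSpace κ' m} (hX : IsLocal X) (hY : IsLocal Y)
    (h : ∀ f, X (monomial f) = Y (monomial f)) : X = Y := by
  classical
  refine LinearMap.ext fun u => fock_ext fun g => ?_
  obtain ⟨S, -, hS⟩ := apply_eq_sum_of_isLocal X hX u g
  obtain ⟨T, -, hT⟩ := apply_eq_sum_of_isLocal Y hY u g
  rw [hS (S ∪ T) Finset.subset_union_left, hT (S ∪ T) Finset.subset_union_right]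
  simp only [h]

theorem isLocal_comp {s : ℕ} {κ κ' κ'' : Kind} {m : Fin s → ℕ}
    {X : fockSpace κ' m → fockSpace κ'' m} {Y : fockSpace κ m → fockSpace κ' m}
    (hX : IsLocal X) (hY : IsLocal Y) : IsLocal (X ∘ Y) := by
  intro n
  obtain ⟨n', hn'⟩ := hX n
  obtain ⟨n'', hn''⟩ := hY n'
  exact ⟨n'', fun u hu => hn' _ (hn'' u hu)⟩

theorem isLocal_add {s : ℕ} {κ κ' : Kind} {m : Fin s → ℕ}
    {X Y : fockSpace κ m → fockSpace κ' m} (hX : IsLocal X) (hY : IsLocal Y) :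
    IsLocal (fun u => X u + Y u) := by
  intro n
  obtain ⟨n', hn'⟩ := hX n
  obtain ⟨n'', hn''⟩ := hY n
  refine ⟨max n' n'', fun u hu g hg => ?_⟩
  change (X u).1 g + (Y u).1 g = 0
  rw [hn' u (fun f hf => hu f (hf.mono (le_max_left _ _))) g hg,
    hn'' u (fun f hf => hu f (hf.mono (le_max_right _ _))) g hg, add_zero]

theorem isLocal_diag {s : ℕ} {κ : Kind} {m : Fin s → ℕ} (w : Label κ m → Qq) :
    IsLocal (diag w) := fun n => ⟨n, fun u hu g hg => by
  change w g * u.1 g = 0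
  rw [hu g hg, mul_zero]⟩

theorem isLocal_hop {s : ℕ} {κ : Kind} {m : Fin s → ℕ} {t : ℕ} {a b : ℤ} (hab : |a - b| = 1) :
    IsLocal (hop κ m t a b) := by
  intro n
  refine ⟨n + a.natAbs + b.natAbs + 1, fun u hu g hg => ?_⟩
  rcases hop_cases (κ := κ) (m := m) (t := t) hab g with ⟨g', e, o, -, h⟩ | ⟨-, h⟩
  · rw [h]
    refine hu g' ?_
    rw [e]
    cases κ
    · intro j hj
      have := hg j (by omega)
      simp only [repl]
      rw [if_neg, this]
      rintro ⟨-, h⟩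
      omega
    · intro j
      have := hg j
      simp only [repl]
      split_ifs <;> omega
  · exact h u

/-! ### Triangular operators -/

/-- `g` is below `f`, and `g^♮` is below `f^♮`. -/
def BothBelow {s : ℕ} {m : Fin s → ℕ} (g f : Label .ord m) : Prop :=
  Below g f ∧ Below (naturalLabel g) (naturalLabel f)

theorem BothBelow.refl {s : ℕ} {m : Fin s → ℕ} (f : Label .ord m) : BothBelow f f :=
  ⟨Relation.ReflTransGen.refl, Relation.ReflTransGen.refl⟩

theorem BothBelow.trans {s : ℕ} {m : Fin s → ℕ} {f g h : Label .ord m} (h1 : BothBelow f g)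
    (h2 : BothBelow g h) : BothBelow f h :=
  ⟨Relation.ReflTransGen.trans h2.1 h1.1, Relation.ReflTransGen.trans h2.2 h1.2⟩

theorem BothBelow.dle {s : ℕ} {m : Fin s → ℕ} {f g : Label .ord m} (h : BothBelow f g) : DLe f g :=
  h.1.dle

/-- The operator given by a matrix supported below the diagonal. -/
def opOf {s : ℕ} {m : Fin s → ℕ} (A : Label .ord m → Label .ord m → Qq) :
    Module.End Qq (fockSpace .ord m) where
  toFun u := ⟨fun g => ∑ f ∈ Up g, u.1 f * A g f, fun n => by
    refine ((u.2 n).biUnion fun f _ => finite_down n f).subset ?_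
    rintro g ⟨h1, h2⟩
    obtain ⟨f, hf, hne⟩ := Finset.exists_ne_zero_of_sum_ne_zero h1
    rw [mem_Up] at hf
    simp only [Set.mem_iUnion]
    exact ⟨f, ⟨left_ne_zero_of_mul hne, hf.level h2⟩, h2, hf⟩⟩
  map_add' u v := fock_ext fun g => by
    change ∑ f ∈ Up g, (u.1 f + v.1 f) * A g f = _ + _
    simp only [add_mul, Finset.sum_add_distrib]
  map_smul' c u := fock_ext fun g => by
    change ∑ f ∈ Up g, (c * u.1 f) * A g f = c * _
    rw [Finset.mul_sum]
    exact Finset.sum_congr rfl fun f _ => mul_assoc _ _ _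

theorem opOf_apply {s : ℕ} {m : Fin s → ℕ} (A : Label .ord m → Label .ord m → Qq)
    (u : fockSpace .ord m) (g : Label .ord m) : (opOf A u).1 g = ∑ f ∈ Up g, u.1 f * A g f := rfl

theorem opOf_monomial {s : ℕ} {m : Fin s → ℕ} {A : Label .ord m → Label .ord m → Qq}
    (hA : ∀ g f, A g f ≠ 0 → DLe g f) (f g : Label .ord m) :
    (opOf A (monomial f)).1 g = A g f := by
  classical
  rw [opOf_apply]
  simp only [monomial_apply, ite_mul, one_mul, zero_mul]
  rw [Finset.sum_ite_eq']
  split_ifs with h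
  · rfl
  · by_contra hne
    exact h (mem_Up.mpr (hA g f (Ne.symm hne)))

/-- Operators given by triangular matrices with entries in `ℤ[q,q⁻¹]`. -/
structure IsTri {s : ℕ} {m : Fin s → ℕ} (X : Module.End Qq (fockSpace .ord m)) : Prop where
  apply : ∀ u g, (X u).1 g = ∑ f ∈ Up g, u.1 f * (X (monomial f)).1 g
  laurent : ∀ f g, (X (monomial f)).1 g ∈ laurentInt
  below : ∀ f g, (X (monomial f)).1 g ≠ 0 → BothBelow g f

theorem isTri_opOf {s : ℕ} {m : Fin s → ℕ} {A : Label .ord m → Label .ord m → Qq}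
    (h1 : ∀ g f, A g f ∈ laurentInt) (h2 : ∀ g f, A g f ≠ 0 → BothBelow g f) :
    IsTri (opOf A) := by
  have h3 : ∀ g f, A g f ≠ 0 → DLe g f := fun g f h => (h2 g f h).dle
  refine ⟨fun u g => ?_, fun f g => ?_, fun f g h => ?_⟩
  · simp only [opOf_monomial h3, opOf_apply]
  · rw [opOf_monomial h3]; exact h1 g f
  · rw [opOf_monomial h3] at h; exact h2 g f h

theorem isLocal_of_apply {s : ℕ} {m : Fin s → ℕ}
    {X : fockSpace .ord m → fockSpace .ord m}
    (h : ∀ u g, (∀ f, DLe g f → u.1 f = 0) → (X u).1 g = 0) : IsLocal X :=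
  fun n => ⟨n, fun u hu g hg => h u g fun f hf => hu f (hf.level hg)⟩

theorem IsTri.isLocal {s : ℕ} {m : Fin s → ℕ} {X : Module.End Qq (fockSpace .ord m)}
    (h : IsTri X) : IsLocal X :=
  isLocal_of_apply fun u g hu => by
    rw [h.apply]
    exact Finset.sum_eq_zero fun f hf => by rw [hu f (mem_Up.mp hf), zero_mul]

/-- Matrix multiplication over the finite intervals between two labels. On the diagonal,
antisymmetry of `DLe` leaves one term. -/
theorem IsTri.mul {s : ℕ} {m : Fin s → ℕ} {X Y : Module.End Qq (fockSpace .ord m)}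
    (hX : IsTri X) (hY : IsTri Y) : IsTri (X * Y) ∧ ∀ f, ((X * Y) (monomial f)).1 f =
      (X (monomial f)).1 f * (Y (monomial f)).1 f := by
  refine ⟨⟨fun u g => ?_, fun f g => ?_, fun f g h => ?_⟩, fun f => ?_⟩
  · simp only [Module.End.mul_apply]
    rw [hX.apply]
    simp only [hX.apply (Y _)]
    simp only [Finset.mul_sum]
    rw [Finset.sum_comm]
    refine Finset.sum_congr rfl fun h hh => ?_
    rw [hY.apply u h, Finset.sum_mul]
    have hsub : Up h ⊆ Up g := fun k hk => mem_Up.mpr ((mem_Up.mp hh).trans (mem_Up.mp hk))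
    rw [← Finset.sum_subset hsub]
    · exact Finset.sum_congr rfl fun k _ => by ring
    · intro k _ hk
      have : (Y (monomial k)).1 h = 0 := by
        by_contra hne
        exact hk (mem_Up.mpr (hY.below k h hne).dle)
      rw [this]; ring
  · rw [Module.End.mul_apply, hX.apply]
    exact sum_mem fun h _ => mul_mem (hY.laurent _ _) (hX.laurent _ _)
  · rw [Module.End.mul_apply, hX.apply] at h
    obtain ⟨k, -, hne⟩ := Finset.exists_ne_zero_of_sum_ne_zero h
    exact (hX.below k g (right_ne_zero_of_mul hne)).trans
      (hY.below f k (left_ne_zero_of_mul hne))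
  · rw [Module.End.mul_apply, hX.apply, Finset.sum_eq_single f, mul_comm]
    · intro k hk hkf
      have : (Y (monomial f)).1 k = 0 := by
        by_contra hne
        exact hkf ((hY.below f k hne).dle.antisymm (mem_Up.mp hk))
      rw [this, zero_mul]
    · intro h
      exact absurd (mem_Up.mpr (DLe.refl f)) h

theorem isTri_one {s : ℕ} {m : Fin s → ℕ} : IsTri (1 : Module.End Qq (fockSpace .ord m)) := by
  classical
  refine ⟨fun u g => ?_, fun f g => ?_, fun f g h => ?_⟩
  · simp only [Module.End.one_apply, monomial_apply, mul_ite, mul_one, mul_zero]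
    rw [Finset.sum_ite_eq, if_pos (mem_Up.mpr (DLe.refl g))]
  · rw [Module.End.one_apply, monomial_apply]
    split_ifs
    · exact one_mem _
    · exact zero_mem _
  · rw [Module.End.one_apply] at h
    by_cases e : g = f
    · subst e; exact BothBelow.refl g
    · exact absurd (monomial_apply_ne e) h

end FockDuality

end

/-! ### Chains in the Bruhat and super Bruhat orderings. -/

noncomputable section
namespace FockDuality
open Relation

/-- A sequence arises from its decreasing rearrangement by exchanging entries in decreasing order. -/
theorem arrange {ι α : Type} [LinearOrder α] [DecidableEq ι] {R : (ι → α) → (ι → α) → Prop} {n : ℕ}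
    (e : Fin n → ι) (he : Function.Injective e)
    (hR : ∀ f i j, i < j → f (e j) < f (e i) → R f (f ∘ Equiv.swap (e i) (e j)))
    (f h : ι → α) (hoff : ∀ i, (∀ k, e k ≠ i) → f i = h i) (hf : StrictAnti (f ∘ e))
    (hr : Set.range (f ∘ e) = Set.range (h ∘ e)) (hh : Function.Injective (h ∘ e)) :
    ReflTransGen R f h := by
  -- Functions equal to `f` off the image of `e`, with the remaining entries prescribed. The chain
  -- stays among these.
  let emb : (Fin n → α) → ι → α := fun u => Function.extend e u f
  have hembe : ∀ u k, emb u (e k) = u k := fun u k => he.extend_apply u f k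
  have hembo : ∀ u i, (∀ k, e k ≠ i) → emb u i = f i := fun u i hi =>
    Function.extend_apply' u f i (by rintro ⟨k, hk⟩; exact hi k hk)
  -- Bubble sort with the order reversed leads from `h` to the decreasing arrangement. Each of its
  -- transpositions is undone by one step of `R`, so the chain towards `h` grows at its upper end.
  have key := Tuple.bubble_sort_induction (α := αᵒᵈ) (f := OrderDual.toDual ∘ h ∘ e)
    (P := fun u => ReflTransGen R (emb (OrderDual.ofDual ∘ u)) h) ?_ ?_
  · have h1 : OrderDual.ofDual ∘ ((OrderDual.toDual ∘ h ∘ e) ∘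
        Tuple.sort (OrderDual.toDual ∘ h ∘ e)) = f ∘ e := by
      have hm := Tuple.monotone_sort (OrderDual.toDual ∘ h ∘ e)
      have hs := hm.strictMono_of_injective
        ((OrderDual.toDual.injective.comp hh).comp (Equiv.injective _))
      have := (StrictMono.range_inj hs hf.dual_right).mp (by
        rw [Set.range_comp (OrderDual.toDual ∘ h ∘ e), Equiv.range_eq_univ, Set.image_univ,
          Set.range_comp OrderDual.toDual, Set.range_comp OrderDual.toDual, hr])
      rw [this]
      rfl
    have h2 : emb (f ∘ e) = f := by
      funext i
      by_cases hi : ∃ k, e k = i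
      · obtain ⟨k, rfl⟩ := hi
        exact hembe _ k
      · push Not at hi
        exact hembo _ i hi
    rw [h1, h2] at key
    exact key
  · have : emb (h ∘ e) = h := by
      funext i
      by_cases hi : ∃ k, e k = i
      · obtain ⟨k, rfl⟩ := hi
        exact hembe _ k
      · push Not at hi
        rw [hembo _ i hi, hoff i hi]
    change ReflTransGen R (emb (h ∘ e)) h
    rw [this]
  · intro g i j hij hg ih
    refine ReflTransGen.head ?_ ih
    have h1 := hR (emb (OrderDual.ofDual ∘ g ∘ Equiv.swap i j)) i j hij (by
      rw [hembe, hembe]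
      simpa using hg)
    convert h1 using 1
    funext x
    by_cases hx : ∃ k, e k = x
    · obtain ⟨k, rfl⟩ := hx
      have hsw : Equiv.swap (e i) (e j) (e k) = e (Equiv.swap i j k) := by
        by_cases h1 : k = i
        · subst h1; simp
        · by_cases h2 : k = j
          · subst h2; simp
          · rw [Equiv.swap_apply_of_ne_of_ne h1 h2,
              Equiv.swap_apply_of_ne_of_ne (he.ne h1) (he.ne h2)]
      rw [Function.comp_apply, hsw, hembe, hembe]
      simp
    · push Not at hx
      rw [Function.comp_apply, Equiv.swap_apply_of_ne_of_ne (hx i).symm (hx j).symm, hembo _ x hx,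
        hembo _ x hx]

/-- The elementary steps generating the ordering `Below`. -/
def KStep {s : ℕ} {m : Fin s → ℕ} : Kind → (Idx m → ℤ) → (Idx m → ℤ) → Prop
  | .ord => BruhatStep
  | .sup => SuperStep

theorem below_iff {s : ℕ} {m : Fin s → ℕ} {κ : Kind} {f g : Label κ m} :
    Below g f ↔ ReflTransGen (KStep κ) f.1 g.1 := by
  cases κ <;> rfl

theorem kStep_inl {s : ℕ} {m : Fin s → ℕ} (κ : Kind) (f : Idx m → ℤ) {p r : Σ t, Fin (m t)}
    (h : Before (.inl p : Idx m) (.inl r)) (hlt : f (.inl r) < f (.inl p)) :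
    KStep κ f (f ∘ Equiv.swap (.inl p) (.inl r)) := by
  cases κ
  · exact ⟨_, _, h, hlt, rfl⟩
  · exact Or.inr (Or.inl ⟨_, _, h, hlt, rfl⟩)

/-- Rearranging one block of a label goes down. -/
theorem arrange_block {s : ℕ} {m : Fin s → ℕ} {κ : Kind} {t : ℕ} (f : Label κ m) (f₀ h : Idx m → ℤ)
    (hf₀ : ∀ i, block i = t → f₀ i = f.1 i) (hoff : ∀ i, block i ≠ t → f₀ i = h i)
    (hinj : ∀ i j, block i = t → block j = t → h i = h j → i = j)
    (hocc : ∀ x, Occ t x h ↔ Occ t x f.1) (htail : ∃ N : ℕ, ∀ j, N ≤ j → h (.inr j) = f₀ (.inr j)) :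
    ReflTransGen (KStep κ) f₀ h := by
  rcases lt_trichotomy t s with ht | rfl | ht
  · have hocc' := fun x => (occ_lt_iff (t := ⟨t, ht⟩) (x := x) (f := h)).symm.trans
      ((hocc x).trans (occ_lt_iff (t := ⟨t, ht⟩) (x := x) (f := f.1)))
    have e1 : (f₀ ∘ fun k => (.inl ⟨⟨t, ht⟩, k⟩ : Idx m)) = fun k => f.1 (.inl ⟨⟨t, ht⟩, k⟩) := by
      funext k
      exact hf₀ _ rfl
    refine arrange (fun k : Fin (m ⟨t, ht⟩) => (.inl ⟨⟨t, ht⟩, k⟩ : Idx m)) ?_ ?_ _ _ ?_ ?_ ?_ ?_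
    · intro k k' hk
      simpa using hk
    · intro u i j hij hlt
      exact kStep_inl κ u (Or.inr ⟨rfl, hij⟩) hlt
    · rintro (⟨t', k⟩ | j) hi
      · refine hoff _ fun h => hi ?_ ?_
        · have : t' = ⟨t, ht⟩ := Fin.ext h
          subst this
          exact k
        · have : t' = ⟨t, ht⟩ := Fin.ext h
          subst this
          rfl
      · exact hoff _ (ne_of_gt ht)
    · rw [e1]
      exact f.2.1 ⟨t, ht⟩
    · rw [e1]
      ext x
      exact (hocc' x).symm
    · intro k k' hk
      simpa using hinj (.inl ⟨⟨t, ht⟩, k⟩) (.inl ⟨⟨t, ht⟩, k'⟩) rfl rfl hk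
  · obtain ⟨N, hN⟩ := htail
    have hocc' := fun x => (occ_last_iff (x := x) (f := h)).symm.trans
      ((hocc x).trans (occ_last_iff (x := x) (f := f.1)))
    have e0 : ∀ k, f₀ (.inr k) = f.1 (.inr k) := fun k => hf₀ _ rfl
    have hinjf : ∀ k l, f.1 (.inr k) = f.1 (.inr l) → k = l := fun k l hkl =>
      Sum.inr_injective (f.2.inj (i := .inr k) (j := .inr l) rfl hkl)
    have e1 : (f₀ ∘ fun k : Fin N => (.inr k : Idx m)) = fun k : Fin N => f.1 (.inr k) := by
      funext k
      exact e0 k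
    have hinj' : Function.Injective fun k : Fin N => (.inr k : Idx m) := fun k k' hk =>
      Fin.ext (Sum.inr_injective hk)
    have hoff' : ∀ i : Idx m, (∀ k : Fin N, (.inr k : Idx m) ≠ i) → f₀ i = h i := by
      rintro (p | j) hi
      · exact hoff _ (ne_of_lt p.1.2)
      · refine (hN j ?_).symm
        by_contra hj
        exact hi ⟨j, not_le.mp hj⟩ rfl
    -- Both functions have the same entries in the last block and agree from position N on. As the
    -- entries are distinct, the first N positions carry the same values.
    have hr : Set.range (f₀ ∘ fun k : Fin N => (.inr k : Idx m)) =
        Set.range (h ∘ fun k : Fin N => (.inr k : Idx m)) := by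
      rw [e1]
      ext x
      constructor
      · rintro ⟨k, rfl⟩
        obtain ⟨j, hj⟩ := (hocc' (f.1 (.inr k))).mpr ⟨k, rfl⟩
        have hjN : j < N := by
          by_contra hge
          rw [hN j (not_lt.mp hge), e0] at hj
          have := hinjf _ _ hj
          omega
        exact ⟨⟨j, hjN⟩, hj⟩
      · rintro ⟨k, rfl⟩
        obtain ⟨j, hj⟩ := (hocc' (h (.inr k))).mp ⟨k, rfl⟩
        have hjN : j < N := by
          by_contra hge
          rw [← e0, ← hN j (not_lt.mp hge)] at hj
          have := Sum.inr_injective (hinj (.inr j) (.inr k) rfl rfl hj)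
          omega
        exact ⟨⟨j, hjN⟩, hj⟩
    have hh : Function.Injective (h ∘ fun k : Fin N => (.inr k : Idx m)) := fun k k' hk =>
      hinj' (hinj _ _ rfl rfl hk)
    cases κ
    · refine arrange (fun k : Fin N => (.inr k : Idx m)) hinj' ?_ _ _ hoff' ?_ hr hh
      · intro u i j hij hlt
        exact ⟨.inr i, .inr j, show (i : ℕ) < j from hij, hlt, rfl⟩
      · rw [e1]
        exact fun k k' hk => f.2.2.1 hk
    -- For the super ordering the last block increases, so the values are compared in the opposite
    -- order.
    · refine arrange (α := ℤᵒᵈ) (fun k : Fin N => (.inr k : Idx m)) hinj' ?_ _ _ hoff' ?_ hr hh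
      · intro u i j hij hlt
        exact Or.inr (Or.inr ⟨_, _, hij, hlt, rfl⟩)
      · intro k k' hk
        change f₀ (.inr k) < f₀ (.inr k')
        rw [e0, e0]
        exact f.2.2.1 hk
  · have : f₀ = h := by
      funext i
      refine hoff i ?_
      rcases i with p | j
      · have := p.1.2
        simp only [block]
        omega
      · simp only [block]
        omega
    rw [this]

/-- The two blocks are rearranged one after the other, passing through the function that agrees with
`h` on block `t` and with `f` elsewhere. -/
theorem arrange_two {s : ℕ} {m : Fin s → ℕ} {κ : Kind} {t t' : ℕ} (htt : t ≠ t') (f : Label κ m)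
    (h : Idx m → ℤ) (hoff : ∀ i, block i ≠ t → block i ≠ t' → f.1 i = h i)
    (hinj : ∀ i j, block i = block j → h i = h j → i = j)
    (hocc : ∀ u x, Occ u x h ↔ Occ u x f.1)
    (htail : ∃ N : ℕ, ∀ j, N ≤ j → h (.inr j) = f.1 (.inr j)) : ReflTransGen (KStep κ) f.1 h := by
  classical
  obtain ⟨N, hN⟩ := htail
  let h₁ : Idx m → ℤ := fun i => if block i = t then h i else f.1 i
  have e1 : ∀ i, block i = t → h₁ i = h i := fun i hi => if_pos hi
  have e2 : ∀ i, block i ≠ t → h₁ i = f.1 i := fun i hi => if_neg hi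
  refine ReflTransGen.trans (b := h₁) (arrange_block (t := t) f f.1 h₁ (fun _ _ => rfl)
    (fun i hi => (e2 i hi).symm) ?_ ?_ ⟨N, fun j hj => ?_⟩)
    (arrange_block (t := t') f h₁ h ?_ ?_ ?_ (hocc t') ⟨N, fun j hj => ?_⟩)
  · intro i j hi hj hij
    rw [e1 i hi, e1 j hj] at hij
    exact hinj i j (hi.trans hj.symm) hij
  · intro x
    rw [← hocc t x]
    constructor
    · rintro ⟨i, hi, hx⟩
      exact ⟨i, hi, by rw [← e1 i hi, hx]⟩
    · rintro ⟨i, hi, hx⟩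
      exact ⟨i, hi, by rw [e1 i hi, hx]⟩
  · by_cases hb : block (.inr j : Idx m) = t
    · rw [e1 _ hb, hN j hj]
    · exact e2 _ hb
  · intro i hi
    exact e2 i (by rw [hi]; exact htt.symm)
  · intro i hi
    by_cases hb : block i = t
    · exact e1 i hb
    · rw [e2 i hb, hoff i hb hi]
  · intro i j hi hj hij
    exact hinj i j (hi.trans hj.symm) hij
  · by_cases hb : block (.inr j : Idx m) = t
    · rw [e1 _ hb]
    · rw [e2 _ hb, hN j hj]

/-! ### Exchanging several entries of two blocks -/

/-- The product of the transpositions of `a k` and `b k`, for `k` in a list. -/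
def exchPerm {r : ℕ} (a b : Fin r → ℤ) : List (Fin r) → Equiv.Perm ℤ
  | [] => 1
  | k :: l => Equiv.swap (a k) (b k) * exchPerm a b l

theorem exchPerm_fix {r : ℕ} {a b : Fin r → ℤ} (l : List (Fin r)) {x : ℤ}
    (ha : ∀ k ∈ l, x ≠ a k) (hb : ∀ k ∈ l, x ≠ b k) : exchPerm a b l x = x := by
  induction l with
  | nil => rfl
  | cons k l ih =>
    rw [exchPerm, Equiv.Perm.mul_apply, ih (fun k hk => ha k (List.mem_cons_of_mem _ hk))
      (fun k hk => hb k (List.mem_cons_of_mem _ hk))]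
    exact Equiv.swap_apply_of_ne_of_ne (ha k (by simp)) (hb k (by simp))

theorem exchPerm_apply {r : ℕ} {a b : Fin r → ℤ} (ha : Function.Injective a)
    (hb : Function.Injective b) (hab : ∀ k l, a k ≠ b l) {l : List (Fin r)} (hl : l.Nodup)
    {k : Fin r} (hk : k ∈ l) : exchPerm a b l (a k) = b k ∧ exchPerm a b l (b k) = a k := by
  induction l with
  | nil => simp at hk
  | cons j l ih =>
    rw [List.nodup_cons] at hl
    simp only [exchPerm, Equiv.Perm.mul_apply]
    by_cases hkj : k = j
    · subst hkj
      have hne : ∀ i ∈ l, k ≠ i := fun i hi h => hl.1 (h ▸ hi)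
      rw [exchPerm_fix l (fun i hi => ha.ne (hne i hi)) (fun i _ => hab _ _),
        exchPerm_fix l (fun i _ => (hab _ _).symm) (fun i hi => hb.ne (hne i hi))]
      simp
    · have hk' : k ∈ l := by simpa [hkj] using hk
      obtain ⟨h1, h2⟩ := ih hl.2 hk'
      rw [h1, h2]
      exact ⟨Equiv.swap_apply_of_ne_of_ne (hab _ _).symm (hb.ne hkj),
        Equiv.swap_apply_of_ne_of_ne (ha.ne hkj) (hab _ _)⟩

open Classical in
/-- Exchange the values `a k` and `b k` in the blocks `t` and `t'`. -/
def exchFun {s : ℕ} {m : Fin s → ℕ} (t t' : ℕ) (g : Idx m → ℤ) {r : ℕ} (a b : Fin r → ℤ)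
    (l : List (Fin r)) : Idx m → ℤ :=
  fun i => if block i = t ∨ block i = t' then exchPerm a b l (g i) else g i

theorem occ_exchFun {s : ℕ} {m : Fin s → ℕ} {t t' : ℕ} {g : Idx m → ℤ} {r : ℕ} {a b : Fin r → ℤ}
    {l : List (Fin r)} {u : ℕ} (hu : u = t ∨ u = t') (x : ℤ) :
    Occ u (exchPerm a b l x) (exchFun t t' g a b l) ↔ Occ u x g := by
  constructor
  · rintro ⟨i, rfl, hx⟩
    simp only [exchFun, hu, if_true] at hx
    exact ⟨i, rfl, (exchPerm a b l).injective hx⟩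
  · rintro ⟨i, rfl, rfl⟩
    exact ⟨i, rfl, by simp only [exchFun, hu, if_true]⟩

theorem exists_tail {s : ℕ} {m : Fin s → ℕ} {κ : Kind} (f g : Label κ m) (l : List ℤ) :
    ∃ N : ℕ, ∀ j, N ≤ j → f.1 (.inr j) = g.1 (.inr j) ∧ g.1 (.inr j) ∉ l := by
  have hl : ∃ M : ℕ, ∀ x ∈ l, x.natAbs < M := by
    induction l with
    | nil => exact ⟨0, by simp⟩
    | cons y l ih =>
      obtain ⟨M, hM⟩ := ih
      refine ⟨M + y.natAbs + 1, fun x hx => ?_⟩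
      rcases List.mem_cons.mp hx with rfl | hx
      · omega
      · have := hM x hx
        omega
  obtain ⟨M, hM⟩ := hl
  cases κ
  · obtain ⟨N1, h1⟩ := f.2.2.2
    obtain ⟨N2, h2⟩ := g.2.2.2
    refine ⟨N1 + N2 + M, fun j hj => ?_⟩
    rw [h1 j (by omega), h2 j (by omega)]
    refine ⟨rfl, fun h => ?_⟩
    have := hM _ h
    omega
  · obtain ⟨N1, h1⟩ := f.2.2.2
    obtain ⟨N2, h2⟩ := g.2.2.2
    refine ⟨N1 + N2 + M, fun j hj => ?_⟩
    rw [h1 j (by omega), h2 j (by omega)]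
    refine ⟨rfl, fun h => ?_⟩
    have := hM _ h
    omega

theorem inl_eq_of_occ {s : ℕ} {m : Fin s → ℕ} {κ : Kind} {f g : Label κ m} {u : ℕ}
    (h : ∀ x, Occ u x f.1 ↔ Occ u x g.1) {i : Idx m} (hi : block i = u) : f.1 i = g.1 i := by
  rcases i with ⟨t, k⟩ | j
  · subst hi
    refine congrFun (strictAnti_range_inj (f.2.1 t) (g.2.1 t) ?_) k
    ext x
    have := h x
    simp only [block] at this
    rwa [occ_lt_iff, occ_lt_iff] at this
  · subst hi
    have hr : Set.range (fun j => f.1 (.inr j)) = Set.range (fun j => g.1 (.inr j)) := by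
      ext x
      have := h x
      simp only [block] at this
      rwa [occ_last_iff, occ_last_iff] at this
    cases κ
    · exact congrFun (strictAnti_range_inj f.2.2.1 g.2.2.1 hr) j
    · exact congrFun ((StrictMono.range_inj f.2.2.1 g.2.2.1).mp hr) j

/-- Exchanging all the values a k and b k in both blocks of `g` gives an unsorted function with the
same entries as `f` in every block. From `f` one descends to it by rearranging. From there the
exchanges are undone one at a time, each going down by `hstep`. -/
theorem below_of_exch {s : ℕ} {m : Fin s → ℕ} {κ : Kind} {f g : Label κ m} {t t' : ℕ}
    (htt : t ≠ t') {r : ℕ} {a b : Fin r → ℤ} (ha : Function.Injective a)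
    (hb : Function.Injective b) (hab : ∀ k l, a k ≠ b l)
    (hother : ∀ u, u ≠ t → u ≠ t' → ∀ x, Occ u x f.1 ↔ Occ u x g.1)
    (hrest : ∀ u, u = t ∨ u = t' → ∀ x, (∀ k, x ≠ a k) → (∀ k, x ≠ b k) →
      (Occ u x f.1 ↔ Occ u x g.1))
    (hocc : ∀ u, u = t ∨ u = t' → ∀ k, (Occ u (a k) f.1 ↔ Occ u (b k) g.1) ∧
      (Occ u (b k) f.1 ↔ Occ u (a k) g.1))
    (hstep : ∀ k l, k ∉ l → ReflTransGen (KStep κ) (exchFun t t' g.1 a b (k :: l))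
      (exchFun t t' g.1 a b l)) : Below g f := by
  rw [below_iff]
  have h1 : ∀ l : List (Fin r), l.Nodup →
      ReflTransGen (KStep κ) (exchFun t t' g.1 a b l) g.1 := by
    intro l hl
    induction l with
    | nil =>
      have : exchFun t t' g.1 a b [] = g.1 := by
        funext i
        simp [exchFun, exchPerm]
      rw [this]
    | cons k l ih =>
      rw [List.nodup_cons] at hl
      exact (hstep k l hl.1).trans (ih hl.2)
  refine ReflTransGen.trans ?_ (h1 _ (List.nodup_finRange r))
  set l := List.finRange r with hl
  have hap := fun k => exchPerm_apply ha hb hab (List.nodup_finRange r) (List.mem_finRange k)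
  refine arrange_two htt f _ ?_ ?_ ?_ ?_
  · intro i h1 h2
    simp only [exchFun, h1, h2, or_self, if_false]
    exact inl_eq_of_occ (hother _ h1 h2) rfl
  · intro i j hij h
    simp only [exchFun, hij] at h
    split_ifs at h
    · exact g.2.inj hij ((exchPerm a b l).injective h)
    · exact g.2.inj hij h
  · intro u x
    by_cases hu : u = t ∨ u = t'
    · obtain ⟨y, rfl⟩ := (exchPerm a b l).surjective x
      rw [occ_exchFun hu]
      by_cases hya : ∃ k, y = a k
      · obtain ⟨k, rfl⟩ := hya
        rw [(hap k).1]
        exact (hocc u hu k).2.symm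
      · by_cases hyb : ∃ k, y = b k
        · obtain ⟨k, rfl⟩ := hyb
          rw [(hap k).2]
          exact (hocc u hu k).1.symm
        · push Not at hya hyb
          rw [exchPerm_fix l (fun k _ => hya k) (fun k _ => hyb k)]
          exact (hrest u hu y hya hyb).symm
    · push Not at hu
      rw [hother u hu.1 hu.2]
      constructor
      · rintro ⟨i, rfl, rfl⟩
        exact ⟨i, rfl, by simp only [exchFun, hu.1, hu.2, or_self, if_false]⟩
      · rintro ⟨i, rfl, rfl⟩
        exact ⟨i, rfl, by simp only [exchFun, hu.1, hu.2, or_self, if_false]⟩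
  · obtain ⟨N, hN⟩ := exists_tail f g (List.ofFn a ++ List.ofFn b)
    refine ⟨N, fun j hj => ?_⟩
    obtain ⟨h1, h2⟩ := hN j hj
    simp only [List.mem_append, List.mem_ofFn, not_or, not_exists] at h2
    rw [h1]
    simp only [exchFun]
    split_ifs
    · exact exchPerm_fix l (fun k _ h => h2.1 k h.symm) (fun k _ h => h2.2 k h.symm)
    · rfl

theorem exchFun_cons {s : ℕ} {m : Fin s → ℕ} {t t' : ℕ} {g : Idx m → ℤ} {r : ℕ} {a b : Fin r → ℤ}
    (ha : Function.Injective a) (hb : Function.Injective b) (hab : ∀ k l, a k ≠ b l) {k : Fin r}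
    {l : List (Fin r)} (hk : k ∉ l) :
    (∀ i, (block i = t ∨ block i = t') → g i = a k → exchFun t t' g a b (k :: l) i = b k ∧
      exchFun t t' g a b l i = a k) ∧
    (∀ i, (block i = t ∨ block i = t') → g i = b k → exchFun t t' g a b (k :: l) i = a k ∧
      exchFun t t' g a b l i = b k) ∧
    (∀ i, ((block i = t ∨ block i = t') → g i ≠ a k ∧ g i ≠ b k) →
      exchFun t t' g a b (k :: l) i = exchFun t t' g a b l i) := by
  have hne : ∀ i ∈ l, k ≠ i := fun i hi h => hk (h ▸ hi)
  have f1 : exchPerm a b l (a k) = a k :=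
    exchPerm_fix l (fun i hi => ha.ne (hne i hi)) (fun i _ => hab _ _)
  have f2 : exchPerm a b l (b k) = b k :=
    exchPerm_fix l (fun i _ => (hab _ _).symm) (fun i hi => hb.ne (hne i hi))
  refine ⟨fun i hi h => ?_, fun i hi h => ?_, fun i h => ?_⟩
  · simp only [exchFun, hi, if_true, h, exchPerm, Equiv.Perm.mul_apply, f1]
    simp
  · simp only [exchFun, hi, if_true, h, exchPerm, Equiv.Perm.mul_apply, f2]
    simp
  · simp only [exchFun, exchPerm, Equiv.Perm.mul_apply]
    split_ifs with hi
    · obtain ⟨h1, h2⟩ := h hi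
      refine Equiv.swap_apply_of_ne_of_ne (fun h3 => h1 ?_) (fun h3 => h2 ?_)
      · exact (exchPerm a b l).injective (h3.trans f1.symm)
      · exact (exchPerm a b l).injective (h3.trans f2.symm)
    · rfl

theorem before_of_block_lt {s : ℕ} {m : Fin s → ℕ} {i j : Idx m} (h : block i < block j) :
    Before i j := by
  rcases i with p | i <;> rcases j with r | j
  · exact Or.inl h
  · trivial
  · exact absurd h (not_lt.mpr r.1.2.le)
  · exact absurd h (lt_irrefl _)

/-- The two positions always carry equal entries, so a step of type (i) can be applied `n` times in
succession. -/
theorem superStep_repeat {s : ℕ} {m : Fin s → ℕ} (p : Σ t, Fin (m t)) (j : ℕ) (h h' : Idx m → ℤ)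
    (n : ℕ) (e1 : h (.inl p) = h' (.inl p) + n) (e2 : h (.inr j) = h' (.inl p) + n)
    (e3 : h' (.inr j) = h' (.inl p)) (e4 : ∀ i, i ≠ .inl p → i ≠ .inr j → h i = h' i) :
    ReflTransGen SuperStep h h' := by
  induction n generalizing h with
  | zero =>
    have : h = h' := by
      funext i
      by_cases h1 : i = .inl p
      · subst h1; simpa using e1
      · by_cases h2 : i = .inr j
        · subst h2; rw [e3]; simpa using e2
        · exact e4 i h1 h2
    rw [this]
  | succ n ih =>
    refine ReflTransGen.head (b := h - dFun (.inl p) + dFun (.inr j))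
      (Or.inl ⟨p, j, e1.trans e2.symm, rfl⟩) (ih _ ?_ ?_ ?_)
    · simp [dFun, e1]; ring
    · simp [dFun, e2]; ring
    · intro i h1 h2
      simp [dFun, h1, h2, e4 i h1 h2]

/-- Exchanging entries `a k` of block `t` with smaller entries `b k` of the later block `t'` goes
down, both in the Bruhat ordering and in the super Bruhat ordering. -/
theorem bothBelow_of_exch {s : ℕ} {m : Fin s → ℕ} {f g : Label .ord m} {t t' : ℕ}
    (htt : t < t') (ht's : t' ≤ s) {r : ℕ} {a b : Fin r → ℤ} (ha : Function.Injective a)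
    (hb : Function.Injective b) (hlt : ∀ k, b k < a k)
    (hother : ∀ u, u ≠ t → u ≠ t' → ∀ x, Occ u x f.1 ↔ Occ u x g.1)
    (hrest : ∀ u, u = t ∨ u = t' → ∀ x, (∀ k, x ≠ a k) → (∀ k, x ≠ b k) →
      (Occ u x f.1 ↔ Occ u x g.1))
    (h1 : ∀ k, Occ t (a k) f.1 ∧ ¬ Occ t (a k) g.1 ∧ Occ t (b k) g.1 ∧ ¬ Occ t (b k) f.1)
    (h2 : ∀ k, Occ t' (b k) f.1 ∧ ¬ Occ t' (b k) g.1 ∧ Occ t' (a k) g.1 ∧ ¬ Occ t' (a k) f.1) :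
    BothBelow g f := by
  have hab : ∀ k l, a k ≠ b l := fun k l h => (h1 k).2.1 (h ▸ (h1 l).2.2.1)
  have hswap : ∀ (κ : Kind) (g' : Label κ m), (∀ k, ¬ Occ t (a k) g'.1 ∧ Occ t (b k) g'.1) →
      (∀ k, ¬ Occ t' (b k) g'.1 ∧ Occ t' (a k) g'.1) →
      (∀ (h : Idx m → ℤ) (i j : Idx m), block i = t → block j = t' → h j < h i →
        KStep κ h (h ∘ Equiv.swap i j)) →
      ∀ k l, k ∉ l → ReflTransGen (KStep κ) (exchFun t t' g'.1 a b (k :: l))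
        (exchFun t t' g'.1 a b l) := by
    intro κ g' hg1 hg2 hK k l hk
    obtain ⟨i, hi, hib⟩ := (hg1 k).2
    obtain ⟨j, hj, hja⟩ := (hg2 k).2
    obtain ⟨c1, c2, c3⟩ := exchFun_cons (t := t) (t' := t') (g := g'.1) ha hb hab hk
    have d1 := c1 j (Or.inr hj) hja
    have d2 := c2 i (Or.inl hi) hib
    refine ReflTransGen.single ?_
    convert hK (exchFun t t' g'.1 a b (k :: l)) i j hi hj (by rw [d1.1, d2.1]; exact hlt k) using 1
    funext x
    by_cases hxi : x = i
    · subst hxi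
      rw [Function.comp_apply, Equiv.swap_apply_left, d1.1, d2.2]
    · by_cases hxj : x = j
      · subst hxj
        rw [Function.comp_apply, Equiv.swap_apply_right, d1.2, d2.1]
      · rw [Function.comp_apply, Equiv.swap_apply_of_ne_of_ne hxi hxj]
        refine (c3 x ?_).symm
        rintro (hx | hx)
        · exact ⟨fun h => (hg1 k).1 ⟨x, hx, h⟩,
            fun h => hxi (g'.2.inj (hx.trans hi.symm) (h.trans hib.symm))⟩
        · exact ⟨fun h => hxj (g'.2.inj (hx.trans hj.symm) (h.trans hja.symm)),
            fun h => (hg2 k).1 ⟨x, hx, h⟩⟩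
  constructor
  · refine below_of_exch htt.ne ha hb hab hother hrest ?_
      (hswap .ord g (fun k => ⟨(h1 k).2.1, (h1 k).2.2.1⟩) (fun k => ⟨(h2 k).2.1, (h2 k).2.2.1⟩)
        fun h i j hi hj hlt => ⟨i, j, before_of_block_lt (by rw [hi, hj]; exact htt), hlt, rfl⟩)
    rintro u (rfl | rfl) k
    · simp [h1 k]
    · simp [h2 k]
  · have hts : t ≠ s := by omega
    have hocc_t := fun f : Label .ord m => occ_natural_of_lt f hts
    have hother' : ∀ u, u ≠ t → u ≠ t' → ∀ x, Occ u x (naturalLabel f).1 ↔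
        Occ u x (naturalLabel g).1 := by
      intro u hu hu' x
      by_cases hus : u = s
      · subst hus
        rw [occ_natural_last, occ_natural_last, hother u hu hu' x]
      · rw [occ_natural_of_lt f hus, occ_natural_of_lt g hus, hother u hu hu' x]
    have hrest' : ∀ u, u = t ∨ u = t' → ∀ x, (∀ k, x ≠ a k) → (∀ k, x ≠ b k) →
        (Occ u x (naturalLabel f).1 ↔ Occ u x (naturalLabel g).1) := by
      intro u hu x hx hx'
      by_cases hus : u = s
      · subst hus
        rw [occ_natural_last, occ_natural_last, hrest u hu x hx hx']
      · rw [occ_natural_of_lt f hus, occ_natural_of_lt g hus, hrest u hu x hx hx']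
    rcases ht's.lt_or_eq with ht' | rfl
    · have hocc_t' := fun f : Label .ord m => occ_natural_of_lt f ht'.ne
      refine below_of_exch htt.ne ha hb hab hother' hrest' ?_
        (hswap .sup (naturalLabel g) (fun k => ?_) (fun k => ?_) ?_)
      · rintro u (rfl | rfl) k
        · simp [hocc_t, h1 k]
        · simp [hocc_t', h2 k]
      · rw [hocc_t, hocc_t]; exact ⟨(h1 k).2.1, (h1 k).2.2.1⟩
      · rw [hocc_t', hocc_t']; exact ⟨(h2 k).2.1, (h2 k).2.2.1⟩
      · rintro h (p | i) (r | j) hi hj hlt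
        · exact kStep_inl .sup h (before_of_block_lt (by rw [hi, hj]; exact htt)) hlt
        · exact absurd hj ht'.ne'
        · exact absurd hi hts.symm
        · exact absurd hi hts.symm
    -- When the later block is the last one, complements are taken there: f^♮ has a k in both blocks
    -- and g^♮ has b k in both. The exchange of a k with b k thus becomes a common descent of two
    -- equal entries by a k - b k steps of type (i).
    · refine below_of_exch htt.ne ha hb hab hother' hrest' ?_ ?_
      · rintro u (rfl | rfl) k
        · simp [hocc_t, h1 k]
        · simp [occ_natural_last, h2 k]
      · intro k l hk
        have hg1 : ¬ Occ t (a k) (naturalLabel g).1 ∧ Occ t (b k) (naturalLabel g).1 := by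
          rw [hocc_t, hocc_t]; exact ⟨(h1 k).2.1, (h1 k).2.2.1⟩
        have hg2 : ¬ Occ t' (a k) (naturalLabel g).1 ∧ Occ t' (b k) (naturalLabel g).1 := by
          rw [occ_natural_last, occ_natural_last, not_not]; exact ⟨(h2 k).2.2.1, (h2 k).2.1⟩
        obtain ⟨i, hi, hib⟩ := hg1.2
        obtain ⟨j, hj, hjb⟩ := hg2.2
        obtain ⟨c1, c2, c3⟩ := exchFun_cons (t := t) (t' := t') (g := (naturalLabel g).1) ha hb hab hk
        have d1 := c2 j (Or.inr hj) hjb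
        have d2 := c2 i (Or.inl hi) hib
        rcases i with p | i
        · rcases j with r | j
          · exact absurd hj (ne_of_lt r.1.2)
          · have hlt' := hlt k
            refine superStep_repeat p j _ _ (a k - b k).toNat ?_ ?_ ?_ ?_
            · rw [d2.1, d2.2]; omega
            · rw [d1.1, d2.2]; omega
            · rw [d1.2, d2.2]
            · intro x hxi hxj
              refine c3 x ?_
              rintro (hx | hx)
              · exact ⟨fun h => hg1.1 ⟨x, hx, h⟩,
                  fun h => hxi ((naturalLabel g).2.inj (hx.trans hi.symm) (h.trans hib.symm))⟩
              · exact ⟨fun h => hg2.1 ⟨x, hx, h⟩,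
                  fun h => hxj ((naturalLabel g).2.inj (hx.trans hj.symm) (h.trans hjb.symm))⟩
        · exact absurd hi hts.symm

end FockDuality

end

/-! ### The matrix of the two-block intertwiner and its triangularity. -/

noncomputable section
namespace FockDuality

/-- The weight of a column of the intertwiner: the first two arguments tell in which of the two
blocks the column occurs before, and the last two in which it occurs after the exchange. -/
def wgt (z : Qq) : Bool → Bool → Bool → Bool → Qq
  | false, false, false, false => 1
  | true, true, true, true => q
  | true, false, true, false => z
  | false, true, false, true => z
  | true, false, false, true => 1
  | false, true, true, false => q - q * z ^ 2
  | _, _, _, _ => 0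

/-- The change of the parameter of `wgt` from one column to the next lower one. -/
def wgtShift : Bool → Bool → Qq
  | true, false => -q⁻¹
  | false, true => -q
  | _, _ => 1

/-- The weight of two adjacent columns. -/
def wgt₂ (z : Qq) (s₁ t₁ s₀ t₀ s₁' t₁' s₀' t₀' : Bool) : Qq :=
  wgt z s₁ t₁ s₁' t₁' * wgt (z * wgtShift s₁ s₁') s₀ t₀ s₀' t₀'

/-- The eigenvalue of `K_{a+1} K_a⁻¹`, given the occurrence of `a+1` and `a`. -/
def kWgt (x₁ x₀ : Bool) : Qq := (if x₁ then q else 1) * (if x₀ then q⁻¹ else 1)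

/-- The intertwining relation for E_a restricted to the columns a+1 (index 1) and a (index 0). The
letters `s` and `t` stand for the two blocks, and the primes mark the target. On the left E_a acts
before the exchange in the opposite order of factors, on the right after it in the original order.
The 256 cases are identities of rational functions in q and z. -/
theorem wgt₂_E (z : Qq) (s₁ t₁ s₀ t₀ s₁' t₁' s₀' t₀' : Bool) :
    (if s₁ ∧ ¬ s₀ then wgt₂ z false t₁ true t₀ s₁' t₁' s₀' t₀' else 0) +
      kWgt s₁ s₀ * (if t₁ ∧ ¬ t₀ then wgt₂ z s₁ false s₀ true s₁' t₁' s₀' t₀' else 0) =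
    (if t₀' ∧ ¬ t₁' then wgt₂ z s₁ t₁ s₀ t₀ s₁' true s₀' false else 0) +
      kWgt t₁' t₀' * (if s₀' ∧ ¬ s₁' then wgt₂ z s₁ t₁ s₀ t₀ true t₁' false t₀' else 0) := by
  have hq := q_ne_zero
  cases s₁ <;> cases t₁ <;> cases s₀ <;> cases t₀ <;> cases s₁' <;> cases t₁' <;> cases s₀' <;>
    cases t₀' <;> simp only [wgt₂, wgt, wgtShift, kWgt, Bool.false_eq_true, not_true_eq_false,
      not_false_eq_true, and_true, and_false, if_true, if_false, mul_zero, zero_mul, add_zero,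
      zero_add] <;> try (field_simp <;> ring)

theorem wgt₂_F (z : Qq) (s₁ t₁ s₀ t₀ s₁' t₁' s₀' t₀' : Bool) :
    (if t₀ ∧ ¬ t₁ then wgt₂ z s₁ true s₀ false s₁' t₁' s₀' t₀' else 0) +
      kWgt t₀ t₁ * (if s₀ ∧ ¬ s₁ then wgt₂ z true t₁ false t₀ s₁' t₁' s₀' t₀' else 0) =
    (if s₁' ∧ ¬ s₀' then wgt₂ z s₁ t₁ s₀ t₀ false t₁' true t₀' else 0) +
      kWgt s₀' s₁' * (if t₁' ∧ ¬ t₀' then wgt₂ z s₁ t₁ s₀ t₀ s₁' false s₀' true else 0) := by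
  have hq := q_ne_zero
  cases s₁ <;> cases t₁ <;> cases s₀ <;> cases t₀ <;> cases s₁' <;> cases t₁' <;> cases s₀' <;>
    cases t₀' <;> simp only [wgt₂, wgt, wgtShift, kWgt, Bool.false_eq_true, not_true_eq_false,
      not_false_eq_true, and_true, and_false, if_true, if_false, mul_zero, zero_mul, add_zero,
      zero_add] <;> try (field_simp <;> ring)

open Classical in
/-- Whether `x` occurs in block `t`. -/
def oc {s : ℕ} {m : Fin s → ℕ} (t : ℕ) (x : ℤ) (f : Idx m → ℤ) : Bool := decide (Occ t x f)

theorem oc_eq_true {s : ℕ} {m : Fin s → ℕ} {t : ℕ} {x : ℤ} {f : Idx m → ℤ} :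
    oc t x f = true ↔ Occ t x f := by simp [oc]

theorem oc_congr {s : ℕ} {m : Fin s → ℕ} {t u : ℕ} {x y : ℤ} {f g : Idx m → ℤ}
    (h : Occ t x f ↔ Occ u y g) : oc t x f = oc u y g := by simp [oc, h]

theorem oc_of {s : ℕ} {m : Fin s → ℕ} {t : ℕ} {x : ℤ} {f : Idx m → ℤ} (h : Occ t x f) :
    oc t x f = true := by simp [oc, h]

theorem oc_of_not {s : ℕ} {m : Fin s → ℕ} {t : ℕ} {x : ℤ} {f : Idx m → ℤ} (h : ¬ Occ t x f) :
    oc t x f = false := by simp [oc, h]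

/-- The weight of a column in the matrix coefficient of the intertwiner of the blocks `t`, `t'`. -/
def colWgt {s : ℕ} {m : Fin s → ℕ} (t t' : ℕ) (g f : Idx m → ℤ) (x : ℤ) : Qq :=
  wgt ((-q) ^ ((blockCnt t (x + 1) g : ℤ) - blockCnt t (x + 1) f))
    (oc t x f) (oc t' x f) (oc t x g) (oc t' x g)

open Classical in
/-- The matrix coefficients of the intertwiner of the blocks `t`, `t'`. -/
def pairMat {s : ℕ} {m : Fin s → ℕ} (t t' : ℕ) (g f : Label .ord m) : Qq :=
  if ∀ u, u ≠ t → u ≠ t' → ∀ x, Occ u x f.1 ↔ Occ u x g.1 then ∏ᶠ x, colWgt t t' g.1 f.1 x else 0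

/-- Far up, all columns are empty. Far down, finite blocks are empty, the last block is full, and
the counting function has reached the size of the block. There the parameter is (-q) ^ 0 and the
weight is 1, so the product over all columns is finite. -/
theorem exists_colWgt_eq_one {s : ℕ} {m : Fin s → ℕ} {t t' : ℕ} (htt : t < t') (ht' : t' ≤ s)
    (f g : Label .ord m) : ∃ M : ℤ, ∀ x, (x < -M ∨ M < x) →
      colWgt t t' g.1 f.1 x = 1 ∧ blockCnt t (x + 1) g.1 = blockCnt t (x + 1) f.1 := by
  have key : ∀ f : Label .ord m, ∃ M : ℤ, 0 ≤ M ∧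
      (∀ x, M < x → ∀ u, ¬ Occ u x f.1) ∧
      (∀ x, x < -M → Occ s x f.1 ∧ ∀ u, u < s → ¬ Occ u x f.1) ∧
      (∀ x, M < x → blockCnt t x f.1 = 0) ∧
      (∀ x, x ≤ -M → blockCnt t x f.1 =
        (Finset.univ.filter fun p : Σ t : Fin s, Fin (m t) => (p.1 : ℕ) = t).card) := by
    intro f
    obtain ⟨b, hb⟩ := (Set.finite_range fun p => |f.1 (.inl p)|).bddAbove
    have hb' : ∀ p, |f.1 (.inl p)| ≤ b := fun p => hb ⟨p, rfl⟩
    obtain ⟨n, hn⟩ := exists_level f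
    refine ⟨max b 0 + |f.1 (.inr 0)| + n, ?_, ?_, ?_, ?_, ?_⟩
    · have := le_max_right b 0
      positivity
    · rintro x hx u ⟨p | j, -, rfl⟩
      · have h1 := hb' p
        have h2 := le_max_left b 0
        have h3 := le_abs_self (f.1 (.inl p))
        have h4 := abs_nonneg (f.1 (.inr 0))
        omega
      · have h1 := ord_le_zero f j
        have h2 := le_max_right b 0
        have h3 := le_abs_self (f.1 (.inr 0))
        omega
    · intro x hx
      have h2 := le_max_right b 0
      have h4 := abs_nonneg (f.1 (.inr 0))
      refine ⟨occ_of_level hn (by omega), ?_⟩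
      rintro u hu ⟨p | j, h, rfl⟩
      · have h1 := hb' p
        have h2 := le_max_left b 0
        have h3 := neg_abs_le (f.1 (.inl p))
        omega
      · exact absurd h hu.ne'
    · intro x hx
      unfold blockCnt
      rw [Finset.card_eq_zero, Finset.filter_eq_empty_iff]
      rintro p - ⟨-, h⟩
      have h1 := hb' p
      have h2 := le_max_left b 0
      have h3 := le_abs_self (f.1 (.inl p))
      have h4 := abs_nonneg (f.1 (.inr 0))
      omega
    · intro x hx
      unfold blockCnt
      congr 1
      ext p
      simp only [Finset.mem_filter, Finset.mem_univ, true_and, and_iff_left_iff_imp]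
      intro _
      have h1 := hb' p
      have h2 := le_max_left b 0
      have h3 := neg_abs_le (f.1 (.inl p))
      have h4 := abs_nonneg (f.1 (.inr 0))
      omega
  obtain ⟨M, hM, a1, a2, a3, a4⟩ := key f
  obtain ⟨N, hN, b1, b2, b3, b4⟩ := key g
  refine ⟨M + N, fun x hx => ?_⟩
  have hbc : blockCnt t (x + 1) g.1 = blockCnt t (x + 1) f.1 := by
    rcases hx with hx | hx
    · rw [a4 _ (by omega), b4 _ (by omega)]
    · rw [a3 _ (by omega), b3 _ (by omega)]
  refine ⟨?_, hbc⟩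
  unfold colWgt
  rw [hbc, sub_self, zpow_zero]
  rcases hx with hx | hx
  · obtain ⟨c1, c2⟩ := a2 x (by omega)
    obtain ⟨d1, d2⟩ := b2 x (by omega)
    rw [oc_of_not (c2 t (by omega)), oc_of_not (d2 t (by omega))]
    rcases ht'.lt_or_eq with h | rfl
    · rw [oc_of_not (c2 t' h), oc_of_not (d2 t' h)]
      rfl
    · rw [oc_of c1, oc_of d1]
      rfl
  · have c := a1 x (by omega)
    have d := b1 x (by omega)
    rw [oc_of_not (c _), oc_of_not (c _), oc_of_not (d _), oc_of_not (d _)]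
    rfl

theorem finite_mulSupport_colWgt {s : ℕ} {m : Fin s → ℕ} {t t' : ℕ} (htt : t < t') (ht' : t' ≤ s)
    (f g : Label .ord m) : (Function.mulSupport (colWgt t t' g.1 f.1)).Finite := by
  obtain ⟨M, hM⟩ := exists_colWgt_eq_one htt ht' f g
  refine (Set.finite_Icc (-M) M).subset fun x hx => ?_
  by_contra hne
  refine hx (hM x ?_).1
  simp only [Set.mem_Icc, not_and_or, not_le] at hne
  exact hne

theorem colWgt_ne_zero {s : ℕ} {m : Fin s → ℕ} {t t' : ℕ} (htt : t < t') (ht' : t' ≤ s)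
    {f g : Label .ord m} (h : pairMat t t' g f ≠ 0) (x : ℤ) : colWgt t t' g.1 f.1 x ≠ 0 := by
  unfold pairMat at h
  split_ifs at h
  · intro h0
    exact h (finprod_eq_zero _ x h0 (finite_mulSupport_colWgt htt ht' f g))
  · exact absurd rfl h

/-- A nonzero weight conserves the number of occurrences in a column. Moving a value into the first
block costs the factor q (1 - z ^ 2), which vanishes when the counting functions agree just above
that column. -/
theorem wgt_ne_zero_cons {z : Qq} {a b c d : Bool} (h : wgt z a b c d ≠ 0) :
    (a = c ∧ b = d) ∨ (a = true ∧ b = false ∧ c = false ∧ d = true) ∨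
      (a = false ∧ b = true ∧ c = true ∧ d = false ∧ z ^ 2 ≠ 1) := by
  by_cases hz : z ^ 2 = 1
  · cases a <;> cases b <;> cases c <;> cases d <;> simp_all only [wgt] <;> simp_all
  · cases a <;> cases b <;> cases c <;> cases d <;> simp_all only [wgt] <;> simp_all

theorem wgt_mem_laurentInt {z : Qq} (hz : z ∈ laurentInt) (a b c d : Bool) :
    wgt z a b c d ∈ laurentInt := by
  cases a <;> cases b <;> cases c <;> cases d <;> simp only [wgt] <;>
    first
      | exact zero_mem _
      | exact one_mem _
      | exact hz
      | exact q_mem_laurentInt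
      | exact sub_mem q_mem_laurentInt (mul_mem q_mem_laurentInt (pow_mem hz 2))

theorem neg_q_zpow_mem (n : ℤ) : (-q) ^ n ∈ laurentInt := by
  rcases Int.even_or_odd n with h | h
  · rw [h.neg_zpow]; exact q_zpow_mem_laurentInt n
  · rw [h.neg_zpow]; exact neg_mem (q_zpow_mem_laurentInt n)

theorem pairMat_mem_laurentInt {s : ℕ} {m : Fin s → ℕ} (t t' : ℕ) (g f : Label .ord m) :
    pairMat t t' g f ∈ laurentInt := by
  unfold pairMat
  split_ifs
  · exact finprod_induction (· ∈ laurentInt) (one_mem _) (fun _ _ => mul_mem)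
      fun x => wgt_mem_laurentInt (neg_q_zpow_mem _) _ _ _ _
  · exact zero_mem _

/-- Going down from large x, where the counts agree, the excess of `g` over `f` can rise by one only
in a column whose value moves into block `t`. If the counts are equal just above, the factor 1 - z ^
2 vanishes there, so the excess never becomes positive. -/
theorem blockCnt_le_of_pairMat_ne_zero {s : ℕ} {m : Fin s → ℕ} {t t' : ℕ} (htt : t < t')
    (ht' : t' ≤ s) {f g : Label .ord m} (h : pairMat t t' g f ≠ 0) (x : ℤ) :
    blockCnt t x g.1 ≤ blockCnt t x f.1 := by
  classical
  obtain ⟨M, hM⟩ := exists_colWgt_eq_one htt ht' f g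
  rcases lt_or_ge (M + 1) x with hx | hx
  · have := (hM (x - 1) (Or.inr (by omega))).2
    rw [sub_add_cancel] at this
    exact this.le
  · refine Int.leInductionDown
      (motive := fun y _ => blockCnt t y g.1 ≤ blockCnt t y f.1) ?_ ?_ x
      (show x ≤ M + 2 by omega)
    · have := (hM (M + 1) (Or.inr (by omega))).2
      rw [show M + 1 + 1 = M + 2 by ring] at this
      exact this.le
    · intro y _ ih
      have hts : t < s := by omega
      have e1 := blockCnt_succ hts (y - 1) f
      have e2 := blockCnt_succ hts (y - 1) g
      rw [sub_add_cancel] at e1 e2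
      have hne := colWgt_ne_zero htt ht' h (y - 1)
      unfold colWgt at hne
      rw [sub_add_cancel] at hne
      rcases wgt_ne_zero_cons hne with ⟨h1, -⟩ | ⟨h1, -, h2, -⟩ | ⟨h1, -, h2, -, h3⟩
      · have : Occ t (y - 1) f.1 ↔ Occ t (y - 1) g.1 := by
          rw [← oc_eq_true, ← oc_eq_true, h1]
        simp only [this] at e1
        omega
      · have : ¬ Occ t (y - 1) g.1 := by
          rw [← oc_eq_true, h2]; simp
        rw [if_neg this] at e2
        omega
      · have h4 : blockCnt t y g.1 ≠ blockCnt t y f.1 := by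
          intro h5
          rw [h5] at h3
          simp at h3
        split_ifs at e1 e2 <;> omega

/-- The set of values in the finite block `t`. -/
def valSet {s : ℕ} {m : Fin s → ℕ} (t : ℕ) (f : Idx m → ℤ) : Finset ℤ :=
  (Finset.univ.filter fun p : Σ t : Fin s, Fin (m t) => (p.1 : ℕ) = t).image fun p => f (.inl p)

theorem mem_valSet {s : ℕ} {m : Fin s → ℕ} {t : ℕ} (ht : t < s) {f : Idx m → ℤ} {x : ℤ} :
    x ∈ valSet t f ↔ Occ t x f := by
  simp only [valSet, Finset.mem_image, Finset.mem_filter, Finset.mem_univ, true_and]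
  constructor
  · rintro ⟨p, h1, h2⟩
    exact ⟨.inl p, h1, h2⟩
  · rintro ⟨p | j, h1, h2⟩
    · exact ⟨p, h1, h2⟩
    · exact absurd h1 ht.ne'

theorem injOn_inl {s : ℕ} {m : Fin s → ℕ} {κ : Kind} (t : ℕ) (f : Label κ m) :
    Set.InjOn (fun p : Σ t : Fin s, Fin (m t) => f.1 (.inl p)) {p | (p.1 : ℕ) = t} :=
  fun p hp r hr h => Sum.inl_injective (f.2.inj (i := .inl p) (j := .inl r) (hp.trans hr.symm) h)

theorem card_valSet {s : ℕ} {m : Fin s → ℕ} {κ : Kind} (t : ℕ) (f : Label κ m) :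
    (valSet t f.1).card =
      (Finset.univ.filter fun p : Σ t : Fin s, Fin (m t) => (p.1 : ℕ) = t).card :=
  Finset.card_image_of_injOn ((injOn_inl t f).mono fun p hp => by simpa using hp)

theorem blockCnt_eq_card {s : ℕ} {m : Fin s → ℕ} {κ : Kind} (t : ℕ) (y : ℤ) (f : Label κ m) :
    blockCnt t y f.1 = ((valSet t f.1).filter (y ≤ ·)).card := by
  unfold valSet blockCnt
  rw [Finset.filter_image, Finset.card_image_of_injOn]
  · rw [Finset.filter_filter]
  · refine (injOn_inl t f).mono fun p hp => ?_
    simp only [Finset.coe_filter, Finset.mem_filter, Finset.mem_univ, true_and,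
      Set.mem_ofPred_eq] at hp
    exact hp.1

/-- The matrix of the intertwiner is supported below the diagonal. -/
theorem bothBelow_of_pairMat_ne_zero {s : ℕ} {m : Fin s → ℕ} {t t' : ℕ} (htt : t < t')
    (ht' : t' ≤ s) {f g : Label .ord m} (h : pairMat t t' g f ≠ 0) : BothBelow g f := by
  classical
  have hother : ∀ u, u ≠ t → u ≠ t' → ∀ x, Occ u x f.1 ↔ Occ u x g.1 := by
    unfold pairMat at h
    split_ifs at h with hc
    · exact hc
    · exact absurd rfl h
  have hts : t < s := by omega
  have hcnt := blockCnt_le_of_pairMat_ne_zero htt ht' h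
  have hcol : ∀ x, ((Occ t x f.1 ↔ Occ t x g.1) ∧ (Occ t' x f.1 ↔ Occ t' x g.1)) ∨
      (Occ t x f.1 ∧ ¬ Occ t' x f.1 ∧ ¬ Occ t x g.1 ∧ Occ t' x g.1) ∨
      (¬ Occ t x f.1 ∧ Occ t' x f.1 ∧ Occ t x g.1 ∧ ¬ Occ t' x g.1) := by
    intro x
    simp only [← oc_eq_true]
    rcases wgt_ne_zero_cons (colWgt_ne_zero htt ht' h x) with
      ⟨h1, h2⟩ | ⟨h1, h2, h3, h4⟩ | ⟨h1, h2, h3, h4, -⟩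
    · simp [h1, h2]
    · simp [h1, h2, h3, h4]
    · simp [h1, h2, h3, h4]
  let A := valSet t f.1 \ valSet t g.1
  let B := valSet t g.1 \ valSet t f.1
  have hA : ∀ x, x ∈ A ↔ Occ t x f.1 ∧ ¬ Occ t x g.1 := fun x => by
    simp only [A, Finset.mem_sdiff, mem_valSet hts]
  have hB : ∀ x, x ∈ B ↔ Occ t x g.1 ∧ ¬ Occ t x f.1 := fun x => by
    simp only [B, Finset.mem_sdiff, mem_valSet hts]
  have hcard : B.card = A.card := by
    have e1 := Finset.card_sdiff_add_card_inter (valSet t f.1) (valSet t g.1)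
    have e2 := Finset.card_sdiff_add_card_inter (valSet t g.1) (valSet t f.1)
    rw [Finset.inter_comm] at e2
    rw [card_valSet] at e1 e2
    change B.card + _ = _ at e2
    change A.card + _ = _ at e1
    omega
  -- `A` consists of the values leaving block `t`, and `B` of those entering it. Removing common
  -- values from the comparison of counting functions gives this ballot condition.
  have hball : ∀ y, (B.filter (y ≤ ·)).card ≤ (A.filter (y ≤ ·)).card := by
    intro y
    have e1 := Finset.card_sdiff_add_card_inter ((valSet t f.1).filter (y ≤ ·))
      ((valSet t g.1).filter (y ≤ ·))
    have e2 := Finset.card_sdiff_add_card_inter ((valSet t g.1).filter (y ≤ ·))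
      ((valSet t f.1).filter (y ≤ ·))
    rw [Finset.inter_comm] at e2
    rw [← blockCnt_eq_card] at e1 e2
    have e3 := hcnt y
    have e4 : A.filter (y ≤ ·) = (valSet t f.1).filter (y ≤ ·) \ (valSet t g.1).filter (y ≤ ·) := by
      ext x; simp only [A, Finset.mem_filter, Finset.mem_sdiff]; tauto
    have e5 : B.filter (y ≤ ·) = (valSet t g.1).filter (y ≤ ·) \ (valSet t f.1).filter (y ≤ ·) := by
      ext x; simp only [B, Finset.mem_filter, Finset.mem_sdiff]; tauto
    rw [e4, e5]
    omega
  -- Both sets are listed in increasing order. The ballot condition forces b k < a k for every k.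
  let a := A.orderEmbOfFin rfl
  let b := B.orderEmbOfFin hcard
  have ha : ∀ k, Occ t (a k) f.1 ∧ ¬ Occ t (a k) g.1 := fun k =>
    (hA _).mp (A.orderEmbOfFin_mem rfl k)
  have hb : ∀ k, Occ t (b k) g.1 ∧ ¬ Occ t (b k) f.1 := fun k =>
    (hB _).mp (B.orderEmbOfFin_mem hcard k)
  have hra : ∀ x, Occ t x f.1 → ¬ Occ t x g.1 → ∃ k, x = a k := by
    intro x h1 h2
    have : x ∈ Set.range a := by
      rw [Finset.range_orderEmbOfFin]
      exact (hA x).mpr ⟨h1, h2⟩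
    obtain ⟨k, rfl⟩ := this
    exact ⟨k, rfl⟩
  have hrb : ∀ x, Occ t x g.1 → ¬ Occ t x f.1 → ∃ k, x = b k := by
    intro x h1 h2
    have : x ∈ Set.range b := by
      rw [Finset.range_orderEmbOfFin]
      exact (hB x).mpr ⟨h1, h2⟩
    obtain ⟨k, rfl⟩ := this
    exact ⟨k, rfl⟩
  refine bothBelow_of_exch (a := a) (b := b) htt ht' a.injective b.injective ?_ hother ?_ ?_ ?_
  · intro k
    by_contra hlt
    have hne : a k ≠ b k := fun h => (hb k).2 (h ▸ (ha k).1)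
    have hlt' : a k < b k := lt_of_le_of_ne (not_lt.mp hlt) hne
    -- If a k < b k, only the a i with i > k can reach b k, while all b i with i ≥ k do. This is one
    -- element of `B` too many for the ballot condition.
    have h1 : A.filter (b k ≤ ·) ⊆ (Finset.Ioi k).image a := by
      intro x hx
      rw [Finset.mem_filter] at hx
      have : x ∈ Set.range a := by rw [Finset.range_orderEmbOfFin]; exact hx.1
      obtain ⟨i, rfl⟩ := this
      exact Finset.mem_image_of_mem _ (Finset.mem_Ioi.mpr (a.lt_iff_lt.mp (hlt'.trans_le hx.2)))
    have h2 : (Finset.Ici k).image b ⊆ B.filter (b k ≤ ·) := by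
      intro x hx
      obtain ⟨i, hi, rfl⟩ := Finset.mem_image.mp hx
      exact Finset.mem_filter.mpr ⟨B.orderEmbOfFin_mem hcard i,
        b.monotone (Finset.mem_Ici.mp hi)⟩
    have h3 := Finset.card_le_card h1
    have h4 := Finset.card_le_card h2
    rw [Finset.card_image_of_injective _ a.injective, Fin.card_Ioi] at h3
    rw [Finset.card_image_of_injective _ b.injective, Fin.card_Ici] at h4
    have h5 := hball (b k)
    have := k.2
    omega
  · rintro u hu x hxa hxb
    have h3 : Occ t x f.1 ↔ Occ t x g.1 := by
      constructor
      · intro h1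
        by_contra h2
        obtain ⟨k, hk⟩ := hra x h1 h2
        exact hxa k hk
      · intro h1
        by_contra h2
        obtain ⟨k, hk⟩ := hrb x h1 h2
        exact hxb k hk
    rcases hu with rfl | rfl
    · exact h3
    · have := hcol x
      tauto
  · intro k
    exact ⟨(ha k).1, (ha k).2, (hb k).1, (hb k).2⟩
  · intro k
    have h1 := ha k
    have h2 := hb k
    have h3 := hcol (a k)
    have h4 := hcol (b k)
    tauto

end FockDuality

end

noncomputable section
namespace FockDuality
open Gen

/-! ### The intertwiner of two blocks -/

/-- The columns of the matrix of a hop, complementing the rows in `hop_cases`. A monomial goes to a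
monomial or to 0. -/
theorem hop_monomial_cases {s : ℕ} {κ : Kind} {m : Fin s → ℕ} {t : ℕ} {a b : ℤ}
    (hab : |a - b| = 1) (f : Label κ m) :
    (∃ f' : Label κ m, f'.1 = repl t a b f.1 ∧ Occ t a f.1 ∧ ¬ Occ t b f.1 ∧
      hop κ m t a b (monomial f) = monomial f') ∨
    (¬ (Occ t a f.1 ∧ ¬ Occ t b f.1) ∧ hop κ m t a b (monomial f) = 0) := by
  classical
  have hba : |b - a| = 1 := by rwa [abs_sub_comm]
  have hne : a ≠ b := by rintro rfl; simp at hab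
  by_cases h : Occ t a f.1 ∧ ¬ Occ t b f.1
  · refine Or.inl ⟨⟨_, (isLabel_repl_iff hba f.2 h.1).mpr h.2⟩, rfl, h.1, h.2, fock_ext fun g => ?_⟩
    rcases hop_cases (κ := κ) (m := m) (t := t) hab g with ⟨g', e, o, n, h1⟩ | ⟨n, h1⟩
    · rw [h1, monomial_apply, monomial_apply]
      refine if_congr ?_ rfl rfl
      constructor
      · rintro rfl
        refine Subtype.ext ?_
        change g.1 = repl t a b g'.1
        rw [e]
        exact (repl_repl o (e ▸ g'.2)).symm
      · rintro rfl
        refine Subtype.ext ?_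
        rw [e]
        exact repl_repl h.1 ((isLabel_repl_iff hba f.2 h.1).mpr h.2)
    · rw [h1, monomial_apply_ne]
      rintro rfl
      have h2 : Occ t b (repl t a b f.1) := (occ_repl h.1 hba).mpr (Or.inl ⟨rfl, rfl⟩)
      have h3 := n h2
      change Occ t a (repl t a b f.1) at h3
      rw [occ_repl h.1 hba] at h3
      grind
  · refine Or.inr ⟨h, fock_ext fun g => ?_⟩
    rcases hop_cases (κ := κ) (m := m) (t := t) hab g with ⟨g', e, o, n, h1⟩ | ⟨n, h1⟩
    · rw [h1, monomial_apply_ne]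
      · rfl
      · rintro rfl
        refine h ?_
        rw [e, occ_repl o hab, occ_repl o hab]
        grind
    · rw [h1]
      rfl

theorem diag_monomial {s : ℕ} {κ : Kind} {m : Fin s → ℕ} (w : Label κ m → Qq) (f : Label κ m) :
    diag w (monomial f) = w f • monomial f := by
  refine fock_ext fun g => ?_
  change w g * (monomial f).1 g = w f * (monomial f).1 g
  by_cases h : g = f
  · rw [h]
  · rw [monomial_apply_ne h, mul_zero, mul_zero]

theorem isLocal_vFamily {s : ℕ} {κ : Kind} {m : Fin s → ℕ} (t : ℕ) (x : Gen) :
    IsLocal (vFamily κ m t x) := by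
  cases x
  · exact isLocal_hop (abs_succ_sub _)
  · exact isLocal_hop (abs_sub_succ _)
  · exact isLocal_diag _
  · exact isLocal_diag _

theorem isLocal_mul {s : ℕ} {κ : Kind} {m : Fin s → ℕ} {X Y : Module.End Qq (fockSpace κ m)}
    (hX : IsLocal X) (hY : IsLocal Y) : IsLocal (X * Y : Module.End Qq (fockSpace κ m)) :=
  isLocal_comp (X := X) (Y := Y) hX hY

theorem isLocal_tensorFamily {s : ℕ} {κ : Kind} {m : Fin s → ℕ}
    {D₁ D₂ : Gen → Module.End Qq (fockSpace κ m)} (h₁ : ∀ x, IsLocal (D₁ x))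
    (h₂ : ∀ x, IsLocal (D₂ x)) (x : Gen) : IsLocal ⇑(tensorFamily D₁ D₂ x) := by
  cases x
  · exact isLocal_add (h₂ (E _)) (isLocal_mul (h₁ _) (isLocal_mul (h₂ _) (h₂ _)))
  · exact isLocal_add (h₁ (F _)) (isLocal_mul (isLocal_mul (h₁ _) (h₁ _)) (h₂ _))
  · exact isLocal_mul (h₁ _) (h₂ _)
  · exact isLocal_mul (h₁ _) (h₂ _)

theorem blockCnt_repl {s : ℕ} {m : Fin s → ℕ} {t u : ℕ} {a b y : ℤ} (f : Idx m → ℤ)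
    (h : u = t → (y ≤ a ↔ y ≤ b)) : blockCnt t y (repl u a b f) = blockCnt t y f := by
  unfold blockCnt
  congr 1
  refine Finset.filter_congr fun p _ => and_congr_right fun hp => ?_
  change y ≤ (if (p.1 : ℕ) = u ∧ f (.inl p) = a then b else f (.inl p)) ↔ _
  by_cases h1 : (p.1 : ℕ) = u ∧ f (.inl p) = a
  · rw [if_pos h1, h1.2, h (h1.1.symm.trans hp)]
  · rw [if_neg h1]

/-- `f'` is obtained from `f` by changes in the columns `a` and `a + 1` of the blocks `t`, `t'`. -/
structure Near {s : ℕ} {m : Fin s → ℕ} (t t' : ℕ) (a : ℤ) (f f' : Idx m → ℤ) : Prop where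
  occ : ∀ u x, ((u ≠ t ∧ u ≠ t') ∨ (x ≠ a ∧ x ≠ a + 1)) → (Occ u x f' ↔ Occ u x f)
  cnt : ∀ y, y ≠ a + 1 → blockCnt t y f' = blockCnt t y f

theorem Near.refl {s : ℕ} {m : Fin s → ℕ} (t t' : ℕ) (a : ℤ) (f : Idx m → ℤ) : Near t t' a f f :=
  ⟨fun _ _ _ => Iff.rfl, fun _ _ => rfl⟩

theorem near_repl {s : ℕ} {m : Fin s → ℕ} {t t' u : ℕ} {a b c : ℤ} {f : Idx m → ℤ}
    (hu : u = t ∨ u = t') (ho : Occ u b f) (h : (b = a ∧ c = a + 1) ∨ (b = a + 1 ∧ c = a)) :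
    Near t t' a f (repl u b c f) := by
  have hcb : |c - b| = 1 := by rcases h with ⟨rfl, rfl⟩ | ⟨rfl, rfl⟩ <;> simp
  refine ⟨fun v x hx => ?_, fun y hy => blockCnt_repl f fun _ => ?_⟩
  · rw [occ_repl ho hcb]
    grind
  · omega

/-- Changes in the columns a and a+1 leave all other factors of the product alone. `C` collects
these, and `z` is the parameter of column a+1. Thus any relation that only changes these two columns
reduces to one for `wgt₂`. -/
theorem pairMat_factor {s : ℕ} {m : Fin s → ℕ} {t t' : ℕ} (htt : t < t') (ht' : t' ≤ s) (a : ℤ)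
    (f g : Label .ord m) : ∃ C z : Qq, ∀ f' g' : Label .ord m, Near t t' a f.1 f'.1 →
      Near t t' a g.1 g'.1 → pairMat t t' g' f' = C *
        wgt₂ z (oc t (a + 1) f'.1) (oc t' (a + 1) f'.1) (oc t a f'.1) (oc t' a f'.1)
          (oc t (a + 1) g'.1) (oc t' (a + 1) g'.1) (oc t a g'.1) (oc t' a g'.1) := by
  classical
  refine ⟨if ∀ u, u ≠ t → u ≠ t' → ∀ x, Occ u x f.1 ↔ Occ u x g.1 then
      ∏ᶠ x, (if x = a ∨ x = a + 1 then 1 else colWgt t t' g.1 f.1 x) else 0,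
    (-q) ^ ((blockCnt t (a + 1 + 1) g.1 : ℤ) - blockCnt t (a + 1 + 1) f.1),
    fun f' g' hf hg => ?_⟩
  unfold pairMat
  have hc : (∀ u, u ≠ t → u ≠ t' → ∀ x, Occ u x f'.1 ↔ Occ u x g'.1) ↔
      ∀ u, u ≠ t → u ≠ t' → ∀ x, Occ u x f.1 ↔ Occ u x g.1 := by
    refine forall_congr' fun u => forall_congr' fun h1 => forall_congr' fun h2 =>
      forall_congr' fun x => ?_
    rw [hf.occ u x (Or.inl ⟨h1, h2⟩), hg.occ u x (Or.inl ⟨h1, h2⟩)]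
  rw [if_congr hc rfl rfl]
  by_cases h : ∀ u, u ≠ t → u ≠ t' → ∀ x, Occ u x f.1 ↔ Occ u x g.1
  swap
  · rw [if_neg h, if_neg h, zero_mul]
  rw [if_pos h, if_pos h]
  have hfin := finite_mulSupport_colWgt htt ht' f' g'
  have e1 : ∀ x, colWgt t t' g'.1 f'.1 x = (if x = a ∨ x = a + 1 then 1 else colWgt t t' g.1 f.1 x) *
      (if x = a ∨ x = a + 1 then colWgt t t' g'.1 f'.1 x else 1) := by
    intro x
    split_ifs with hx
    · rw [one_mul]
    · push Not at hx
      rw [mul_one]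
      unfold colWgt
      rw [hf.cnt _ (by omega), hg.cnt _ (by omega), oc_congr (hf.occ t x (Or.inr hx)),
        oc_congr (hf.occ t' x (Or.inr hx)), oc_congr (hg.occ t x (Or.inr hx)),
        oc_congr (hg.occ t' x (Or.inr hx))]
  rw [finprod_congr e1, finprod_mul_distrib]
  · congr 1
    rw [finprod_eq_prod_of_mulSupport_subset (s := {a, a + 1})]
    · rw [Finset.prod_pair (by simp), if_pos (Or.inl rfl), if_pos (Or.inr rfl), mul_comm]
      unfold wgt₂ colWgt
      rw [hf.cnt (a + 1 + 1) (by omega), hg.cnt (a + 1 + 1) (by omega)]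
      congr 2
      have hts : t < s := by omega
      -- The parameter of column a differs from that of column a+1 by a power of -q recording
      -- whether a+1 occurs in block `t` of `f'` and of `g'`. This is `wgtShift`.
      have b1 := blockCnt_succ hts (a + 1) f'
      have b2 := blockCnt_succ hts (a + 1) g'
      rw [hf.cnt (a + 1 + 1) (by omega)] at b1
      rw [hg.cnt (a + 1 + 1) (by omega)] at b2
      rw [b1, b2]
      have hq : -q ≠ 0 := neg_ne_zero.mpr q_ne_zero
      by_cases c1 : Occ t (a + 1) f'.1 <;> by_cases c2 : Occ t (a + 1) g'.1 <;>
        simp only [c1, c2, oc, decide_true, decide_false, if_true, if_false, wgtShift, mul_one,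
          Nat.add_zero, Nat.cast_add, Nat.cast_one, add_sub_add_right_eq_sub]
      · rw [← sub_sub, zpow_sub₀ hq, zpow_one, ← inv_neg, div_eq_mul_inv]
      · rw [add_sub_right_comm, zpow_add₀ hq, zpow_one]
    · intro x hx
      rw [Function.mem_mulSupport] at hx
      split_ifs at hx with h1
      · simpa using h1
      · exact absurd rfl hx
  · refine (hfin.union (Set.toFinite {a, a + 1})).subset fun x hx => ?_
    rw [Function.mem_mulSupport] at hx
    split_ifs at hx with h1
    · exact absurd rfl hx
    · refine Or.inl ?_
      rw [Function.mem_mulSupport, e1 x, if_neg h1, if_neg h1, mul_one]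
      exact hx
  · refine (Set.toFinite {a, a + 1}).subset fun x hx => ?_
    rw [Function.mem_mulSupport] at hx
    split_ifs at hx with h1
    · simpa using h1
    · exact absurd rfl hx

/-- The intertwiner of the blocks `t`, `t'`. -/
def pairOp {s : ℕ} (m : Fin s → ℕ) (t t' : ℕ) : Module.End Qq (fockSpace .ord m) :=
  opOf (pairMat t t')

theorem isTri_pairOp {s : ℕ} {m : Fin s → ℕ} {t t' : ℕ} (htt : t < t') (ht' : t' ≤ s) :
    IsTri (pairOp m t t') :=
  isTri_opOf (pairMat_mem_laurentInt t t') fun _ _ h => bothBelow_of_pairMat_ne_zero htt ht' h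

theorem pairOp_monomial {s : ℕ} {m : Fin s → ℕ} {t t' : ℕ} (htt : t < t') (ht' : t' ≤ s)
    (f g : Label .ord m) : (pairOp m t t' (monomial f)).1 g = pairMat t t' g f :=
  opOf_monomial (fun _ _ h => (bothBelow_of_pairMat_ne_zero htt ht' h).dle) f g

theorem ite_oc {s : ℕ} {m : Fin s → ℕ} {t : ℕ} {x : ℤ} {f : Idx m → ℤ} [Decidable (Occ t x f)]
    {α : Type*} (u v : α) : (if Occ t x f then u else v) = if oc t x f then u else v :=
  if_congr oc_eq_true.symm rfl rfl

theorem vFamily_K_monomial {s : ℕ} {κ : Kind} {m : Fin s → ℕ} (t : ℕ) (x : ℤ) (f : Label κ m) :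
    vFamily κ m t (K x) (monomial f) = (if oc t x f.1 then q else 1 : Qq) • monomial f := by
  simp only [vFamily, diag_monomial, ite_oc]

theorem vFamily_Kinv_monomial {s : ℕ} {κ : Kind} {m : Fin s → ℕ} (t : ℕ) (x : ℤ) (f : Label κ m) :
    vFamily κ m t (Kinv x) (monomial f) = (if oc t x f.1 then q⁻¹ else 1 : Qq) • monomial f := by
  simp only [vFamily, diag_monomial, ite_oc]

open Classical in
theorem vFamily_K_apply {s : ℕ} {κ : Kind} {m : Fin s → ℕ} (t : ℕ) (x : ℤ) (u : fockSpace κ m)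
    (g : Label κ m) :
    (vFamily κ m t (K x) u).1 g = (if oc t x g.1 then q else 1 : Qq) * u.1 g := by
  simp only [vFamily]
  change (if Occ t x g.1 then _ else _) * _ = _
  rw [ite_oc]

open Classical in
theorem vFamily_Kinv_apply {s : ℕ} {κ : Kind} {m : Fin s → ℕ} (t : ℕ) (x : ℤ) (u : fockSpace κ m)
    (g : Label κ m) :
    (vFamily κ m t (Kinv x) u).1 g = (if oc t x g.1 then q⁻¹ else 1 : Qq) * u.1 g := by
  simp only [vFamily]
  change (if Occ t x g.1 then _ else _) * _ = _
  rw [ite_oc]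

/-- The pair of operators on both sides of a hop, evaluated by cases. -/
theorem pairOp_hop_monomial {s : ℕ} {m : Fin s → ℕ} {t t' u : ℕ} (htt : t < t') (ht' : t' ≤ s)
    {a b : ℤ} (hab : |a - b| = 1) (f g : Label .ord m) :
    (∃ f' : Label .ord m, f'.1 = repl u a b f.1 ∧ Occ u a f.1 ∧ ¬ Occ u b f.1 ∧
      (pairOp m t t' (hop .ord m u a b (monomial f))).1 g = pairMat t t' g f') ∨
    (¬ (Occ u a f.1 ∧ ¬ Occ u b f.1) ∧
      (pairOp m t t' (hop .ord m u a b (monomial f))).1 g = 0) := by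
  rcases hop_monomial_cases (κ := .ord) (m := m) (t := u) hab f with ⟨f', e, o, n, h⟩ | ⟨n, h⟩
  · exact Or.inl ⟨f', e, o, n, by rw [h, pairOp_monomial htt ht']⟩
  · refine Or.inr ⟨n, ?_⟩
    rw [h, map_zero]
    rfl

theorem oc_repl {s : ℕ} {m : Fin s → ℕ} {t u : ℕ} {a b x : ℤ} {f : Idx m → ℤ}
    (ho : Occ t b f) (hab : |a - b| = 1) : oc u x (repl t b a f) =
      if u = t ∧ x = a then true else if u = t ∧ x = b then false else oc u x f := by
  have hne : a ≠ b := by rintro rfl; simp at hab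
  split_ifs with h1 h2
  · exact oc_of ((occ_repl ho hab).mpr (Or.inl h1))
  · refine oc_of_not ?_
    rw [occ_repl ho hab]
    tauto
  · refine oc_congr ?_
    rw [occ_repl ho hab]
    tauto

/-- Both sides are local, so it suffices to compare coefficients on monomials. The two terms of E_a
on each side become `C` times the corresponding terms of `wgt₂_E`. -/
theorem pairOp_E {s : ℕ} {m : Fin s → ℕ} {t t' : ℕ} (htt : t < t') (ht' : t' ≤ s) (a : ℤ) :
    pairOp m t t' * tensorFamily (vFamily .ord m t') (vFamily .ord m t) (E a) =
      tensorFamily (vFamily .ord m t) (vFamily .ord m t') (E a) * pairOp m t t' := by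
  refine ext_of_isLocal
    (isLocal_mul (isTri_pairOp htt ht').isLocal
      (isLocal_tensorFamily (fun _ => isLocal_vFamily _ _) (fun _ => isLocal_vFamily _ _) _))
    (isLocal_mul (isLocal_tensorFamily (fun _ => isLocal_vFamily _ _) (fun _ => isLocal_vFamily _ _) _)
      (isTri_pairOp htt ht').isLocal) fun f => fock_ext fun g => ?_
  have hab := abs_succ_sub a
  have hba := abs_sub_succ a
  obtain ⟨C, z, hC⟩ := pairMat_factor htt ht' a f g
  have hf0 := Near.refl t t' a f.1
  have hg0 := Near.refl t t' a g.1
  have key := congrArg (C * ·) (wgt₂_E z (oc t (a + 1) f.1) (oc t' (a + 1) f.1) (oc t a f.1)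
    (oc t' a f.1) (oc t (a + 1) g.1) (oc t' (a + 1) g.1) (oc t a g.1) (oc t' a g.1))
  have htn : t ≠ t' := htt.ne
  have htn' : t' ≠ t := htt.ne'
  have l1 : (pairOp m t t' (hop .ord m t (a + 1) a (monomial f))).1 g =
      C * (if oc t (a + 1) f.1 ∧ ¬ oc t a f.1 then wgt₂ z false (oc t' (a + 1) f.1) true
        (oc t' a f.1) (oc t (a + 1) g.1) (oc t' (a + 1) g.1) (oc t a g.1) (oc t' a g.1) else 0) := by
    rcases pairOp_hop_monomial (u := t) htt ht' hab f g with ⟨f', e, o, n, h⟩ | ⟨n, h⟩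
    · rw [h, hC f' g (e ▸ near_repl (Or.inl rfl) o (Or.inr ⟨rfl, rfl⟩)) hg0, if_pos (by
        rw [oc_eq_true, oc_eq_true]; exact ⟨o, n⟩), e]
      simp [oc_repl o hba, htn']
    · rw [h, if_neg (by rw [oc_eq_true, oc_eq_true]; exact n), mul_zero]
  have l2 : (pairOp m t t' (hop .ord m t' (a + 1) a (monomial f))).1 g =
      C * (if oc t' (a + 1) f.1 ∧ ¬ oc t' a f.1 then wgt₂ z (oc t (a + 1) f.1) false
        (oc t a f.1) true (oc t (a + 1) g.1) (oc t' (a + 1) g.1) (oc t a g.1) (oc t' a g.1)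
        else 0) := by
    rcases pairOp_hop_monomial (u := t') htt ht' hab f g with ⟨f', e, o, n, h⟩ | ⟨n, h⟩
    · rw [h, hC f' g (e ▸ near_repl (Or.inr rfl) o (Or.inr ⟨rfl, rfl⟩)) hg0, if_pos (by
        rw [oc_eq_true, oc_eq_true]; exact ⟨o, n⟩), e]
      simp [oc_repl o hba, htn]
    · rw [h, if_neg (by rw [oc_eq_true, oc_eq_true]; exact n), mul_zero]
  have r1 : (hop .ord m t' (a + 1) a (pairOp m t t' (monomial f))).1 g =
      C * (if oc t' a g.1 ∧ ¬ oc t' (a + 1) g.1 then wgt₂ z (oc t (a + 1) f.1) (oc t' (a + 1) f.1)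
        (oc t a f.1) (oc t' a f.1) (oc t (a + 1) g.1) true (oc t a g.1) false else 0) := by
    rcases hop_cases (κ := .ord) (m := m) (t := t') hab g with ⟨g', e, o, n, h⟩ | ⟨n, h⟩
    · rw [h, pairOp_monomial htt ht', hC f g' hf0 (e ▸ near_repl (Or.inr rfl) o (Or.inl ⟨rfl, rfl⟩)),
        if_pos (by rw [oc_eq_true, oc_eq_true]; exact ⟨o, n⟩), e]
      simp [oc_repl o hab, htn]
    · rw [h, if_neg (by rw [oc_eq_true, oc_eq_true]; tauto), mul_zero]
  have r2 : (hop .ord m t (a + 1) a ((vFamily .ord m t' (K (a + 1)) * vFamily .ord m t' (Kinv a))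
        (pairOp m t t' (monomial f)))).1 g =
      C * (kWgt (oc t' (a + 1) g.1) (oc t' a g.1) * (if oc t a g.1 ∧ ¬ oc t (a + 1) g.1 then
        wgt₂ z (oc t (a + 1) f.1) (oc t' (a + 1) f.1) (oc t a f.1) (oc t' a f.1) true
        (oc t' (a + 1) g.1) false (oc t' a g.1) else 0)) := by
    rcases hop_cases (κ := .ord) (m := m) (t := t) hab g with ⟨g', e, o, n, h⟩ | ⟨n, h⟩
    · rw [h, Module.End.mul_apply, vFamily_K_apply, vFamily_Kinv_apply, pairOp_monomial htt ht',
        hC f g' hf0 (e ▸ near_repl (Or.inl rfl) o (Or.inl ⟨rfl, rfl⟩)),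
        if_pos (c := oc t a g.1 = true ∧ _) (by rw [oc_eq_true, oc_eq_true]; exact ⟨o, n⟩), e]
      simp only [oc_repl o hab, htn', false_and, if_false, true_and, if_true]
      simp only [left_eq_add, one_ne_zero, if_false, kWgt]
      simp
      ring_nf
    · rw [h, if_neg (by rw [oc_eq_true, oc_eq_true]; tauto), mul_zero, mul_zero]
  simp only [Module.End.mul_apply, tensorFamily, LinearMap.add_apply, vFamily_Kinv_monomial,
    map_smul, vFamily_K_monomial, map_add]
  rw [Module.End.mul_apply] at r2
  change (pairOp m t t' (hop .ord m t (a + 1) a (monomial f))).1 g +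
    _ * (_ * (pairOp m t t' (hop .ord m t' (a + 1) a (monomial f))).1 g) =
    (hop .ord m t' (a + 1) a (pairOp m t t' (monomial f))).1 g + 
    (hop .ord m t (a + 1) a (vFamily .ord m t' (K (a + 1)) (vFamily .ord m t' (Kinv a)
        (pairOp m t t' (monomial f))))).1 g
  rw [l1, l2, r1, r2, ← mul_add, ← key]
  unfold kWgt
  ring

theorem pairOp_F {s : ℕ} {m : Fin s → ℕ} {t t' : ℕ} (htt : t < t') (ht' : t' ≤ s) (a : ℤ) :
    pairOp m t t' * tensorFamily (vFamily .ord m t') (vFamily .ord m t) (F a) =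
      tensorFamily (vFamily .ord m t) (vFamily .ord m t') (F a) * pairOp m t t' := by
  refine ext_of_isLocal
    (isLocal_mul (isTri_pairOp htt ht').isLocal
      (isLocal_tensorFamily (fun _ => isLocal_vFamily _ _) (fun _ => isLocal_vFamily _ _) _))
    (isLocal_mul (isLocal_tensorFamily (fun _ => isLocal_vFamily _ _) (fun _ => isLocal_vFamily _ _) _)
      (isTri_pairOp htt ht').isLocal) fun f => fock_ext fun g => ?_
  have hba := abs_succ_sub a
  have hab := abs_sub_succ a
  obtain ⟨C, z, hC⟩ := pairMat_factor htt ht' a f g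
  have hf0 := Near.refl t t' a f.1
  have hg0 := Near.refl t t' a g.1
  have key := congrArg (C * ·) (wgt₂_F z (oc t (a + 1) f.1) (oc t' (a + 1) f.1) (oc t a f.1)
    (oc t' a f.1) (oc t (a + 1) g.1) (oc t' (a + 1) g.1) (oc t a g.1) (oc t' a g.1))
  have htn : t ≠ t' := htt.ne
  have htn' : t' ≠ t := htt.ne'
  have l1 : (pairOp m t t' (hop .ord m t' a (a + 1) (monomial f))).1 g =
      C * (if oc t' a f.1 ∧ ¬ oc t' (a + 1) f.1 then wgt₂ z (oc t (a + 1) f.1) true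
        (oc t a f.1) false (oc t (a + 1) g.1) (oc t' (a + 1) g.1) (oc t a g.1) (oc t' a g.1)
        else 0) := by
    rcases pairOp_hop_monomial (u := t') htt ht' hab f g with ⟨f', e, o, n, h⟩ | ⟨n, h⟩
    · rw [h, hC f' g (e ▸ near_repl (Or.inr rfl) o (Or.inl ⟨rfl, rfl⟩)) hg0, if_pos (by
        rw [oc_eq_true, oc_eq_true]; exact ⟨o, n⟩), e]
      simp [oc_repl o hba, htn]
    · rw [h, if_neg (by rw [oc_eq_true, oc_eq_true]; exact n), mul_zero]
  have l2 : (pairOp m t t' ((vFamily .ord m t' (K a) * vFamily .ord m t' (Kinv (a + 1)))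
        (hop .ord m t a (a + 1) (monomial f)))).1 g =
      C * (kWgt (oc t' a f.1) (oc t' (a + 1) f.1) * (if oc t a f.1 ∧ ¬ oc t (a + 1) f.1 then
        wgt₂ z true (oc t' (a + 1) f.1) false (oc t' a f.1) (oc t (a + 1) g.1) (oc t' (a + 1) g.1)
        (oc t a g.1) (oc t' a g.1) else 0)) := by
    rcases hop_monomial_cases (κ := .ord) (m := m) (t := t) hab f with ⟨f', e, o, n, h⟩ | ⟨n, h⟩
    · rw [h, Module.End.mul_apply, vFamily_Kinv_monomial, map_smul, vFamily_K_monomial, map_smul,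
        map_smul]
      change _ * (_ * (pairOp m t t' (monomial f')).1 g) = _
      rw [pairOp_monomial htt ht', hC f' g (e ▸ near_repl (Or.inl rfl) o (Or.inl ⟨rfl, rfl⟩)) hg0,
        if_pos (c := oc t a f.1 = true ∧ _) (by rw [oc_eq_true, oc_eq_true]; exact ⟨o, n⟩), e]
      simp only [oc_repl o hba, htn', false_and, if_false, true_and, if_true]
      simp only [left_eq_add, one_ne_zero, if_false, kWgt]
      simp
      ring_nf
      split_ifs <;> ring
    · rw [h, map_zero, map_zero, if_neg (by rw [oc_eq_true, oc_eq_true]; exact n), mul_zero,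
        mul_zero]
      rfl
  have r1 : (hop .ord m t a (a + 1) (pairOp m t t' (monomial f))).1 g =
      C * (if oc t (a + 1) g.1 ∧ ¬ oc t a g.1 then wgt₂ z (oc t (a + 1) f.1) (oc t' (a + 1) f.1)
        (oc t a f.1) (oc t' a f.1) false (oc t' (a + 1) g.1) true (oc t' a g.1) else 0) := by
    rcases hop_cases (κ := .ord) (m := m) (t := t) hab g with ⟨g', e, o, n, h⟩ | ⟨n, h⟩
    · rw [h, pairOp_monomial htt ht', hC f g' hf0 (e ▸ near_repl (Or.inl rfl) o (Or.inr ⟨rfl, rfl⟩)),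
        if_pos (by rw [oc_eq_true, oc_eq_true]; exact ⟨o, n⟩), e]
      simp [oc_repl o hab, htn']
    · rw [h, if_neg (by rw [oc_eq_true, oc_eq_true]; tauto), mul_zero]
  have r2 : (hop .ord m t' a (a + 1) (pairOp m t t' (monomial f))).1 g =
      C * (if oc t' (a + 1) g.1 ∧ ¬ oc t' a g.1 then wgt₂ z (oc t (a + 1) f.1) (oc t' (a + 1) f.1)
        (oc t a f.1) (oc t' a f.1) (oc t (a + 1) g.1) false (oc t a g.1) true else 0) := by
    rcases hop_cases (κ := .ord) (m := m) (t := t') hab g with ⟨g', e, o, n, h⟩ | ⟨n, h⟩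
    · rw [h, pairOp_monomial htt ht', hC f g' hf0 (e ▸ near_repl (Or.inr rfl) o (Or.inr ⟨rfl, rfl⟩)),
        if_pos (by rw [oc_eq_true, oc_eq_true]; exact ⟨o, n⟩), e]
      simp [oc_repl o hab, htn]
    · rw [h, if_neg (by rw [oc_eq_true, oc_eq_true]; tauto), mul_zero]
  simp only [Module.End.mul_apply, tensorFamily, LinearMap.add_apply, map_add]
  rw [Module.End.mul_apply] at l2
  change (pairOp m t t' (hop .ord m t' a (a + 1) (monomial f))).1 g +
    (pairOp m t t' (vFamily .ord m t' (K a) (vFamily .ord m t' (Kinv (a + 1))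
        (hop .ord m t a (a + 1) (monomial f))))).1 g =
    (hop .ord m t a (a + 1) (pairOp m t t' (monomial f))).1 g + 
    (vFamily .ord m t (K a) (vFamily .ord m t (Kinv (a + 1))
        (hop .ord m t' a (a + 1) (pairOp m t t' (monomial f))))).1 g
  rw [l1, l2, r1, vFamily_K_apply, vFamily_Kinv_apply, r2, ← mul_add, key]
  unfold kWgt
  ring

theorem pairMat_ne_zero_occ {s : ℕ} {m : Fin s → ℕ} {t t' : ℕ} {f g : Label .ord m}
    (h : pairMat t t' g f ≠ 0) : ∀ u, u ≠ t → u ≠ t' → ∀ x, Occ u x f.1 ↔ Occ u x g.1 := by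
  unfold pairMat at h
  split_ifs at h with hc
  · exact hc
  · exact absurd rfl h

theorem diag_pairOp {s : ℕ} {m : Fin s → ℕ} {t t' : ℕ} (htt : t < t') (ht' : t' ≤ s)
    (w : Label .ord m → Qq) (h : ∀ f g, pairMat t t' g f ≠ 0 → w f = w g) :
    pairOp m t t' * diag w = diag w * pairOp m t t' := by
  refine ext_of_isLocal (isLocal_mul (isTri_pairOp htt ht').isLocal (isLocal_diag _))
    (isLocal_mul (isLocal_diag _) (isTri_pairOp htt ht').isLocal) fun f => fock_ext fun g => ?_
  rw [Module.End.mul_apply, Module.End.mul_apply, diag_monomial, map_smul]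
  change w f * _ = w g * _
  rw [pairOp_monomial htt ht']
  by_cases h0 : pairMat t t' g f = 0
  · rw [h0, mul_zero, mul_zero]
  · rw [h f g h0]

/-- For K_a the relation says that a nonzero coefficient keeps the number of occurrences of a in the
two blocks. -/
theorem pairOp_tensorFamily {s : ℕ} {m : Fin s → ℕ} {t t' : ℕ} (htt : t < t') (ht' : t' ≤ s)
    (x : Gen) : pairOp m t t' * tensorFamily (vFamily .ord m t') (vFamily .ord m t) x =
      tensorFamily (vFamily .ord m t) (vFamily .ord m t') x * pairOp m t t' := by
  cases x with
  | E a => exact pairOp_E htt ht' a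
  | F a => exact pairOp_F htt ht' a
  | K a =>
    classical
    simp only [tensorFamily, vFamily, diag_mul_diag]
    conv_lhs => simp only [mul_comm]
    refine diag_pairOp htt ht' _ fun f g h => ?_
    simp only [ite_oc]
    rcases wgt_ne_zero_cons (colWgt_ne_zero htt ht' h a) with
      ⟨h1, h2⟩ | ⟨h1, h2, h3, h4⟩ | ⟨h1, h2, h3, h4, -⟩
    · rw [h1, h2]
    · rw [h1, h2, h3, h4]; simp
    · rw [h1, h2, h3, h4]; simp
  | Kinv a =>
    classical
    simp only [tensorFamily, vFamily, diag_mul_diag]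
    conv_lhs => simp only [mul_comm]
    refine diag_pairOp htt ht' _ fun f g h => ?_
    simp only [ite_oc]
    rcases wgt_ne_zero_cons (colWgt_ne_zero htt ht' h a) with
      ⟨h1, h2⟩ | ⟨h1, h2, h3, h4⟩ | ⟨h1, h2, h3, h4, -⟩
    · rw [h1, h2]
    · rw [h1, h2, h3, h4]; simp
    · rw [h1, h2, h3, h4]; simp

/-- The matrix depends on a third block only through the condition that both labels agree there, and
the inverse move on the other label preserves this condition. -/
theorem pairMat_repl {s : ℕ} {m : Fin s → ℕ} {t t' u : ℕ} (hu : u ≠ t) (hu' : u ≠ t') {a b : ℤ}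
    (hab : |a - b| = 1) {f f' g g' : Label .ord m} (ef : f'.1 = repl u a b f.1)
    (of : Occ u a f.1 ∧ ¬ Occ u b f.1) (eg : g'.1 = repl u b a g.1)
    (og : Occ u b g.1 ∧ ¬ Occ u a g.1) : pairMat t t' g f' = pairMat t t' g' f := by
  have hba : |b - a| = 1 := by rwa [abs_sub_comm]
  have hne : a ≠ b := by rintro rfl; simp at hab
  classical
  unfold pairMat
  refine if_congr ?_ (finprod_congr fun x => ?_) rfl
  · refine forall_congr' fun v => forall_congr' fun h1 => forall_congr' fun h2 =>
      forall_congr' fun x => ?_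
    rw [ef, eg, occ_repl of.1 hba, occ_repl og.1 hab]
    by_cases hv : v = u
    · subst hv
      by_cases hx : x = a
      · subst hx; simp [hne, of.1, og.2]
      · by_cases hx' : x = b
        · subst hx'; simp [Ne.symm hne, of.2, og.1]
        · simp [hx, hx']
    · simp [hv]
  · unfold colWgt
    rw [ef, eg, oc_repl of.1 hba, oc_repl of.1 hba, oc_repl og.1 hab, oc_repl og.1 hab,
      blockCnt_repl _ (fun h => absurd h hu), blockCnt_repl _ (fun h => absurd h hu)]
    simp [hu.symm, hu'.symm]

theorem pairOp_hop_comm {s : ℕ} {m : Fin s → ℕ} {t t' u : ℕ} (htt : t < t') (ht' : t' ≤ s)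
    (hu : u ≠ t) (hu' : u ≠ t') {a b : ℤ} (hab : |a - b| = 1) :
    Commute (pairOp m t t') (hop .ord m u a b) := by
  have hba : |b - a| = 1 := by rwa [abs_sub_comm]
  have hne : a ≠ b := by rintro rfl; simp at hab
  refine ext_of_isLocal (isLocal_mul (isTri_pairOp htt ht').isLocal (isLocal_hop hab))
    (isLocal_mul (isLocal_hop hab) (isTri_pairOp htt ht').isLocal) fun f => fock_ext fun g => ?_
  rw [Module.End.mul_apply, Module.End.mul_apply]
  rcases pairOp_hop_monomial (u := u) htt ht' hab f g with ⟨f', ef, of, nf, hf⟩ | ⟨nf, hf⟩ <;>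
  rcases hop_cases (κ := .ord) (m := m) (t := u) hab g with ⟨g', eg, og, ng, hg⟩ | ⟨ng, hg⟩ <;>
  rw [hf, hg]
  · rw [pairOp_monomial htt ht']
    exact pairMat_repl hu hu' hab ef ⟨of, nf⟩ eg ⟨og, ng⟩
  · by_contra h
    have h1 := pairMat_ne_zero_occ h u hu hu'
    refine absurd (ng ((h1 b).mp ?_)) (fun h2 => ?_)
    · rw [ef, occ_repl of hba]; exact Or.inl ⟨rfl, rfl⟩
    · have h3 := (h1 a).mpr h2
      rw [ef, occ_repl of hba] at h3
      simp [hne] at h3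
  · rw [pairOp_monomial htt ht']
    by_contra h
    have h1 := pairMat_ne_zero_occ (Ne.symm h) u hu hu'
    refine nf ⟨(h1 a).mpr ?_, fun h2 => ?_⟩
    · rw [eg, occ_repl og hab]; exact Or.inl ⟨rfl, rfl⟩
    · have h3 := (h1 b).mp h2
      rw [eg, occ_repl og hab] at h3
      simp [Ne.symm hne] at h3

theorem pairOp_comm {s : ℕ} {m : Fin s → ℕ} {t t' u : ℕ} (htt : t < t') (ht' : t' ≤ s)
    (hu : u ≠ t) (hu' : u ≠ t') (x : Gen) :
    Commute (pairOp m t t') (vFamily .ord m u x) := by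
  cases x with
  | E a => exact pairOp_hop_comm htt ht' hu hu' (abs_succ_sub a)
  | F a => exact pairOp_hop_comm htt ht' hu hu' (abs_sub_succ a)
  | K a =>
    classical
    refine diag_pairOp htt ht' _ fun f g h => ?_
    exact if_congr (pairMat_ne_zero_occ h u hu hu' a) rfl rfl
  | Kinv a =>
    classical
    refine diag_pairOp htt ht' _ fun f g h => ?_
    exact if_congr (pairMat_ne_zero_occ h u hu hu' a) rfl rfl

/-- On the diagonal every parameter is 1, so a column contributes q if both blocks contain its value
and 1 otherwise. -/
theorem pairMat_self {s : ℕ} {m : Fin s → ℕ} {t t' : ℕ} (htt : t < t') (ht' : t' ≤ s)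
    (f : Label .ord m) : pairMat t t' f f = q ^ {x | Occ t x f.1 ∧ Occ t' x f.1}.ncard := by
  have hts : t < s := by omega
  have hfin : {x | Occ t x f.1 ∧ Occ t' x f.1}.Finite :=
    (valSet t f.1).finite_toSet.subset fun x hx => (mem_valSet hts).mpr hx.1
  unfold pairMat
  rw [if_pos fun _ _ _ _ => Iff.rfl,
    finprod_eq_prod_of_mulSupport_subset (s := hfin.toFinset), Set.ncard_eq_toFinset_card _ hfin]
  · refine Finset.prod_eq_pow_card fun x hx => ?_
    simp only [Set.Finite.mem_toFinset, Set.mem_ofPred_eq] at hx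
    unfold colWgt
    rw [oc_of hx.1, oc_of hx.2]
    rfl
  · intro x hx
    simp only [Set.Finite.coe_toFinset, Set.mem_ofPred_eq]
    by_contra hne
    refine hx ?_
    unfold colWgt
    rw [sub_self, zpow_zero]
    rw [← oc_eq_true, ← oc_eq_true] at hne
    cases h1 : oc t x f.1 <;> cases h2 : oc t' x f.1 <;> simp_all [wgt]

end FockDuality

end

noncomputable section
namespace FockDuality
open Gen

/-! ### Intertwiners of tensor products -/

/-- Coassociativity of the comultiplication on the generators. -/
theorem tensorFamily_assoc {B : Type} [Ring B] {D₁ D₂ D₃ : Gen → B}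
    (h₁₂ : ∀ x y, Commute (D₁ x) (D₂ y)) (h₂₃ : ∀ x y, Commute (D₂ x) (D₃ y)) :
    tensorFamily (tensorFamily D₁ D₂) D₃ = tensorFamily D₁ (tensorFamily D₂ D₃) := by
  funext x
  cases x with
  | E a =>
    simp only [tensorFamily]
    rw [mul_pair (h₂₃ _ _).symm, add_mul, add_assoc]
    simp only [mul_assoc]
  | F a =>
    simp only [tensorFamily]
    rw [mul_pair (h₁₂ _ _).symm, mul_add, add_assoc]
    simp only [mul_assoc]
  | K a => exact mul_assoc _ _ _
  | Kinv a => exact mul_assoc _ _ _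

theorem tensorFamily_commute {B : Type} [Ring B] {b : B} {D₁ D₂ : Gen → B}
    (h₁ : ∀ x, Commute b (D₁ x)) (h₂ : ∀ x, Commute b (D₂ x)) (x : Gen) :
    Commute b (tensorFamily D₁ D₂ x) := by
  cases x
  · exact (h₂ _).add_right ((h₁ _).mul_right ((h₂ _).mul_right (h₂ _)))
  · exact (h₁ _).add_right (((h₁ _).mul_right (h₁ _)).mul_right (h₂ _))
  · exact (h₁ _).mul_right (h₂ _)
  · exact (h₁ _).mul_right (h₂ _)

theorem tensorFamily_intertwine {B : Type} [Ring B] {b : B} {D₁ D₂ D₁' D₂' : Gen → B}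
    (h₁ : ∀ x, SemiconjBy b (D₁ x) (D₁' x)) (h₂ : ∀ x, SemiconjBy b (D₂ x) (D₂' x)) (x : Gen) :
    SemiconjBy b (tensorFamily D₁ D₂ x) (tensorFamily D₁' D₂' x) := by
  cases x
  · exact (h₂ _).add_right ((h₁ _).mul_right ((h₂ _).mul_right (h₂ _)))
  · exact (h₁ _).add_right (((h₁ _).mul_right (h₁ _)).mul_right (h₂ _))
  · exact (h₁ _).mul_right (h₂ _)
  · exact (h₁ _).mul_right (h₂ _)

theorem fockFamily_commute {s : ℕ} {m : Fin s → ℕ} {b : Module.End Qq (fockSpace .ord m)} {k : ℕ}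
    (h : ∀ u, u < k → ∀ x, Commute b (vFamily .ord m u x)) (x : Gen) :
    Commute b (fockFamily .ord m k x) := by
  induction k generalizing x with
  | zero =>
    cases x
    · exact Commute.zero_right _
    · exact Commute.zero_right _
    · exact Commute.one_right _
    · exact Commute.one_right _
  | succ k ih =>
    exact tensorFamily_commute (ih fun u hu => h u (by omega)) (h k (by omega)) x

/-- The action on the tensor product of the first `k` factors in the opposite order. -/
def revFamily {s : ℕ} (m : Fin s → ℕ) : ℕ → Gen → Module.End Qq (fockSpace .ord m)
  | 0 => counitFamily
  | k + 1 => tensorFamily (vFamily .ord m k) (revFamily m k)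

/-- The intertwiner moving the factor `k` past the first `j` factors. -/
def moveOp {s : ℕ} (m : Fin s → ℕ) (k : ℕ) : ℕ → Module.End Qq (fockSpace .ord m)
  | 0 => 1
  | j + 1 => pairOp m j k * moveOp m k j

/-- The intertwiner reversing the order of the first `k` factors. -/
def revIntertwiner {s : ℕ} (m : Fin s → ℕ) : ℕ → Module.End Qq (fockSpace .ord m)
  | 0 => 1
  | k + 1 => moveOp m k k * revIntertwiner m k

theorem moveOp_comm {s : ℕ} {m : Fin s → ℕ} {j k u : ℕ} (hjk : j ≤ k) (hk : k ≤ s) (hu : u ≠ k)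
    (hj : j ≤ u) (x : Gen) : Commute (moveOp m k j) (vFamily .ord m u x) := by
  induction j with
  | zero => exact Commute.one_left _
  | succ j ih =>
    exact (pairOp_comm (by omega) hk (by omega) hu x).mul_left (ih (by omega) (by omega))

theorem counit_tensorFamily {B : Type} [Ring B] (D : Gen → B) :
    tensorFamily counitFamily D = D ∧ tensorFamily D counitFamily = D := by
  constructor <;> funext x <;> cases x <;> simp [tensorFamily, counitFamily]

/-- Factor `k` first passes the factors before `j`, with factor `j` standing to the right as a
spectator. Then it passes factor `j`, with the earlier factors as spectators on the left.
Coassociativity provides the rebracketing. -/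
theorem moveOp_intertwine {s : ℕ} {m : Fin s → ℕ} {j k : ℕ} (hjk : j ≤ k) (hk : k ≤ s) (x : Gen) :
    SemiconjBy (moveOp m k j) (tensorFamily (vFamily .ord m k) (fockFamily .ord m j) x)
      (tensorFamily (fockFamily .ord m j) (vFamily .ord m k) x) := by
  induction j generalizing x with
  | zero =>
    change SemiconjBy 1 (tensorFamily _ counitFamily x) (tensorFamily counitFamily _ x)
    rw [(counit_tensorFamily _).1, (counit_tensorFamily _).2]
    exact SemiconjBy.one_left _
  | succ j ih =>
    have c1 : ∀ x y, Commute (fockFamily .ord m j x) (vFamily .ord m j y) :=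
      fockFamily_comm .ord m j j le_rfl
    have c2 : ∀ x y, Commute (fockFamily .ord m j x) (vFamily .ord m k y) :=
      fockFamily_comm .ord m j k (by omega)
    have c3 : ∀ x y, Commute (vFamily .ord m k x) (vFamily .ord m j y) :=
      vFamily_comm .ord m (by omega)
    have e1 : tensorFamily (vFamily .ord m k) (fockFamily .ord m (j + 1)) =
        tensorFamily (tensorFamily (vFamily .ord m k) (fockFamily .ord m j)) (vFamily .ord m j) :=
      (tensorFamily_assoc (fun x y => (c2 y x).symm) c1).symm
    have e2 : tensorFamily (fockFamily .ord m (j + 1)) (vFamily .ord m k) =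
        tensorFamily (fockFamily .ord m j)
          (tensorFamily (vFamily .ord m j) (vFamily .ord m k)) :=
      tensorFamily_assoc c1 fun x y => (c3 y x).symm
    rw [e1, e2]
    refine SemiconjBy.mul_left (y := tensorFamily (fockFamily .ord m j)
      (tensorFamily (vFamily .ord m k) (vFamily .ord m j)) x) ?_ ?_
    · have h1 : ∀ x, Commute (pairOp m j k) (fockFamily .ord m j x) :=
        fockFamily_commute fun u hu => pairOp_comm (by omega) hk (by omega) (by omega)
      have h2 : ∀ x, SemiconjBy (pairOp m j k)
          (tensorFamily (vFamily .ord m k) (vFamily .ord m j) x)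
          (tensorFamily (vFamily .ord m j) (vFamily .ord m k) x) :=
        fun x => pairOp_tensorFamily (by omega) hk x
      exact tensorFamily_intertwine (fun x => (h1 x).semiconjBy)
        h2 x
    · rw [← tensorFamily_assoc c2 c3]
      have h1 : ∀ x, Commute (moveOp m k j) (vFamily .ord m j x) :=
        moveOp_comm (by omega) hk (by omega) le_rfl
      exact tensorFamily_intertwine (ih (by omega)) (fun x => (h1 x).semiconjBy) x

theorem revIntertwiner_comm {s : ℕ} {m : Fin s → ℕ} {k u : ℕ} (hk : k ≤ u) (hu : u ≤ s) (x : Gen) :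
    Commute (revIntertwiner m k) (vFamily .ord m u x) := by
  induction k with
  | zero => exact Commute.one_left _
  | succ k ih =>
    exact (moveOp_comm le_rfl (by omega) (by omega) (by omega) x).mul_left (ih (by omega))

/-- In the opposite order factor `k` comes first. The factors behind it are put into order by
induction, and then factor `k` is moved past them. -/
theorem revIntertwiner_intertwine {s : ℕ} {m : Fin s → ℕ} {k : ℕ} (hk : k ≤ s + 1) (x : Gen) :
    SemiconjBy (revIntertwiner m k) (revFamily m k x) (fockFamily .ord m k x) := by
  induction k generalizing x with
  | zero => exact SemiconjBy.one_left _
  | succ k ih =>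
    have h1 : ∀ x, Commute (revIntertwiner m k) (vFamily .ord m k x) :=
      revIntertwiner_comm le_rfl (by omega)
    exact SemiconjBy.mul_left (moveOp_intertwine le_rfl (by omega) x)
      (tensorFamily_intertwine (fun x => (h1 x).semiconjBy) (ih (by omega)) x)

/-- The number of values common to the blocks `u` and `v`. -/
def common {s : ℕ} {m : Fin s → ℕ} (u v : ℕ) (f : Idx m → ℤ) : ℕ :=
  {x | Occ u x f ∧ Occ v x f}.ncard

/-- The number of pairs of equal values in different blocks. -/
def overlap {s : ℕ} {m : Fin s → ℕ} (k : ℕ) (f : Idx m → ℤ) : ℕ :=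
  ∑ v ∈ Finset.range k, ∑ u ∈ Finset.range v, common u v f

theorem isTri_moveOp {s : ℕ} {m : Fin s → ℕ} {j k : ℕ} (hjk : j ≤ k) (hk : k ≤ s) :
    IsTri (moveOp m k j) ∧ ∀ f, (moveOp m k j (monomial f)).1 f =
      q ^ ∑ u ∈ Finset.range j, common u k f.1 := by
  induction j with
  | zero =>
    refine ⟨isTri_one, fun f => ?_⟩
    rw [moveOp, Module.End.one_apply, monomial_apply_self, Finset.range_zero, Finset.sum_empty,
      pow_zero]
  | succ j ih =>
    obtain ⟨h1, h2⟩ := ih (by omega)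
    have h3 : IsTri (pairOp m j k) := isTri_pairOp (by omega) hk
    refine ⟨(h3.mul h1).1, fun f => ?_⟩
    rw [moveOp, (h3.mul h1).2, h2, pairOp_monomial (by omega) hk, pairMat_self (by omega) hk,
      Finset.sum_range_succ, add_comm, pow_add]
    rfl

/-- The diagonal coefficients of the two-block intertwiners multiply to q to the number of
coincidences between blocks. The normalisation of `revMap` cancels exactly this power. -/
theorem isTri_revIntertwiner {s : ℕ} {m : Fin s → ℕ} {k : ℕ} (hk : k ≤ s + 1) :
    IsTri (revIntertwiner m k) ∧ ∀ f, (revIntertwiner m k (monomial f)).1 f =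
      q ^ overlap k f.1 := by
  induction k with
  | zero =>
    refine ⟨isTri_one, fun f => ?_⟩
    rw [revIntertwiner, Module.End.one_apply, monomial_apply_self, overlap, Finset.range_zero,
      Finset.sum_empty, pow_zero]
  | succ k ih =>
    obtain ⟨h1, h2⟩ := ih (by omega)
    obtain ⟨h3, h4⟩ := isTri_moveOp (m := m) (le_refl k) (by omega)
    refine ⟨(h3.mul h1).1, fun f => ?_⟩
    rw [revIntertwiner, (h3.mul h1).2, h2, h4, overlap, overlap, Finset.sum_range_succ, add_comm,
      pow_add]

/-! ### The action of the generators, explicitly -/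

/-- The exponent of the eigenvalue of `K_a` on the factor `u`. -/
def occExp {s : ℕ} {m : Fin s → ℕ} (u : ℕ) (a : ℤ) (f : Idx m → ℤ) : ℤ := if oc u a f then 1 else 0

/-- The exponent of the eigenvalue of `K_{a+1} K_a⁻¹` on the factor `u`. -/
def kExp {s : ℕ} {m : Fin s → ℕ} (u : ℕ) (a : ℤ) (f : Idx m → ℤ) : ℤ :=
  occExp u (a + 1) f - occExp u a f

/-- The elements `K_a` act diagonally, with exponents `e`. -/
def ActsBy {s : ℕ} {m : Fin s → ℕ} (D : Gen → Module.End Qq (fockSpace .ord m))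
    (e : ℤ → (Idx m → ℤ) → ℤ) : Prop :=
  ∀ a u (g : Label .ord m), (D (K a) u).1 g = q ^ e a g.1 * u.1 g ∧
    (D (Kinv a) u).1 g = q ^ (-e a g.1) * u.1 g

theorem actsBy_vFamily {s : ℕ} {m : Fin s → ℕ} (t : ℕ) :
    ActsBy (vFamily .ord m t) (occExp t) := by
  intro a u g
  rw [vFamily_K_apply, vFamily_Kinv_apply]
  unfold occExp
  split_ifs <;> simp

theorem actsBy_counitFamily {s : ℕ} {m : Fin s → ℕ} :
    ActsBy (counitFamily : Gen → Module.End Qq (fockSpace .ord m)) 0 := by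
  intro a u g
  simp [counitFamily]

theorem ActsBy.tensor {s : ℕ} {m : Fin s → ℕ} {D₁ D₂ : Gen → Module.End Qq (fockSpace .ord m)}
    {e₁ e₂ : ℤ → (Idx m → ℤ) → ℤ} (h₁ : ActsBy D₁ e₁) (h₂ : ActsBy D₂ e₂) :
    ActsBy (tensorFamily D₁ D₂) (e₁ + e₂) := by
  intro a u g
  simp only [tensorFamily, Module.End.mul_apply]
  rw [(h₁ _ _ _).1, (h₁ _ _ _).2, (h₂ _ _ _).1, (h₂ _ _ _).2]
  simp only [Pi.add_apply, neg_add, zpow_add₀ q_ne_zero, mul_assoc]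
  exact ⟨trivial, trivial⟩

theorem ActsBy.KKinv {s : ℕ} {m : Fin s → ℕ} {D : Gen → Module.End Qq (fockSpace .ord m)}
    {e : ℤ → (Idx m → ℤ) → ℤ} (h : ActsBy D e) (a b : ℤ) (u : fockSpace .ord m)
    (g : Label .ord m) :
    ((D (K a) * D (Kinv b)) u).1 g = q ^ (e a g.1 - e b g.1) * u.1 g := by
  rw [Module.End.mul_apply, (h _ _ _).1, (h _ _ _).2, ← mul_assoc, ← zpow_add₀ q_ne_zero,
    ← sub_eq_add_neg]

theorem actsBy_fockFamily {s : ℕ} {m : Fin s → ℕ} (k : ℕ) :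
    ActsBy (fockFamily .ord m k) (∑ i ∈ Finset.range k, occExp i) := by
  induction k with
  | zero => exact actsBy_counitFamily
  | succ k ih =>
    rw [Finset.sum_range_succ]
    exact ih.tensor (actsBy_vFamily k)

theorem actsBy_revFamily {s : ℕ} {m : Fin s → ℕ} (k : ℕ) :
    ActsBy (revFamily m k) (∑ i ∈ Finset.range k, occExp i) := by
  induction k with
  | zero => exact actsBy_counitFamily
  | succ k ih =>
    rw [Finset.sum_range_succ, add_comm (∑ i ∈ _, _)]
    exact (actsBy_vFamily k).tensor ih

theorem revFamily_comm {s : ℕ} {m : Fin s → ℕ} {k u : ℕ} (hk : k ≤ u) (x y : Gen) :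
    Commute (revFamily m k x) (vFamily .ord m u y) := by
  induction k generalizing x with
  | zero =>
    cases x
    · exact Commute.zero_left _
    · exact Commute.zero_left _
    · exact Commute.one_left _
    · exact Commute.one_left _
  | succ k ih =>
    exact (tensorFamily_commute (fun x => vFamily_comm .ord m (show u ≠ k by omega) y x)
      (fun x => (ih (by omega) x).symm) x).symm

theorem sum_occExp {s : ℕ} {m : Fin s → ℕ} (k : ℕ) (a : ℤ) (g : Idx m → ℤ) :
    (∑ i ∈ Finset.range k, occExp i (m := m)) (a + 1) g -
      (∑ i ∈ Finset.range k, occExp i (m := m)) a g = ∑ i ∈ Finset.range k, kExp i a g := by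
  simp only [Finset.sum_apply, kExp, Finset.sum_sub_distrib]

/-- In the iterated comultiplication, E_a on factor `t` comes with K_{a+1} K_a⁻¹ on all factors
after `t`, whereas F_a comes with K_a K_{a+1}⁻¹ on all factors before `t`. In the opposite order of
factors, before and after are interchanged. -/
theorem fockFamily_E_apply {s : ℕ} {m : Fin s → ℕ} (k : ℕ) (a : ℤ) (u : fockSpace .ord m)
    (g : Label .ord m) : (fockFamily .ord m k (E a) u).1 g = ∑ t ∈ Finset.range k,
      q ^ (∑ i ∈ Finset.range k, if t < i then kExp i a g.1 else 0) *
        (hop .ord m t (a + 1) a u).1 g := by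
  induction k with
  | zero => simp [fockFamily, counitFamily]
  | succ k ih =>
    have h1 : Commute (fockFamily .ord m k (E a))
        (vFamily .ord m k (K (a + 1)) * vFamily .ord m k (Kinv a)) :=
      (fockFamily_comm .ord m k k le_rfl _ _).mul_right (fockFamily_comm .ord m k k le_rfl _ _)
    -- The diagonal elements are moved to the left, so that their eigenvalues are read off at the
    -- label `g` of the result.
    have h2 : fockFamily .ord m (k + 1) (E a) = hop .ord m k (a + 1) a +
        (vFamily .ord m k (K (a + 1)) * vFamily .ord m k (Kinv a)) * fockFamily .ord m k (E a) := by
      rw [← h1.eq]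
      rfl
    rw [h2]
    change (hop .ord m k (a + 1) a u).1 g + ((vFamily .ord m k (K (a + 1)) *
      vFamily .ord m k (Kinv a)) (fockFamily .ord m k (E a) u)).1 g = _
    rw [(actsBy_vFamily k).KKinv, ih, Finset.sum_range_succ, add_comm, Finset.mul_sum]
    congr 1
    · refine Finset.sum_congr rfl fun t ht => ?_
      rw [Finset.sum_range_succ, if_pos (Finset.mem_range.mp ht), zpow_add₀ q_ne_zero]
      change q ^ kExp k a g.1 * _ = _
      ring
    · rw [Finset.sum_eq_zero, zpow_zero, one_mul]
      intro i hi
      rw [if_neg]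
      rw [Finset.mem_range] at hi
      omega

theorem fockFamily_F_apply {s : ℕ} {m : Fin s → ℕ} (k : ℕ) (a : ℤ) (u : fockSpace .ord m)
    (g : Label .ord m) : (fockFamily .ord m k (F a) u).1 g = ∑ t ∈ Finset.range k,
      q ^ (-∑ i ∈ Finset.range t, kExp i a g.1) * (hop .ord m t a (a + 1) u).1 g := by
  induction k with
  | zero => simp [fockFamily, counitFamily]
  | succ k ih =>
    change (fockFamily .ord m k (F a) u).1 g + ((fockFamily .ord m k (K a) *
      fockFamily .ord m k (Kinv (a + 1))) (hop .ord m k a (a + 1) u)).1 g = _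
    rw [(actsBy_fockFamily k).KKinv, ih, Finset.sum_range_succ, ← neg_sub, sum_occExp]

theorem revFamily_E_apply {s : ℕ} {m : Fin s → ℕ} (k : ℕ) (a : ℤ) (u : fockSpace .ord m)
    (g : Label .ord m) : (revFamily m k (E a) u).1 g = ∑ t ∈ Finset.range k,
      q ^ (∑ i ∈ Finset.range t, kExp i a g.1) * (hop .ord m t (a + 1) a u).1 g := by
  induction k with
  | zero => simp [revFamily, counitFamily]
  | succ k ih =>
    have h1 : Commute (revFamily m k (K (a + 1)) * revFamily m k (Kinv a)) (hop .ord m k (a + 1) a) :=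
      (revFamily_comm le_rfl _ (E a)).mul_left (revFamily_comm le_rfl _ (E a))
    have h2 : revFamily m (k + 1) (E a) = revFamily m k (E a) +
        (revFamily m k (K (a + 1)) * revFamily m k (Kinv a)) * hop .ord m k (a + 1) a := by
      rw [h1.eq]
      rfl
    rw [h2]
    change (revFamily m k (E a) u).1 g + ((revFamily m k (K (a + 1)) *
      revFamily m k (Kinv a)) (hop .ord m k (a + 1) a u)).1 g = _
    rw [(actsBy_revFamily k).KKinv, ih, Finset.sum_range_succ, sum_occExp]

theorem revFamily_F_apply {s : ℕ} {m : Fin s → ℕ} (k : ℕ) (a : ℤ) (u : fockSpace .ord m)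
    (g : Label .ord m) : (revFamily m k (F a) u).1 g = ∑ t ∈ Finset.range k,
      q ^ (-∑ i ∈ Finset.range k, if t < i then kExp i a g.1 else 0) *
        (hop .ord m t a (a + 1) u).1 g := by
  induction k with
  | zero => simp [revFamily, counitFamily]
  | succ k ih =>
    change (hop .ord m k a (a + 1) u).1 g + ((vFamily .ord m k (K a) *
      vFamily .ord m k (Kinv (a + 1))) (revFamily m k (F a) u)).1 g = _
    rw [(actsBy_vFamily k).KKinv, ih, Finset.sum_range_succ, add_comm, Finset.mul_sum]
    congr 1
    · refine Finset.sum_congr rfl fun t ht => ?_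
      rw [Finset.sum_range_succ, if_pos (Finset.mem_range.mp ht), neg_add, zpow_add₀ q_ne_zero,
        ← neg_sub (occExp k (a + 1) g.1)]
      change q ^ (-kExp k a g.1) * _ = _
      ring
    · rw [Finset.sum_eq_zero, neg_zero, zpow_zero, one_mul]
      intro i hi
      rw [if_neg]
      rw [Finset.mem_range] at hi
      omega

/-! ### The anti-linear reversal -/

theorem common_comm {s : ℕ} {m : Fin s → ℕ} (u v : ℕ) (f : Idx m → ℤ) :
    common u v f = common v u f := by
  unfold common
  simp only [and_comm]

theorem finite_common {s : ℕ} {m : Fin s → ℕ} {u v : ℕ} (huv : u ≠ v) (hu : u ≤ s) (hv : v ≤ s)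
    (f : Label .ord m) : {x | Occ u x f.1 ∧ Occ v x f.1}.Finite := by
  rcases lt_or_ge u s with h | h
  · exact (valSet u f.1).finite_toSet.subset fun x hx => (mem_valSet h).mpr hx.1
  · exact (valSet v f.1).finite_toSet.subset fun x hx => (mem_valSet (by omega)).mpr hx.2

/-- The coincidence at `b` is lost if block `u` contains `b`, and one at `a` is gained if it
contains `a`. -/
theorem common_repl {s : ℕ} {m : Fin s → ℕ} {u t : ℕ} (hut : u ≠ t) (hu : u ≤ s) (ht : t ≤ s)
    {a b : ℤ} (hab : |a - b| = 1) {g : Label .ord m} (hb : Occ t b g.1) (ha : ¬ Occ t a g.1) :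
    (common u t (repl t b a g.1) : ℤ) = common u t g.1 + (occExp u a g.1 - occExp u b g.1) := by
  have hfin := finite_common hut hu ht g
  have hne : a ≠ b := by rintro rfl; simp at hab
  have e : {x | Occ u x (repl t b a g.1) ∧ Occ t x (repl t b a g.1)} =
      {x | Occ u x g.1 ∧ x = a} ∪ ({x | Occ u x g.1 ∧ Occ t x g.1} \ {b}) := by
    ext x
    simp only [Set.mem_ofPred_eq, occ_repl hb hab, Set.mem_union, Set.mem_sdiff,
      Set.mem_singleton_iff]
    tauto
  unfold common occExp
  rw [e, Set.ncard_union_eq _ (Set.toFinite {a} |>.subset fun x hx => hx.2) hfin.sdiff]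
  · have e1 : ({x | Occ u x g.1 ∧ x = a}.ncard : ℤ) = if oc u a g.1 then 1 else 0 := by
      split_ifs with h
      · rw [oc_eq_true] at h
        have : {x | Occ u x g.1 ∧ x = a} = {a} := by
          ext x; simp only [Set.mem_ofPred_eq, Set.mem_singleton_iff]
          exact ⟨fun h => h.2, fun h' => ⟨h' ▸ h, h'⟩⟩
        rw [this, Set.ncard_singleton, Nat.cast_one]
      · rw [oc_eq_true] at h
        have : {x | Occ u x g.1 ∧ x = a} = ∅ := by
          ext x; simp only [Set.mem_ofPred_eq, Set.mem_empty_iff_false, iff_false]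
          rintro ⟨h1, rfl⟩; exact h h1
        rw [this, Set.ncard_empty, Nat.cast_zero]
    have e2 : (({x | Occ u x g.1 ∧ Occ t x g.1} \ {b}).ncard : ℤ) =
        {x | Occ u x g.1 ∧ Occ t x g.1}.ncard - if oc u b g.1 then 1 else 0 := by
      split_ifs with h
      · rw [oc_eq_true] at h
        have := Set.ncard_sdiff_singleton_add_one
          (show b ∈ {x | Occ u x g.1 ∧ Occ t x g.1} from ⟨h, hb⟩) hfin
        omega
      · rw [oc_eq_true] at h
        rw [Set.sdiff_singleton_eq_self fun h' => h h'.1, sub_zero]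
    push_cast
    rw [e1, e2]
    ring
  · rw [Set.disjoint_left]
    rintro x ⟨-, rfl⟩ ⟨⟨-, h⟩, -⟩
    exact ha h

theorem common_repl_of_ne {s : ℕ} {m : Fin s → ℕ} {u v t : ℕ} (hut : u ≠ t) (hvt : v ≠ t)
    {a b : ℤ} (hab : |a - b| = 1) {g : Label .ord m} (hb : Occ t b g.1) :
    common u v (repl t b a g.1) = common u v g.1 := by
  unfold common
  simp [occ_repl hb hab, hut, hvt]

/-- Only pairs involving block `t` change, so the difference is a sum over all other blocks. The
factors before and after `t` enter symmetrically, which allows one group to be traded for the other.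
-/
theorem overlap_repl {s : ℕ} {m : Fin s → ℕ} {k t : ℕ} (htk : t < k) (hk : k ≤ s + 1)
    {a b : ℤ} (hab : |a - b| = 1) {g : Label .ord m} (hb : Occ t b g.1) (ha : ¬ Occ t a g.1) :
    (overlap k (repl t b a g.1) : ℤ) = overlap k g.1 +
      (∑ i ∈ Finset.range t, (occExp i a g.1 - occExp i b g.1) +
        ∑ i ∈ Finset.range k, if t < i then occExp i a g.1 - occExp i b g.1 else 0) := by
  have key : ∀ v, v ≤ s → ((∑ u ∈ Finset.range v, common u v (repl t b a g.1) : ℕ) : ℤ) =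
      (∑ u ∈ Finset.range v, common u v g.1 : ℕ) +
      ((if v = t then ∑ i ∈ Finset.range t, (occExp i a g.1 - occExp i b g.1) else 0) +
        if t < v then occExp v a g.1 - occExp v b g.1 else 0) := by
    intro v hv
    push_cast
    rcases lt_trichotomy v t with h | rfl | h
    · rw [if_neg h.ne, if_neg h.not_gt, add_zero, add_zero]
      refine Finset.sum_congr rfl fun u hu => ?_
      rw [Finset.mem_range] at hu
      rw [common_repl_of_ne (by omega) h.ne hab hb]
    · rw [if_pos rfl, if_neg (lt_irrefl _), add_zero, ← Finset.sum_add_distrib]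
      refine Finset.sum_congr rfl fun u hu => ?_
      rw [Finset.mem_range] at hu
      exact common_repl (by omega) (by omega) hv hab hb ha
    · rw [if_neg h.ne', if_pos h, zero_add,
        ← Finset.add_sum_erase _ _ (Finset.mem_range.mpr h),
        ← Finset.add_sum_erase (Finset.range v) (fun u => (common u v g.1 : ℤ))
          (Finset.mem_range.mpr h), common_comm t v, common_comm t v,
        common_repl h.ne' hv (by omega) hab hb ha,
        Finset.sum_congr rfl (g := fun u => (common u v g.1 : ℤ))]
      · ring
      · intro u hu
        rw [Finset.mem_erase] at hu
        rw [common_repl_of_ne hu.1 h.ne' hab hb]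
  unfold overlap
  push_cast at key ⊢
  rw [Finset.sum_congr rfl fun v hv => key v (by rw [Finset.mem_range] at hv; omega),
    Finset.sum_add_distrib, Finset.sum_add_distrib, Finset.sum_ite_eq',
    if_pos (Finset.mem_range.mpr htk)]

/-- The anti-linear map reversing the order of the tensor factors. -/
def revMap {s : ℕ} (m : Fin s → ℕ) : fockSpace .ord m →ₛₗ[qBar] fockSpace .ord m where
  toFun u := ⟨fun g => q ^ (-(overlap (s + 1) g.1 : ℤ)) * qBar (u.1 g), fun n =>
    (u.2 n).subset fun f ⟨h1, h2⟩ => ⟨fun h => h1 (by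
      change _ * qBar (u.1 f) = 0
      rw [h, map_zero, mul_zero]), h2⟩⟩
  map_add' u v := fock_ext fun g => by
    change _ * qBar (u.1 g + v.1 g) = _ * _ + _ * _
    rw [map_add, mul_add]
  map_smul' c u := fock_ext fun g => by
    change _ * qBar (c * u.1 g) = qBar c * (_ * _)
    rw [map_mul, mul_left_comm]

theorem revMap_apply {s : ℕ} {m : Fin s → ℕ} (u : fockSpace .ord m) (g : Label .ord m) :
    (revMap m u).1 g = q ^ (-(overlap (s + 1) g.1 : ℤ)) * qBar (u.1 g) := rfl

theorem revMap_monomial {s : ℕ} {m : Fin s → ℕ} (f : Label .ord m) :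
    revMap m (monomial f) = q ^ (-(overlap (s + 1) f.1 : ℤ)) • monomial f := by
  refine fock_ext fun g => ?_
  rw [revMap_apply]
  change _ = _ * (monomial f).1 g
  by_cases h : g = f
  · rw [h, monomial_apply_self, map_one]
  · rw [monomial_apply_ne h, map_zero, mul_zero, mul_zero]

/-- The images of the generators under the bar involution, as generators. -/
def barIdx : Gen → Gen
  | E a => E a
  | F a => F a
  | K a => Kinv a
  | Kinv a => K a

theorem revMap_hop {s : ℕ} {m : Fin s → ℕ} {t : ℕ} (ht : t < s + 1) {a b : ℤ} (hab : |a - b| = 1)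
    (u : fockSpace .ord m) (g : Label .ord m) (n : ℤ) :
    q ^ (-(overlap (s + 1) g.1 : ℤ) + n) * qBar ((hop .ord m t a b u).1 g) =
      q ^ (n + (∑ i ∈ Finset.range t, (occExp i a g.1 - occExp i b g.1) +
        ∑ i ∈ Finset.range (s + 1), if t < i then occExp i a g.1 - occExp i b g.1 else 0)) *
      (hop .ord m t a b (revMap m u)).1 g := by
  rcases hop_cases (κ := .ord) (m := m) (t := t) hab g with ⟨g', e, o, n, h⟩ | ⟨n, h⟩
  · rw [h, h, revMap_apply, ← mul_assoc, ← zpow_add₀ q_ne_zero, e,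
      overlap_repl ht le_rfl hab o n]
    congr 2
    ring
  · rw [h, h, map_zero, mul_zero, mul_zero]

/-- For E_a, conjugation negates the exponent, which is the sum of `kExp` over the factors after
`t`. The change of `overlap` under the hop adds the sum of `kExp` over all factors other than `t`.
What remains is the sum over the factors before `t`, as in the opposite order. F_a is similar with
the opposite signs. -/
theorem revMap_intertwine {s : ℕ} {m : Fin s → ℕ} (x : Gen) (u : fockSpace .ord m) :
    revMap m (fockFamily .ord m (s + 1) x u) = revFamily m (s + 1) (barIdx x) (revMap m u) := by
  refine fock_ext fun g => ?_
  rw [revMap_apply]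
  cases x with
  | E a =>
    rw [fockFamily_E_apply, barIdx, revFamily_E_apply, map_sum, Finset.mul_sum]
    refine Finset.sum_congr rfl fun t ht => ?_
    rw [map_mul, qBar_q_zpow, ← mul_assoc, ← zpow_add₀ q_ne_zero,
      revMap_hop (Finset.mem_range.mp ht) (abs_succ_sub a)]
    congr 2
    simp only [kExp]
    ring
  | F a =>
    rw [fockFamily_F_apply, barIdx, revFamily_F_apply, map_sum, Finset.mul_sum]
    refine Finset.sum_congr rfl fun t ht => ?_
    rw [map_mul, qBar_q_zpow, ← mul_assoc, ← zpow_add₀ q_ne_zero,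
      revMap_hop (Finset.mem_range.mp ht) (abs_sub_succ a)]
    congr 2
    have : ∀ i, occExp i a g.1 - occExp i (a + 1) g.1 = -kExp i a g.1 := fun i => by
      simp only [kExp, neg_sub]
    have h2 : ∀ i, (if t < i then -kExp i a g.1 else 0) = -if t < i then kExp i a g.1 else 0 :=
      fun i => by split_ifs <;> simp
    simp only [this, h2, Finset.sum_neg_distrib]
    ring
  | K a =>
    rw [barIdx, (actsBy_fockFamily _ _ _ _).1, (actsBy_revFamily _ _ _ _).2, revMap_apply, map_mul,
      qBar_q_zpow]
    ring
  | Kinv a =>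
    rw [barIdx, (actsBy_fockFamily _ _ _ _).2, (actsBy_revFamily _ _ _ _).1, revMap_apply, map_mul,
      qBar_q_zpow, neg_neg]
    ring

/-! ### The bar map -/

/-- The bar map of the completed Fock space. -/
def barMap {s : ℕ} (m : Fin s → ℕ) : fockSpace .ord m →ₛₗ[qBar] fockSpace .ord m :=
  (revIntertwiner m (s + 1)).comp (revMap m)

theorem barMap_monomial {s : ℕ} {m : Fin s → ℕ} (f g : Label .ord m) :
    (barMap m (monomial f)).1 g = q ^ (-(overlap (s + 1) f.1 : ℤ)) *
      (revIntertwiner m (s + 1) (monomial f)).1 g := by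
  change (revIntertwiner m (s + 1) (revMap m (monomial f))).1 g = _
  rw [revMap_monomial, map_smul]
  rfl

theorem barMap_monomial_self {s : ℕ} {m : Fin s → ℕ} (f : Label .ord m) :
    (barMap m (monomial f)).1 f = 1 := by
  rw [barMap_monomial, (isTri_revIntertwiner le_rfl).2, zpow_neg, zpow_natCast,
    inv_mul_cancel₀ (pow_ne_zero _ q_ne_zero)]

theorem barMap_laurent {s : ℕ} {m : Fin s → ℕ} (f g : Label .ord m) :
    (barMap m (monomial f)).1 g ∈ laurentInt := by
  rw [barMap_monomial]
  exact mul_mem (q_zpow_mem_laurentInt _) ((isTri_revIntertwiner le_rfl).1.laurent f g)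

theorem barMap_below {s : ℕ} {m : Fin s → ℕ} {f g : Label .ord m}
    (h : (barMap m (monomial f)).1 g ≠ 0) : BothBelow g f := by
  rw [barMap_monomial] at h
  exact (isTri_revIntertwiner le_rfl).1.below f g (right_ne_zero_of_mul h)

theorem isLocal_barMap {s : ℕ} {m : Fin s → ℕ} : IsLocal (barMap m) := by
  refine isLocal_comp (X := revIntertwiner m (s + 1)) (isTri_revIntertwiner le_rfl).1.isLocal
    (fun n => ⟨n, fun u hu g hg => ?_⟩)
  rw [revMap_apply, hu g hg, map_zero, mul_zero]

theorem barMap_generator {s : ℕ} {m : Fin s → ℕ} (x : Gen) (u : fockSpace .ord m) :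
    barMap m (fockRep .ord m (UqGl.gen x) u) = fockRep .ord m (barU (UqGl.gen x)) (barMap m u) := by
  have h1 : barU (UqGl.gen x) = UqGl.gen (barIdx x) := by
    rw [barU_gen]
    cases x <;> rfl
  have h2 := revIntertwiner_intertwine (m := m) (k := s + 1) le_rfl (barIdx x)
  unfold fockRep
  rw [h1, UqGl.lift_gen, UqGl.lift_gen]
  change revIntertwiner m (s + 1) (revMap m _) = _
  rw [revMap_intertwine]
  exact LinearMap.congr_fun h2.eq (revMap m u)

theorem barU_algebraMap (r : Qq) : barU (algebraMap Qq UqGl r) = algebraMap Qq UqGl (qBar r) := by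
  rw [Algebra.algebraMap_eq_smul_one, Algebra.algebraMap_eq_smul_one, barU_smul, map_one]

theorem barMap_equivariant {s : ℕ} {m : Fin s → ℕ} (X : UqGl) (hX : X ∈ UqSl)
    (u : fockSpace .ord m) :
    barMap m (fockRep .ord m X u) = fockRep .ord m (barU X) (barMap m u) := by
  induction hX using Algebra.adjoin_induction generalizing u with
  | mem X hX =>
    simp only [Set.mem_iUnion, Set.mem_insert_iff, Set.mem_singleton_iff] at hX
    obtain ⟨a, rfl | rfl | rfl⟩ := hX
    · exact barMap_generator _ u
    · exact barMap_generator _ u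
    · rw [map_mul, map_mul, map_mul, Module.End.mul_apply, Module.End.mul_apply, barMap_generator,
        barMap_generator]
  | algebraMap r =>
    rw [barU_algebraMap, AlgHom.commutes, AlgHom.commutes, Module.algebraMap_end_apply,
      Module.algebraMap_end_apply, map_smulₛₗ]
  | add X Y _ _ hX hY =>
    rw [map_add, map_add, map_add, LinearMap.add_apply, LinearMap.add_apply, map_add, hX, hY]
  | mul X Y _ _ hX hY =>
    rw [map_mul, map_mul, map_mul, Module.End.mul_apply, Module.End.mul_apply, hX, hY]

end FockDuality

end

noncomputable section
namespace FockDuality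
open Gen

/-! ### Seeds -/

/-- A label whose entries before the last block increase from block to block, and such that all
integers below one of them are entries of the last block. -/
structure IsSeed {s : ℕ} {m : Fin s → ℕ} (f : Idx m → ℤ) : Prop where
  low : ∀ p x, x ≤ f (.inl p) → Occ s x f
  lt : ∀ p r : Σ t : Fin s, Fin (m t), p.1 < r.1 → f (.inl p) < f (.inl r)

/-- Let v be the largest finite entry of the seed. Above v neither label has finite entries, and the
last blocks have equally many. Up to v the last block of the seed is full, so that of `g` cannot
contain more. By conservation of weight the finite blocks of `g` lose nothing. -/
theorem IsSeed.cnt_last_eq {s : ℕ} {m : Fin s → ℕ} {f g : Label .ord m} (hf : IsSeed f.1)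
    (h : DLe g f) (x : ℤ) : cnt s x g.1 = cnt s x f.1 := by
  classical
  refine le_antisymm (h.2 s x) ?_
  by_cases hx : ∃ p, x ≤ f.1 (.inl p)
  swap
  · push Not at hx
    have : cnt s x f.1 = 0 := by
      unfold cnt
      rw [Finset.card_eq_zero, Finset.filter_eq_empty_iff]
      rintro p - ⟨-, hp⟩
      exact absurd (hx p) (not_lt.mpr hp)
    omega
  obtain ⟨Z₁, h1⟩ := exists_bound f
  obtain ⟨Z₂, h2⟩ := exists_bound g
  obtain ⟨h1, -⟩ := h1 (max Z₁ Z₂) (le_max_left _ _)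
  obtain ⟨h2, -⟩ := h2 (max Z₁ Z₂) (le_max_right _ _)
  set Z := max Z₁ Z₂
  obtain ⟨p₀, hp₀⟩ := hx
  have : Nonempty (Σ t : Fin s, Fin (m t)) := ⟨p₀⟩
  obtain ⟨p, hp⟩ := Finite.exists_max fun p => f.1 (.inl p)
  set v := f.1 (.inl p)
  have hxv : x ≤ v := hp₀.trans (hp p₀)
  have hvZ : v ≤ Z := h1 p
  have split : ∀ k : Idx m → ℤ, lastCnt x Z k =
      ((Finset.Icc x v).filter fun y => Occ s y k).card + lastCnt (v + 1) Z k := by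
    intro k
    unfold lastCnt
    rw [← Finset.card_union_of_disjoint, ← Finset.filter_union]
    · congr 2
      ext y
      simp only [Finset.mem_Icc, Finset.mem_union]
      omega
    · refine Finset.disjoint_filter_filter ?_
      rw [Finset.disjoint_left]
      intro y hy hy'
      rw [Finset.mem_Icc] at hy hy'
      omega
  have top : cnt s (v + 1) f.1 = 0 := by
    unfold cnt
    rw [Finset.card_eq_zero, Finset.filter_eq_empty_iff]
    rintro r - ⟨-, hr⟩
    have := hp r
    omega
  have e0 := h.2 s (v + 1)
  have e1 := sum_col (v + 1) Z f.1 h1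
  have e2 := sum_col (v + 1) Z g.1 h2
  have e3 := sum_col x Z f.1 h1
  have e4 := sum_col x Z g.1 h2
  rw [Finset.sum_congr rfl fun y _ => h.1 y] at e2 e4
  have e5 : ((Finset.Icc x v).filter fun y => Occ s y f.1) = Finset.Icc x v :=
    Finset.filter_true_of_mem fun y hy => hf.low p y (Finset.mem_Icc.mp hy).2
  have e6 := Finset.card_filter_le (Finset.Icc x v) fun y => Occ s y g.1
  have e7 := split f.1
  have e8 := split g.1
  rw [e5] at e7
  omega

theorem cnt_last_split {s : ℕ} {m : Fin s → ℕ} (w : ℕ) (y : ℤ) (f : Idx m → ℤ) :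
    cnt s y f = (Finset.univ.filter fun p : Σ t : Fin s, Fin (m t) =>
      (p.1 : ℕ) < w ∧ y ≤ f (.inl p)).card + (Finset.univ.filter fun p : Σ t : Fin s, Fin (m t) =>
      ¬ (p.1 : ℕ) < w ∧ y ≤ f (.inl p)).card := by
  unfold cnt
  rw [← Finset.card_union_of_disjoint]
  · congr 1
    ext p
    simp only [Finset.mem_filter, Finset.mem_univ, true_and, Finset.mem_union]
    have := p.1.2
    tauto
  · refine Finset.disjoint_filter.mpr fun p _ h1 h2 => h2.1 h1.1

/-- Seeds are minimal. -/
theorem IsSeed.eq_of_dle {s : ℕ} {m : Fin s → ℕ} {f g : Label .ord m} (hf : IsSeed f.1)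
    (h : DLe g f) : g = f := by
  refine h.antisymm ⟨fun x => (h.1 x).symm, fun w y => ?_⟩
  by_cases h0 : cnt w y f.1 = 0
  · omega
  obtain ⟨p, hp⟩ := Finset.card_pos.mp (Nat.pos_of_ne_zero h0)
  simp only [Finset.mem_filter, Finset.mem_univ, true_and] at hp
  have e1 := cnt_last_split w y f.1
  have e2 := cnt_last_split w y g.1
  have e3 := hf.cnt_last_eq h y
  -- Once the seed has an entry ≥ y before block `w`, all its entries from block `w` on are larger
  -- still. So `g` has no surplus there, and equality of the totals puts at least as many entries of
  -- `g` before block `w`.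
  have e4 : (Finset.univ.filter fun r : Σ t : Fin s, Fin (m t) =>
      ¬ (r.1 : ℕ) < w ∧ y ≤ g.1 (.inl r)) ⊆ Finset.univ.filter fun r : Σ t : Fin s, Fin (m t) =>
      ¬ (r.1 : ℕ) < w ∧ y ≤ f.1 (.inl r) := by
    intro r hr
    simp only [Finset.mem_filter, Finset.mem_univ, true_and] at hr ⊢
    refine ⟨hr.1, hp.2.trans (hf.lt p r ?_).le⟩
    rw [Fin.lt_def]
    omega
  have e5 := Finset.card_le_card e4
  change cnt s y f.1 = cnt w y f.1 + _ at e1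
  change cnt s y g.1 = cnt w y g.1 + _ at e2
  omega

/-! ### Leading terms -/

theorem repl_eq_update {s : ℕ} {m : Fin s → ℕ} {κ : Kind} {t : ℕ} {a b : ℤ} {g : Label κ m}
    {i : Idx m} (hi : block i = t) (hb : g.1 i = b) : repl t b a g.1 = Function.update g.1 i a := by
  funext j
  unfold repl
  by_cases h : j = i
  · subst h
    rw [if_pos ⟨hi, hb⟩, Function.update_self]
  · rw [Function.update_of_ne h, if_neg]
    rintro ⟨h1, h2⟩
    exact h (g.2.inj (h1.trans hi.symm) (h2.trans hb.symm))

theorem finite_fiber {s : ℕ} {m : Fin s → ℕ} {κ : Kind} (g : Label κ m) (x : ℤ) :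
    {i | g.1 i = x}.Finite := by
  refine Set.Finite.of_finite_image (f := block) ((Set.finite_Iic s).subset ?_) ?_
  · rintro _ ⟨i, -, rfl⟩
    rcases i with p | j
    · exact Set.mem_Iic.mpr p.1.2.le
    · exact Set.mem_Iic.mpr (le_refl s)
  · intro i hi j hj h
    exact g.2.inj h (hi.trans hj.symm)

theorem col_repl {s : ℕ} {m : Fin s → ℕ} {t : ℕ} {a b : ℤ} (hne : a ≠ b) {g g' : Label .ord m}
    (e : g'.1 = repl t b a g.1) (o : Occ t b g.1) (x : ℤ) :
    (col x g'.1 : ℤ) = col x g.1 + (if x = a then 1 else 0) - (if x = b then 1 else 0) := by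
  obtain ⟨i, hi, hb⟩ := o
  rw [mult_add_eq_ncard, mult_add_eq_ncard, e, repl_eq_update hi hb]
  have hfin := finite_fiber g x
  by_cases hxa : x = a
  · subst hxa
    have : {j | Function.update g.1 i x j = x} = insert i {j | g.1 j = x} := by
      ext j
      by_cases h : j = i
      · subst h; simp
      · simp [h]
    rw [this, Set.ncard_insert_of_notMem (by simp [hb, Ne.symm hne]) hfin, if_pos rfl, if_neg hne]
    push_cast
    ring
  · by_cases hxb : x = b
    · have : {j | Function.update g.1 i a j = x} = {j | g.1 j = x} \ {i} := by
        ext j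
        by_cases h : j = i
        · subst h; simp [Ne.symm hxa]
        · simp [h]
      have h1 := Set.ncard_sdiff_singleton_add_one
        (show i ∈ {j | g.1 j = x} from hb.trans hxb.symm) hfin
      rw [this, if_neg hxa, if_pos hxb]
      omega
    · have : {j | Function.update g.1 i a j = x} = {j | g.1 j = x} := by
        ext j
        by_cases h : j = i
        · subst h; simp [Ne.symm hxa, hb, Ne.symm hxb]
        · simp [Function.update_of_ne h]
      rw [this, if_neg hxa, if_neg hxb]
      ring

theorem cnt_repl {s : ℕ} {m : Fin s → ℕ} {v : ℕ} {a : ℤ} {g : Label .ord m}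
    (o : Occ v (a + 1) g.1) (w : ℕ) (y : ℤ) :
    cnt w y g.1 = cnt w y (repl v (a + 1) a g.1) +
      if y = a + 1 ∧ v < w ∧ v < s then 1 else 0 := by
  obtain ⟨i, hi, hb⟩ := o
  rw [repl_eq_update hi hb]
  unfold cnt
  rcases i with p | j
  · have hps := p.1.2
    change (p.1 : ℕ) = v at hi
    subst hi
    by_cases h : y = a + 1 ∧ (p.1 : ℕ) < w
    · rw [if_pos ⟨h.1, h.2, hps⟩, ← Finset.card_insert_of_notMem (a := p)]
      · congr 1
        ext r
        simp only [Finset.mem_filter, Finset.mem_univ, true_and, Finset.mem_insert]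
        by_cases hr : r = p
        · subst hr
          simp [h.2, hb, h.1]
        · rw [Function.update_of_ne (fun e => hr (Sum.inl_injective e))]
          simp [hr]
      · simp [h.1]
    · rw [if_neg (fun h' => h ⟨h'.1, h'.2.1⟩), add_zero]
      congr 1
      refine Finset.filter_congr fun r _ => and_congr_right fun hrw => ?_
      by_cases hr : r = p
      · subst hr
        rw [Function.update_self, hb]
        have : y ≠ a + 1 := fun e => h ⟨e, hrw⟩
        omega
      · rw [Function.update_of_ne (fun e => hr (Sum.inl_injective e))]
  · change s = v at hi
    rw [if_neg (by omega), add_zero]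
    congr 1

/-- `f` is the largest label with nonzero coefficient in `u`. -/
def Lead {s : ℕ} {m : Fin s → ℕ} (u : fockSpace .ord m) (f : Label .ord m) : Prop :=
  u.1 f ≠ 0 ∧ ∀ g, u.1 g ≠ 0 → DLe g f

/-- F_a raises an entry a to a+1. In blocks before `t` it cannot act on labels below `h`, as the
entries of `h` there are smaller than a. Raising in a block after `t` affects fewer counting
functions than raising in `t`. So the top term comes from block `t` of `h` alone, and no other block
contributes to its coefficient. -/
theorem lead_F {s : ℕ} {m : Fin s → ℕ} {t : ℕ} (ht : t < s) {a : ℤ} {u : fockSpace .ord m}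
    {f h : Label .ord m} (hu : Lead u h) (e : h.1 = repl t (a + 1) a f.1)
    (o : Occ t (a + 1) f.1) (n : ¬ Occ t a f.1)
    (hlow : ∀ p : Σ t : Fin s, Fin (m t), (p.1 : ℕ) < t → f.1 (.inl p) < a) :
    Lead (fockFamily .ord m (s + 1) (F a) u) f := by
  have hab := abs_sub_succ a
  have hcf : ∀ w y, cnt w y f.1 = cnt w y h.1 + if y = a + 1 ∧ t < w ∧ t < s then 1 else 0 :=
    fun w y => e ▸ cnt_repl o w y
  constructor
  · rw [fockFamily_F_apply, Finset.sum_eq_single t]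
    · rw [hop_apply hab u f h o n e]
      exact mul_ne_zero (zpow_ne_zero _ q_ne_zero) hu.1
    · intro v hv hvt
      rcases hop_cases (κ := .ord) (m := m) (t := v) hab f with ⟨k, ek, ok, nk, hk⟩ | ⟨nk, hk⟩
      · rw [hk]
        by_cases h0 : u.1 k = 0
        · rw [h0, mul_zero]
        · exfalso
          have hkh := hu.2 k h0
          -- An earlier block of `f` does not contain a+1. For a later block, `k` would have the
          -- count of `f` at (t+1, a+1), one more than `h`.
          rcases lt_or_gt_of_ne hvt with hlt | hgt
          · obtain ⟨p | j, hp, hx⟩ := ok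
            · have := hlow p (hp.trans_lt hlt)
              omega
            · exact absurd hp (by change s ≠ v; omega)
          · have h1 := hkh.2 (t + 1) (a + 1)
            have h2 := cnt_repl ok (t + 1) (a + 1)
            have h3 := hcf (t + 1) (a + 1)
            rw [if_neg (by omega), ← ek] at h2
            rw [if_pos ⟨rfl, by omega, ht⟩] at h3
            omega
      · rw [hk, mul_zero]
    · intro h'
      exact absurd (Finset.mem_range.mpr (by omega)) h'
  · intro g hg
    rw [fockFamily_F_apply] at hg
    obtain ⟨v, -, hv⟩ := Finset.exists_ne_zero_of_sum_ne_zero hg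
    have hv := right_ne_zero_of_mul hv
    rcases hop_cases (κ := .ord) (m := m) (t := v) hab g with ⟨k, ek, ok, nk, hk⟩ | ⟨nk, hk⟩
    swap
    · exact absurd (hk u) hv
    rw [hk] at hv
    have hkh := hu.2 k hv
    have hne : a ≠ a + 1 := by omega
    -- A hop in an earlier block would give `k` an entry a there, although `h` has only entries
    -- below a in the blocks up to that one.
    have hvt : t ≤ v := by
      by_contra hlt
      have h1 : Occ v a k.1 := by
        rw [ek, occ_repl ok hab]
        exact Or.inl ⟨rfl, rfl⟩
      obtain ⟨p | j, hp, hx⟩ := h1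
      · have h2 := hkh.2 (v + 1) a
        have h3 : 0 < cnt (v + 1) a k.1 := Finset.card_pos.mpr ⟨p, by
          simp only [Finset.mem_filter, Finset.mem_univ, true_and]
          exact ⟨by change (p.1 : ℕ) = v at hp; omega, hx.ge⟩⟩
        obtain ⟨r, hr⟩ := Finset.card_pos.mp (h3.trans_le h2)
        simp only [Finset.mem_filter, Finset.mem_univ, true_and] at hr
        have h4 := hlow r (by omega)
        have h5 : h.1 (.inl r) = f.1 (.inl r) := by
          rw [e]
          refine if_neg ?_
          rintro ⟨h6, -⟩
          change (r.1 : ℕ) = t at h6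
          omega
        omega
      · exact absurd hp (by change s ≠ v; omega)
    refine ⟨fun x => ?_, fun w y => ?_⟩
    · have h1 := col_repl hne e o x
      have h2 := col_repl hne ek ok x
      have h3 := hkh.1 x
      omega
    · have h1 := cnt_repl ok w y
      rw [← ek] at h1
      have h2 := hkh.2 w y
      have h3 := hcf w y
      rw [h1, h3]
      refine add_le_add h2 ?_
      split_ifs with h4 h5
      · exact le_rfl
      · exact absurd ⟨h4.1, by omega, ht⟩ h5
      · exact Nat.zero_le _
      · exact le_rfl

/-- `f` is the leading term of an element of the `𝒰`-submodule generated by the monomial of a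
seed. -/
def Reached {s : ℕ} {m : Fin s → ℕ} (f : Label .ord m) : Prop :=
  ∃ X ∈ UqSl, ∃ f₀ : Label .ord m, IsSeed f₀.1 ∧ Lead (fockRep .ord m X (monomial f₀)) f

theorem gen_F_mem (a : ℤ) : UqGl.gen (F a) ∈ UqSl :=
  Algebra.subset_adjoin (Set.mem_iUnion.mpr ⟨a, by simp⟩)

theorem Reached.step {s : ℕ} {m : Fin s → ℕ} {t : ℕ} (ht : t < s) {a : ℤ}
    {f h : Label .ord m} (hr : Reached h) (e : h.1 = repl t (a + 1) a f.1)
    (o : Occ t (a + 1) f.1) (n : ¬ Occ t a f.1)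
    (hlow : ∀ p : Σ t : Fin s, Fin (m t), (p.1 : ℕ) < t → f.1 (.inl p) < a) : Reached f := by
  obtain ⟨X, hX, f₀, h0, hL⟩ := hr
  refine ⟨UqGl.gen (F a) * X, mul_mem (gen_F_mem a) hX, f₀, h0, ?_⟩
  rw [map_mul, Module.End.mul_apply]
  have : fockRep .ord m (UqGl.gen (F a)) = fockFamily .ord m (s + 1) (F a) := UqGl.lift_gen _ _ _
  rw [this]
  exact lead_F ht hL e o n hlow

/-- Induction on the total distance from the entries of the finite blocks to `τ`. One entry is
lowered by 1, and `Reached.step` recovers `f` from the resulting label. Choosing the first block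
that differs from `τ` makes the earlier blocks small, and choosing the last such position in it
leaves room for the lowered entry. -/
theorem reached_of_target {s : ℕ} {m : Fin s → ℕ} {τ : (Σ t : Fin s, Fin (m t)) → ℤ}
    (hτ : ∀ t, StrictAnti fun k : Fin (m t) => τ ⟨t, k⟩)
    (hτ' : ∀ p r : Σ t : Fin s, Fin (m t), p.1 < r.1 → τ p < τ r)
    (f : Label .ord m) (hf : ∀ p, τ p ≤ f.1 (.inl p)) (hlow : ∀ p x, x ≤ τ p → Occ s x f.1) :
    Reached f := by
  classical
  induction hN : ∑ p, (f.1 (.inl p) - τ p).toNat using Nat.strong_induction_on generalizing f with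
  | _ N ih =>
    subst hN
    by_cases heq : ∀ p, f.1 (.inl p) = τ p
    · refine ⟨1, one_mem _, f, ⟨fun p x hx => hlow p x (heq p ▸ hx), fun p r h => ?_⟩, ?_⟩
      · rw [heq, heq]
        exact hτ' p r h
      · rw [map_one, Module.End.one_apply]
        refine ⟨by rw [monomial_apply_self]; exact one_ne_zero, fun g hg => ?_⟩
        by_cases e : g = f
        · rw [e]; exact DLe.refl f
        · exact absurd (monomial_apply_ne e) hg
    push Not at heq
    -- the first block which differs, and its last position which differs
    have hex : ∃ t : Fin s, ∃ k, f.1 (.inl ⟨t, k⟩) ≠ τ ⟨t, k⟩ := by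
      obtain ⟨⟨t, k⟩, h⟩ := heq
      exact ⟨t, k, h⟩
    obtain ⟨t, ⟨k₀, hk₀⟩, hmin⟩ := WellFounded.has_min
      (wellFounded_lt (α := Fin s)) {t | ∃ k, f.1 (.inl ⟨t, k⟩) ≠ τ ⟨t, k⟩} hex
    obtain ⟨k, hk, hmax⟩ := WellFounded.has_min (wellFounded_gt (α := Fin (m t)))
      {k | f.1 (.inl ⟨t, k⟩) ≠ τ ⟨t, k⟩} ⟨k₀, hk₀⟩
    have hlt : τ ⟨t, k⟩ < f.1 (.inl ⟨t, k⟩) := lt_of_le_of_ne (hf _) (Ne.symm hk)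
    obtain ⟨a, ha⟩ : ∃ a, f.1 (.inl ⟨t, k⟩) = a + 1 := ⟨f.1 (.inl ⟨t, k⟩) - 1, by ring⟩
    have o : Occ (t : ℕ) (a + 1) f.1 := ⟨.inl ⟨t, k⟩, rfl, ha⟩
    have n : ¬ Occ (t : ℕ) a f.1 := by
      rw [occ_lt_iff]
      rintro ⟨k', hk'⟩
      rcases lt_trichotomy k' k with h | rfl | h
      · have := f.2.1 t h
        simp only at this
        omega
      · omega
      · have h1 : f.1 (.inl ⟨t, k'⟩) = τ ⟨t, k'⟩ := by
          by_contra hne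
          exact hmax k' hne h
        have h2 := hτ t h
        simp only at h2
        omega
    have hl := (isLabel_repl_iff (abs_sub_succ a) f.2 o).mpr n
    have hup : repl (t : ℕ) (a + 1) a f.1 = Function.update f.1 (.inl ⟨t, k⟩) a :=
      repl_eq_update rfl ha
    have hother : ∀ p, p ≠ ⟨t, k⟩ → repl (t : ℕ) (a + 1) a f.1 (.inl p) = f.1 (.inl p) := by
      intro p hp
      rw [hup, Function.update_of_ne fun e => hp (Sum.inl_injective e)]
    have hself : repl (t : ℕ) (a + 1) a f.1 (.inl ⟨t, k⟩) = a := by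
      rw [hup, Function.update_self]
    refine Reached.step (h := ⟨_, hl⟩) t.2 (ih _ ?_ ⟨_, hl⟩ ?_ ?_ rfl) rfl o n ?_
    · refine Finset.sum_lt_sum (fun p _ => ?_) ⟨⟨t, k⟩, Finset.mem_univ _, ?_⟩
      · by_cases hp : p = ⟨t, k⟩
        · subst hp
          change (repl (t : ℕ) (a + 1) a f.1 (.inl ⟨t, k⟩) - _).toNat ≤ _
          rw [hself]
          omega
        · change (repl (t : ℕ) (a + 1) a f.1 (.inl p) - _).toNat ≤ _
          rw [hother p hp]
      · change (repl (t : ℕ) (a + 1) a f.1 (.inl ⟨t, k⟩) - _).toNat < _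
        rw [hself]
        omega
    · intro p
      change τ p ≤ repl (t : ℕ) (a + 1) a f.1 (.inl p)
      by_cases hp : p = ⟨t, k⟩
      · subst hp
        rw [hself]
        omega
      · rw [hother p hp]
        exact hf p
    · intro p x hx
      change Occ s x (repl (t : ℕ) (a + 1) a f.1)
      rw [occ_repl o (abs_sub_succ a)]
      exact Or.inr ⟨hlow p x hx, fun h' => absurd h'.1 t.2.ne'⟩
    · intro p hp
      have h1 : f.1 (.inl p) = τ p := by
        by_contra hne
        exact hmin p.1 ⟨p.2, hne⟩ hp
      have h2 := hτ' p ⟨t, k⟩ hp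
      omega

theorem reached {s : ℕ} {m : Fin s → ℕ} (f : Label .ord m) : Reached f := by
  obtain ⟨n, hn⟩ := exists_level f
  have hW : ∀ t, m t ≤ ∑ t, m t := fun t => Finset.single_le_sum (fun _ _ => Nat.zero_le _)
    (Finset.mem_univ t)
  set W := ∑ t, m t
  have hS : ∀ p, |f.1 (.inl p)| ≤ ∑ p, |f.1 (.inl p)| := fun p =>
    Finset.single_le_sum (f := fun p => |f.1 (.inl p)|) (fun _ _ => abs_nonneg _)
      (Finset.mem_univ p)
  set S := ∑ p, |f.1 (.inl p)|
  have hS0 : 0 ≤ S := Finset.sum_nonneg fun _ _ => abs_nonneg _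
  have hle : ∀ p : Σ t : Fin s, Fin (m t),
      -(n : ℤ) - S - s * W + (p.1 : ℕ) * W - (p.2 : ℕ) ≤ -n - S := by
    intro p
    have : ((p.1 : ℕ) : ℤ) * W ≤ s * W := by
      have := p.1.2
      gcongr
    have h2 : (0 : ℤ) ≤ (p.2 : ℕ) := Nat.cast_nonneg _
    omega
  -- Each finite block receives its own interval of length W ≥ m t, in increasing order of blocks.
  -- All of them lie at or below -n - S, hence below every finite entry of `f` and in the range
  -- where its last block is full.
  refine reached_of_target (τ := fun p => -(n : ℤ) - S - s * W + (p.1 : ℕ) * W - (p.2 : ℕ))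
    (fun t k k' h => ?_) (fun p r h => ?_) f (fun p => ?_) (fun p x hx => ?_)
  · have : (k : ℕ) < k' := h
    change -(n : ℤ) - S - s * W + (t : ℕ) * W - (k' : ℕ) < -n - S - s * W + (t : ℕ) * W - (k : ℕ)
    omega
  · have h1 : ((p.1 : ℕ) + 1) * W ≤ (r.1 : ℕ) * W := Nat.mul_le_mul_right _ h
    have h2 := r.2.2
    have h3 := hW r.1
    have h4 : (0 : ℤ) ≤ (p.2 : ℕ) := Nat.cast_nonneg _
    zify at h1 h2 h3
    rw [add_mul, one_mul] at h1
    omega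
  · have h1 := hle p
    have h2 := hS p
    have h3 := neg_abs_le (f.1 (.inl p))
    omega
  · have h1 := hle p
    exact occ_of_level hn (by omega)

end FockDuality

end

noncomputable section
namespace FockDuality
open Gen Filter Topology

/-! ### Uniqueness of the bar map -/

instance : RingHomCompTriple qBar qBar (RingHom.id Qq) := ⟨RingHom.ext qBar_qBar⟩

theorem gen_E_mem (a : ℤ) : UqGl.gen (E a) ∈ UqSl :=
  Algebra.subset_adjoin (Set.mem_iUnion.mpr ⟨a, by simp⟩)

theorem gen_KKinv_mem (a : ℤ) : UqGl.gen (K a) * UqGl.gen (Kinv (a + 1)) ∈ UqSl :=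
  Algebra.subset_adjoin (Set.mem_iUnion.mpr ⟨a, by simp⟩)

/-- Only K_a K_{a+1}⁻¹ is among the generators of 𝒰. Its inverse is obtained from the commutator of
E_a and F_a, so 𝒰 is stable under the bar involution. -/
theorem gen_KKinv_mem' (a : ℤ) : UqGl.gen (K (a + 1)) * UqGl.gen (Kinv a) ∈ UqSl := by
  have h := UqGl.isQuantum_gen _ _ (.E_F_same a)
  have h1 : UqGl.gen (K (a + 1)) * UqGl.gen (Kinv a) = UqGl.gen (K a) * UqGl.gen (Kinv (a + 1)) -
      (q - q⁻¹) • (UqGl.gen (E a) * UqGl.gen (F a) - UqGl.gen (F a) * UqGl.gen (E a)) := by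
    rw [h, smul_smul, mul_inv_cancel₀ q_sub_inv_ne_zero, one_smul, sub_sub_cancel]
  rw [h1]
  exact sub_mem (gen_KKinv_mem a) (Subalgebra.smul_mem _ (sub_mem
    (mul_mem (gen_E_mem a) (gen_F_mem a)) (mul_mem (gen_F_mem a) (gen_E_mem a))) _)

theorem barU_mem_and_barU_barU {X : UqGl} (hX : X ∈ UqSl) : barU X ∈ UqSl ∧ barU (barU X) = X := by
  induction hX using Algebra.adjoin_induction with
  | mem X hX =>
    simp only [Set.mem_iUnion, Set.mem_insert_iff, Set.mem_singleton_iff] at hX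
    obtain ⟨a, rfl | rfl | rfl⟩ := hX
    · simp only [barU_gen, barGen]
      exact ⟨gen_E_mem a, trivial⟩
    · simp only [barU_gen, barGen]
      exact ⟨gen_F_mem a, trivial⟩
    · simp only [map_mul, barU_gen, barGen]
      refine ⟨?_, trivial⟩
      rw [← (UqGl.isQuantum_gen.commute_K_Kinv (a + 1) a).eq]
      exact gen_KKinv_mem' a
  | algebraMap r =>
    rw [barU_algebraMap, barU_algebraMap, qBar_qBar]
    exact ⟨Subalgebra.algebraMap_mem _ _, rfl⟩
  | add X Y _ _ hX hY =>
    rw [map_add, map_add, hX.2, hY.2]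
    exact ⟨add_mem hX.1 hY.1, rfl⟩
  | mul X Y _ _ hX hY =>
    rw [map_mul, map_mul, hX.2, hY.2]
    exact ⟨mul_mem hX.1 hY.1, rfl⟩

/-- A unitriangular operator commuting with `𝒰` and fixing the monomials of seeds is the identity. -/
theorem eq_id_of_equivariant {s : ℕ} {m : Fin s → ℕ} (θ : Module.End Qq (fockSpace .ord m))
    (hloc : IsLocal θ) (heq : ∀ X ∈ UqSl, ∀ u, θ (fockRep .ord m X u) = fockRep .ord m X (θ u))
    (hseed : ∀ f : Label .ord m, IsSeed f.1 → θ (monomial f) = monomial f)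
    (hdiag : ∀ f, (θ (monomial f)).1 f = 1)
    (hbelow : ∀ f g, (θ (monomial f)).1 g ≠ 0 → DLe g f) : θ = LinearMap.id := by
  classical
  refine ext_of_isLocal hloc (fun n => ⟨n, fun u hu g hg => hu g hg⟩) fun f => fock_ext fun g => ?_
  change _ = (monomial f).1 g
  -- Induction on the size of the interval between `g` and `f`, with `g` fixed.
  induction hN : ((Up g).filter fun h => DLe h f).card using Nat.strong_induction_on
    generalizing f with
  | _ N ih =>
    subst hN
    by_cases hgf : g = f
    · rw [hgf, hdiag, monomial_apply_self]
    rw [monomial_apply_ne hgf]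
    by_contra hne
    have hle := hbelow f g hne
    have ih' : ∀ h, DLe h f → h ≠ f → (θ (monomial h)).1 g = if g = h then 1 else 0 := by
      intro h hh hhf
      rw [← monomial_apply]
      refine ih _ (Finset.card_lt_card ?_) h rfl
      refine ⟨fun k hk => ?_, fun hsub => ?_⟩
      · rw [Finset.mem_filter] at hk ⊢
        exact ⟨hk.1, hk.2.trans hh⟩
      · have := hsub (Finset.mem_filter.mpr ⟨mem_Up.mpr hle, DLe.refl f⟩)
        rw [Finset.mem_filter] at this
        exact hhf (hh.antisymm this.2)
    -- The element u with leading label `f` is fixed by `θ`. In its coefficient at `g`, induction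
    -- leaves only the terms of `f` and `g`, so u_g = u_f θ_{g,f} + u_g with u_f ≠ 0.
    obtain ⟨X, hX, f₀, h0, hL⟩ := reached f
    set u := fockRep .ord m X (monomial f₀) with hu
    have h1 : θ u = u := by rw [hu, heq X hX, hseed f₀ h0]
    obtain ⟨S, hS, hsum⟩ := apply_eq_sum_of_isLocal θ hloc u g
    have h2 := hsum (insert f (insert g S))
      ((Finset.subset_insert _ _).trans (Finset.subset_insert _ _))
    rw [h1, ← Finset.add_sum_erase _ _ (Finset.mem_insert_self _ _), Finset.sum_eq_single g] at h2
    · rw [ih' g hle hgf, if_pos rfl, mul_one] at h2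
      simp only [RingHom.id_apply] at h2
      rw [right_eq_add, mul_eq_zero] at h2
      exact h2.elim hL.1 hne
    · intro h hh hhg
      by_cases huh : u.1 h = 0
      · rw [huh, map_zero, zero_mul]
      · rw [ih' h (hL.2 h huh) (Finset.ne_of_mem_erase hh), if_neg (Ne.symm hhg), mul_zero]
    · intro h
      exact absurd (Finset.mem_erase.mpr ⟨hgf, by simp⟩) h

/-- Equivariant anti-linear maps which are unitriangular and fix the monomials of seeds. -/
structure IsTriBar {s : ℕ} {m : Fin s → ℕ} (φ : fockSpace .ord m →ₛₗ[qBar] fockSpace .ord m) :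
    Prop where
  isLocal : IsLocal φ
  equivariant : ∀ X ∈ UqSl, ∀ u, φ (fockRep .ord m X u) = fockRep .ord m (barU X) (φ u)
  seed : ∀ f : Label .ord m, IsSeed f.1 → φ (monomial f) = monomial f
  diag : ∀ f, (φ (monomial f)).1 f = 1
  below : ∀ f g, (φ (monomial f)).1 g ≠ 0 → DLe g f

/-- The composite of two anti-linear maps is linear and commutes with 𝒰, so `eq_id_of_equivariant`
applies. With φ = ψ this is involutivity, and with different maps it gives uniqueness. -/
theorem IsTriBar.comp_apply {s : ℕ} {m : Fin s → ℕ}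
    {φ ψ : fockSpace .ord m →ₛₗ[qBar] fockSpace .ord m} (hφ : IsTriBar φ) (hψ : IsTriBar ψ)
    (u : fockSpace .ord m) : φ (ψ u) = u := by
  classical
  refine LinearMap.congr_fun (eq_id_of_equivariant (φ.comp ψ : Module.End Qq (fockSpace .ord m))
    (isLocal_comp (X := φ) (Y := ψ) hφ.isLocal hψ.isLocal) (fun X hX u => ?_) (fun f hf => ?_) (fun f => ?_)
    (fun f g h => ?_)) u
  · have h := barU_mem_and_barU_barU hX
    rw [LinearMap.comp_apply, hψ.equivariant X hX, hφ.equivariant _ h.1, h.2]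
    rfl
  · rw [LinearMap.comp_apply, hψ.seed f hf, hφ.seed f hf]
  · rw [LinearMap.comp_apply]
    obtain ⟨S, hS, hsum⟩ := apply_eq_sum_of_isLocal φ hφ.isLocal (ψ (monomial f)) f
    rw [hsum (insert f S) (Finset.subset_insert _ _), Finset.sum_eq_single f]
    · rw [hψ.diag, hφ.diag, map_one, one_mul]
    · intro h _ hne
      by_contra h0
      have h1 : (ψ (monomial f)).1 h ≠ 0 := fun e => left_ne_zero_of_mul h0 (by rw [e, map_zero])
      exact hne ((hψ.below f h h1).antisymm (hφ.below h f (right_ne_zero_of_mul h0)))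
    · intro h
      exact absurd (Finset.mem_insert_self _ _) h
  · rw [LinearMap.comp_apply] at h
    obtain ⟨S, hS, hsum⟩ := apply_eq_sum_of_isLocal φ hφ.isLocal (ψ (monomial f)) g
    rw [hsum S subset_rfl] at h
    obtain ⟨k, hk, h0⟩ := Finset.exists_ne_zero_of_sum_ne_zero h
    exact (hφ.below k g (right_ne_zero_of_mul h0)).trans (hψ.below f k (hS k hk))

theorem IsTriBar.unique {s : ℕ} {m : Fin s → ℕ}
    {φ ψ : fockSpace .ord m →ₛₗ[qBar] fockSpace .ord m} (hφ : IsTriBar φ) (hψ : IsTriBar ψ) :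
    φ = ψ := LinearMap.ext fun u => by
  rw [← hψ.comp_apply hψ u, hφ.comp_apply hψ, hψ.comp_apply hψ]

theorem eq_monomial_of_minimal {s : ℕ} {κ : Kind} {m : Fin s → ℕ} {u : fockSpace κ m}
    {f : Label κ m} (h1 : u.1 f = 1) (h2 : ∀ g, u.1 g ≠ 0 → g = f) : u = monomial f := by
  refine fock_ext fun g => ?_
  by_cases h : g = f
  · rw [h, h1, monomial_apply_self]
  · rw [monomial_apply_ne h]
    by_contra h0
    exact h (h2 g h0)

theorem isTriBar_barMap {s : ℕ} {m : Fin s → ℕ} : IsTriBar (barMap m) where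
  isLocal := isLocal_barMap
  equivariant X hX u := barMap_equivariant X hX u
  seed f hf := eq_monomial_of_minimal (barMap_monomial_self f) fun _ hg =>
    hf.eq_of_dle (barMap_below hg).dle
  diag := barMap_monomial_self
  below _ _ h := (barMap_below h).dle

theorem barMap_barMap {s : ℕ} {m : Fin s → ℕ} (u : fockSpace .ord m) :
    barMap m (barMap m u) = u := isTriBar_barMap.comp_apply isTriBar_barMap u

/-! ### Bar invariant elements -/

theorem barMap_apply {s : ℕ} {m : Fin s → ℕ} (u : fockSpace .ord m) (g : Label .ord m) :
    (barMap m u).1 g = ∑ h ∈ Up g, qBar (u.1 h) * (barMap m (monomial h)).1 g := by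
  classical
  obtain ⟨S, hS, hsum⟩ := apply_eq_sum_of_isLocal (barMap m) isLocal_barMap u g
  rw [hsum (S ∪ Up g) Finset.subset_union_left]
  refine (Finset.sum_subset Finset.subset_union_right fun h _ hh => ?_).symm
  by_contra h0
  exact hh (mem_Up.mpr (barMap_below (right_ne_zero_of_mul h0)).dle)

open Classical in
theorem barMap_apply' {s : ℕ} {m : Fin s → ℕ} (u : fockSpace .ord m) (g : Label .ord m) :
    (barMap m u).1 g = qBar (u.1 g) +
      ∑ h ∈ (Up g).erase g, qBar (u.1 h) * (barMap m (monomial h)).1 g := by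
  rw [barMap_apply, ← Finset.add_sum_erase _ _ (mem_Up.mpr (DLe.refl g)), barMap_monomial_self,
    mul_one]

/-- Once the coefficients at all larger labels vanish, unitriangularity makes the coefficient at `g`
bar-invariant, and `P` contains no nonzero invariant element. -/
theorem eq_zero_of_barMap_eq {s : ℕ} {m : Fin s → ℕ} {P : Set Qq} (hP : IsHalf P)
    {w : fockSpace .ord m} (h1 : barMap m w = w) (h2 : ∀ g, w.1 g ∈ P) : w = 0 := by
  classical
  refine fock_ext fun g => ?_
  change w.1 g = 0
  induction g using up_induction with
  | h g ih =>
    refine hP.eq_zero _ (h2 g) ?_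
    have h3 := barMap_apply' w g
    rw [h1, Finset.sum_eq_zero, add_zero] at h3
    · exact h3.symm
    · intro h hh
      rw [Finset.mem_erase, mem_Up] at hh
      rw [ih h hh.2 hh.1, map_zero, zero_mul]

open Classical in
/-- The coefficients of the canonical bases. -/
def klCoeff {s : ℕ} {m : Fin s → ℕ} (P : Set Qq) (f g : Label .ord m) : Qq :=
  if g = f then 1 else
    -- Bar invariance at `g` prescribes x - x̄ in terms of the finitely many coefficients above `g`.
    -- For a half `P` a solution always exists, by `klCoeff_spec`, so the value 0 is not a genuine
    -- default.
    if hx : ∃ x ∈ P, x - qBar x = ∑ h ∈ ((Up g).erase g).attach,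
        qBar (klCoeff P f h.1) * (barMap m (monomial h.1)).1 g then hx.choose else 0
termination_by (Up g).card
decreasing_by
  have h2 := Finset.mem_erase.mp h.2
  exact card_Up_lt (mem_Up.mp h2.2) h2.1

theorem klCoeff_self {s : ℕ} {m : Fin s → ℕ} (P : Set Qq) (f : Label .ord m) :
    klCoeff P f f = 1 := by
  rw [klCoeff, if_pos rfl]

open Classical in
theorem klCoeff_of_ne {s : ℕ} {m : Fin s → ℕ} {P : Set Qq} {f g : Label .ord m} (h : g ≠ f)
    (hx : ∃ x ∈ P, x - qBar x = ∑ h ∈ (Up g).erase g,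
      qBar (klCoeff P f h) * (barMap m (monomial h)).1 g) :
    klCoeff P f g ∈ P ∧ klCoeff P f g - qBar (klCoeff P f g) = ∑ h ∈ (Up g).erase g,
      qBar (klCoeff P f h) * (barMap m (monomial h)).1 g := by
  rw [← Finset.sum_attach] at hx ⊢
  have : klCoeff P f g = hx.choose := by
    conv_lhs => rw [klCoeff]
    rw [if_neg h, dif_pos hx]
  rw [this]
  exact hx.choose_spec

open Classical in
-- Lusztig's recursion. All properties are proved together from larger to smaller labels, because
-- solvability at `g` needs invariance at the labels above.
theorem klCoeff_spec {s : ℕ} {m : Fin s → ℕ} {P : Set Qq} (hP : IsHalf P) (f g : Label .ord m) :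
    (g ≠ f → klCoeff P f g ∈ P) ∧ klCoeff P f g ∈ laurentInt ∧
      (klCoeff P f g ≠ 0 → BothBelow g f) ∧
      klCoeff P f g = qBar (klCoeff P f g) + ∑ h ∈ (Up g).erase g,
        qBar (klCoeff P f h) * (barMap m (monomial h)).1 g := by
  induction g using up_induction with
  | h g ih =>
    by_cases hgf : g = f
    · subst hgf
      rw [klCoeff_self, map_one]
      refine ⟨fun h => absurd rfl h, one_mem _, fun _ => BothBelow.refl g, ?_⟩
      rw [Finset.sum_eq_zero, add_zero]
      intro h hh
      rw [Finset.mem_erase, mem_Up] at hh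
      have h0 : klCoeff P g h = 0 := by
        by_contra h0
        exact hh.1 (((ih h hh.2 hh.1).2.2.1 h0).dle.antisymm hh.2)
      rw [h0, map_zero, zero_mul]
    · set S := ∑ h ∈ (Up g).erase g, qBar (klCoeff P f h) * (barMap m (monomial h)).1 g with hS
      have hlaurent : S ∈ laurentInt := sum_mem fun h hh => by
        rw [Finset.mem_erase, mem_Up] at hh
        exact mul_mem (qBar_mem_laurentInt (ih h hh.2 hh.1).2.1) (barMap_laurent h g)
      -- Let v collect the terms already known above `g`. Its bar image agrees with v above `g` and
      -- has coefficient S at `g`. Applying the bar map again returns v, whose coefficient at `g` is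
      -- 0, hence 0 = S̄ + S.
      have hskew : qBar S = -S := by
        let v : fockSpace .ord m := ∑ h ∈ (Up g).erase g, klCoeff P f h • monomial h
        have hv : ∀ k, v.1 k = if k ∈ (Up g).erase g then klCoeff P f k else 0 := by
          intro k
          have h3 : ∀ h ∈ (Up g).erase g, (klCoeff P f h • monomial h).1 k =
              if h = k then klCoeff P f k else 0 := by
            intro h _
            change klCoeff P f h * (monomial h).1 k = _
            by_cases e : h = k
            · subst e; rw [monomial_apply_self, if_pos rfl, mul_one]
            · rw [monomial_apply_ne (Ne.symm e), if_neg e, mul_zero]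
          rw [sum_apply, Finset.sum_congr rfl h3, Finset.sum_ite_eq']
        have hvg : v.1 g = 0 := by rw [hv, if_neg (by simp)]
        have e1 : (barMap m v).1 g = S := by
          rw [barMap_apply', hvg, map_zero, zero_add]
          exact Finset.sum_congr rfl fun h hh => by rw [hv, if_pos hh]
        have e2 : ∀ h ∈ (Up g).erase g, (barMap m v).1 h = klCoeff P f h := by
          intro h hh
          have hh' := Finset.mem_erase.mp hh
          rw [mem_Up] at hh'
          rw [barMap_apply', hv, if_pos hh]
          refine Eq.trans ?_ (ih h hh'.2 hh'.1).2.2.2.symm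
          refine congrArg (qBar (klCoeff P f h) + ·) (Finset.sum_congr rfl fun k hk => ?_)
          rw [Finset.mem_erase, mem_Up] at hk
          rw [hv, if_pos]
          refine Finset.mem_erase.mpr ⟨?_, mem_Up.mpr (hh'.2.trans hk.2)⟩
          rintro rfl
          exact hh'.1 (hk.2.antisymm hh'.2)
        have e3 := barMap_apply' (barMap m v) g
        have e4 : ∑ h ∈ (Up g).erase g, qBar ((barMap m v).1 h) * (barMap m (monomial h)).1 g = S :=
          Finset.sum_congr rfl fun h hh => by rw [e2 h hh]
        rw [barMap_barMap, hvg, e1, e4] at e3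
        exact eq_neg_of_add_eq_zero_left e3.symm
      have hsol := klCoeff_of_ne hgf (hP.solve S hlaurent hskew)
      rw [← hS] at hsol
      refine ⟨fun _ => hsol.1, hP.laurent _ hsol.1, fun h0 => ?_, (sub_eq_iff_eq_add'.mp hsol.2)⟩
      -- If S were 0, the coefficient would be a bar-invariant element of `P`. A nonzero summand of
      -- S then provides a label between `g` and `f`.
      have hS0 : S ≠ 0 := by
        intro h
        rw [h, sub_eq_zero] at hsol
        exact h0 (hP.eq_zero _ hsol.1 hsol.2.symm)
      obtain ⟨h, hh, hne⟩ := Finset.exists_ne_zero_of_sum_ne_zero hS0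
      rw [Finset.mem_erase, mem_Up] at hh
      refine (barMap_below (right_ne_zero_of_mul hne)).trans ((ih h hh.2 hh.1).2.2.1 ?_)
      exact fun e => left_ne_zero_of_mul hne (by rw [e, map_zero])

/-- The elements of the canonical bases. -/
def klBasis {s : ℕ} {m : Fin s → ℕ} {P : Set Qq} (hP : IsHalf P) (f : Label .ord m) :
    fockSpace .ord m :=
  ⟨klCoeff P f, fun n => (finite_down n f).subset fun g hg =>
    ⟨hg.2, ((klCoeff_spec hP f g).2.2.1 hg.1).dle⟩⟩

theorem klBasis_apply {s : ℕ} {m : Fin s → ℕ} {P : Set Qq} (hP : IsHalf P) (f g : Label .ord m) :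
    (klBasis hP f).1 g = klCoeff P f g := rfl

theorem klBasis_sub_apply {s : ℕ} {m : Fin s → ℕ} {P : Set Qq} (hP : IsHalf P)
    (f g : Label .ord m) : (klBasis hP f - monomial f).1 g ∈ P ∧
      (klBasis hP f - monomial f).1 g ∈ laurentInt ∧
      ((klBasis hP f - monomial f).1 g ≠ 0 → BothBelow g f ∧ g ≠ f) := by
  change (klCoeff P f g - (monomial f).1 g) ∈ P ∧ (klCoeff P f g - (monomial f).1 g) ∈ _ ∧
    (klCoeff P f g - (monomial f).1 g ≠ 0 → _)
  by_cases h : g = f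
  · subst h
    rw [klCoeff_self, monomial_apply_self, sub_self]
    exact ⟨hP.zero_mem, zero_mem _, fun h => absurd rfl h⟩
  · rw [monomial_apply_ne h, sub_zero]
    have hs := klCoeff_spec hP f g
    exact ⟨hs.1 h, hs.2.1, fun h0 => ⟨hs.2.2.1 h0, h⟩⟩

theorem barMap_klBasis {s : ℕ} {m : Fin s → ℕ} {P : Set Qq} (hP : IsHalf P) (f : Label .ord m) :
    barMap m (klBasis hP f) = klBasis hP f := fock_ext fun g => by
  classical
  rw [barMap_apply', klBasis_apply]
  exact (klCoeff_spec hP f g).2.2.2.symm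

/-! ### Topological bases -/

/-- Membership of the coefficients in the completion matters here: on level n only finitely many
summands can contribute, because larger labels inherit the level. -/
theorem hasSum_fock {s : ℕ} {m : Fin s → ℕ} {B : Label .ord m → fockSpace .ord m}
    (hB : ∀ f g, (B f).1 g ≠ 0 → DLe g f) {a : Label .ord m → Qq} (ha : a ∈ fockSpace .ord m)
    {u : fockSpace .ord m} (hu : ∀ g, ∑ f ∈ Up g, a f * (B f).1 g = u.1 g) :
    HasSum (fun f => a f • B f) u := by
  classical
  refine tendsto_fock_iff.mpr fun n => ?_
  filter_upwards [eventually_ge_atTop (ha n).toFinset] with S hS g hg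
  rw [sum_apply, ← hu g]
  change ∑ f ∈ S, a f * (B f).1 g = _
  refine (Finset.sum_subset (Finset.subset_union_left (s₂ := Up g)) fun f _ hf => ?_).trans
    (Finset.sum_subset Finset.subset_union_right fun f _ hf => ?_).symm
  · by_contra h0
    refine hf (hS ((Set.Finite.mem_toFinset _).mpr ⟨left_ne_zero_of_mul h0, ?_⟩))
    exact (hB f g (right_ne_zero_of_mul h0)).level hg
  · by_contra h0
    exact hf (mem_Up.mpr (hB f g (right_ne_zero_of_mul h0)))

theorem sum_of_hasSum {s : ℕ} {m : Fin s → ℕ} {B : Label .ord m → fockSpace .ord m}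
    (hB : ∀ f g, (B f).1 g ≠ 0 → DLe g f) {a : Label .ord m → Qq}
    {u : fockSpace .ord m} (h : HasSum (fun f => a f • B f) u) (g : Label .ord m) :
    ∑ f ∈ Up g, a f * (B f).1 g = u.1 g := by
  classical
  obtain ⟨n, hn⟩ := exists_level g
  obtain ⟨S, hS, h1⟩ := ((tendsto_fock_iff.mp h n).and (eventually_ge_atTop (Up g))).exists
  rw [← hS g hn, sum_apply]
  refine Finset.sum_subset h1 fun f _ hf => ?_
  by_contra h0
  exact hf (mem_Up.mpr (hB f g (right_ne_zero_of_mul h0)))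

open Classical in
/-- The coordinates of `u` with respect to the unitriangular family `B`. -/
def coordOf {s : ℕ} {m : Fin s → ℕ} (B : Label .ord m → fockSpace .ord m) (u : fockSpace .ord m)
    (g : Label .ord m) : Qq :=
  u.1 g - ∑ h ∈ ((Up g).erase g).attach, coordOf B u h.1 * (B h.1).1 g
termination_by (Up g).card
decreasing_by
  have h2 := Finset.mem_erase.mp h.2
  exact card_Up_lt (mem_Up.mp h2.2) h2.1

open Classical in
theorem coordOf_eq {s : ℕ} {m : Fin s → ℕ} (B : Label .ord m → fockSpace .ord m)
    (u : fockSpace .ord m) (g : Label .ord m) :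
    coordOf B u g = u.1 g - ∑ h ∈ (Up g).erase g, coordOf B u h * (B h).1 g := by
  rw [coordOf, Finset.sum_attach _ fun h => coordOf B u h * (B h).1 g]

/-- A unitriangular family is a topological basis. -/
theorem existsUnique_hasSum {s : ℕ} {m : Fin s → ℕ} {B : Label .ord m → fockSpace .ord m}
    (h1 : ∀ f, (B f).1 f = 1) (h2 : ∀ f g, (B f).1 g ≠ 0 → DLe g f) (u : fockSpace .ord m) :
    ∃! a : Label .ord m → Qq, HasSum (fun f => a f • B f) u := by
  classical
  refine ⟨coordOf B u, ?_, fun a ha => ?_⟩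
  · refine hasSum_fock h2 (fun n => ?_) fun g => ?_
    · refine ((u.2 n).biUnion fun f _ => finite_down n f).subset ?_
      rintro g ⟨hg, hn⟩
      -- Coordinates are nonzero only below the support of `u`, so the coordinate vector lies in the
      -- completion.
      have key : ∀ g, coordOf B u g ≠ 0 → ∃ f, DLe g f ∧ u.1 f ≠ 0 := by
        intro g
        induction g using up_induction with
        | h g ih =>
          intro hg
          by_cases hu : u.1 g = 0
          · rw [coordOf_eq, hu, zero_sub, neg_ne_zero] at hg
            obtain ⟨h, hh, hne⟩ := Finset.exists_ne_zero_of_sum_ne_zero hg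
            rw [Finset.mem_erase, mem_Up] at hh
            obtain ⟨f, hf, hfu⟩ := ih h hh.2 hh.1 (left_ne_zero_of_mul hne)
            exact ⟨f, hh.2.trans hf, hfu⟩
          · exact ⟨g, DLe.refl g, hu⟩
      obtain ⟨f, hf, hfu⟩ := key g hg
      simp only [Set.mem_iUnion]
      exact ⟨f, ⟨hfu, hf.level hn⟩, hn, hf⟩
    · rw [← Finset.add_sum_erase _ _ (mem_Up.mpr (DLe.refl g)), h1, mul_one]
      conv_lhs => rw [coordOf_eq]
      exact sub_add_cancel _ _
  -- The coefficient of the sum at `g` is the coordinate at `g` plus terms from larger labels, so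
  -- every solution obeys the recursion of `coordOf`.
  · funext g
    induction g using up_induction with
    | h g ih =>
      have h3 := sum_of_hasSum h2 ha g
      rw [← Finset.add_sum_erase _ _ (mem_Up.mpr (DLe.refl g)), h1, mul_one] at h3
      rw [coordOf_eq, ← h3, eq_sub_iff_add_eq]
      congr 1
      refine Finset.sum_congr rfl fun h hh => ?_
      rw [Finset.mem_erase, mem_Up] at hh
      rw [ih h hh.2 hh.1]

end FockDuality

end

noncomputable section
namespace FockDuality
open Gen Filter Topology

/-! ### The isomorphism of Fock spaces -/

/-- The bijection `♮` of labels. -/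
def labelEquiv {s : ℕ} (m : Fin s → ℕ) : Label .ord m ≃ Label .sup m :=
  Equiv.ofBijective naturalLabel naturalLabel_bijective

/-- The isomorphism of Fock spaces given by the bijection `♮` of labels. -/
def fockEquiv {s : ℕ} (m : Fin s → ℕ) : fockSpace .ord m ≃ₗ[Qq] fockSpace .sup m where
  toFun u := ⟨fun g => u.1 ((labelEquiv m).symm g), fun n => by
    refine ((u.2 (n + 1)).image naturalLabel).subset ?_
    rintro g ⟨h1, h2⟩
    obtain ⟨f, rfl⟩ := (labelEquiv m).surjective g
    simp only [Equiv.symm_apply_apply] at h1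
    exact ⟨f, ⟨h1, (level_natural_iff n f).mp h2⟩, rfl⟩⟩
  invFun v := ⟨fun f => v.1 (naturalLabel f), fun n => by
    refine Set.Finite.of_finite_image (f := naturalLabel) ((v.2 n).subset ?_)
      naturalLabel_bijective.injective.injOn
    rintro _ ⟨f, ⟨h1, h2⟩, rfl⟩
    exact ⟨h1, (level_natural_iff n f).mpr (h2.mono (Nat.le_succ n))⟩⟩
  map_add' _ _ := rfl
  map_smul' _ _ := rfl
  left_inv u := fock_ext fun f => congrArg u.1 ((labelEquiv m).symm_apply_apply f)
  right_inv v := fock_ext fun g => congrArg v.1 ((labelEquiv m).apply_symm_apply g)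

theorem fockEquiv_symm_apply {s : ℕ} {m : Fin s → ℕ} (v : fockSpace .sup m) (f : Label .ord m) :
    ((fockEquiv m).symm v).1 f = v.1 (naturalLabel f) := rfl

theorem fockEquiv_apply {s : ℕ} {m : Fin s → ℕ} (u : fockSpace .ord m) (f : Label .ord m) :
    (fockEquiv m u).1 (naturalLabel f) = u.1 f :=
  congrArg u.1 ((labelEquiv m).symm_apply_apply f)

theorem sup_ext {s : ℕ} {m : Fin s → ℕ} {u v : fockSpace .sup m}
    (h : ∀ f, u.1 (naturalLabel f) = v.1 (naturalLabel f)) : u = v := fock_ext fun g => by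
  obtain ⟨f, rfl⟩ := naturalLabel_bijective.surjective g
  exact h f

theorem fockEquiv_monomial {s : ℕ} {m : Fin s → ℕ} (f : Label .ord m) :
    fockEquiv m (monomial f) = monomial (naturalLabel f) := sup_ext fun g => by
  classical
  rw [fockEquiv_apply, monomial_apply, monomial_apply]
  exact if_congr naturalLabel_bijective.injective.eq_iff.symm rfl rfl

theorem isLocal_fockEquiv {s : ℕ} {m : Fin s → ℕ} : IsLocal (fockEquiv m) := by
  intro n
  refine ⟨n + 1, fun u hu g hg => ?_⟩
  obtain ⟨f, rfl⟩ := naturalLabel_bijective.surjective g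
  rw [fockEquiv_apply]
  exact hu f ((level_natural_iff n f).mp hg)

theorem isLocal_fockEquiv_symm {s : ℕ} {m : Fin s → ℕ} : IsLocal (fockEquiv m).symm := by
  intro n
  refine ⟨n, fun v hv f hf => ?_⟩
  rw [fockEquiv_symm_apply]
  exact hv _ ((level_natural_iff n f).mpr (hf.mono (Nat.le_succ n)))

theorem continuous_fockEquiv {s : ℕ} {m : Fin s → ℕ} : Continuous (fockEquiv m) :=
  (continuous_iff_isLocal (map_sub _)).mpr isLocal_fockEquiv

theorem continuous_fockEquiv_symm {s : ℕ} {m : Fin s → ℕ} : Continuous (fockEquiv m).symm :=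
  (continuous_iff_isLocal (map_sub _)).mpr isLocal_fockEquiv_symm

/-- The operators `X` and `Y` correspond to each other under the isomorphism. -/
def Corr {s : ℕ} {m : Fin s → ℕ} (X : Module.End Qq (fockSpace .ord m))
    (Y : Module.End Qq (fockSpace .sup m)) : Prop :=
  ∀ u, fockEquiv m (X u) = Y (fockEquiv m u)

theorem Corr.mul {s : ℕ} {m : Fin s → ℕ} {X X' : Module.End Qq (fockSpace .ord m)}
    {Y Y' : Module.End Qq (fockSpace .sup m)} (h : Corr X Y) (h' : Corr X' Y') :
    Corr (X * X') (Y * Y') := fun u => by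
  rw [Module.End.mul_apply, Module.End.mul_apply, h, h']

theorem Corr.add {s : ℕ} {m : Fin s → ℕ} {X X' : Module.End Qq (fockSpace .ord m)}
    {Y Y' : Module.End Qq (fockSpace .sup m)} (h : Corr X Y) (h' : Corr X' Y') :
    Corr (X + X') (Y + Y') := fun u => by
  rw [LinearMap.add_apply, LinearMap.add_apply, map_add, h, h']

theorem corr_hop {s : ℕ} {m : Fin s → ℕ} {t : ℕ} {a b a' b' : ℤ} (hab : |a - b| = 1)
    (hab' : |a' - b'| = 1)
    (h : ∀ g : Label .ord m, (Occ t b g.1 ∧ ¬ Occ t a g.1) ↔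
      (Occ t b' (naturalLabel g).1 ∧ ¬ Occ t a' (naturalLabel g).1))
    (h' : ∀ g g' : Label .ord m, g'.1 = repl t b a g.1 → Occ t b g.1 → ¬ Occ t a g.1 →
      ∀ u x, Occ u x (naturalLabel g').1 ↔ Occ u x (repl t b' a' (naturalLabel g).1)) :
    Corr (hop .ord m t a b) (hop .sup m t a' b') := fun c => sup_ext fun g => by
  rw [fockEquiv_apply]
  rcases hop_cases (κ := .ord) (m := m) (t := t) hab g with ⟨g1, e1, o1, n1, h1⟩ | ⟨n1, h1⟩ <;>
  rcases hop_cases (κ := .sup) (m := m) (t := t) hab' (naturalLabel g) with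
    ⟨g2, e2, o2, n2, h2⟩ | ⟨n2, h2⟩ <;> rw [h1, h2]
  · have : g2 = naturalLabel g1 := label_ext fun u x => by
      rw [e2, h' g g1 e1 o1 n1]
    rw [this, fockEquiv_apply]
  · have := (h g).mp ⟨o1, n1⟩
    exact absurd (n2 this.1) this.2
  · have := (h g).mpr ⟨o2, n2⟩
    exact absurd (n1 this.1) this.2

theorem corr_hop_of_ne {s : ℕ} {m : Fin s → ℕ} {t : ℕ} (ht : t ≠ s) {a b : ℤ}
    (hab : |a - b| = 1) : Corr (hop .ord m t a b) (hop .sup m t a b) := by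
  refine corr_hop hab hab (fun g => ?_) fun g g' e o n u x => ?_
  · rw [occ_natural_of_lt g ht, occ_natural_of_lt g ht]
  · rw [occ_repl ((occ_natural_of_lt g ht b).mpr o) hab]
    by_cases hu : u = s
    · subst hu
      rw [occ_natural_last, occ_natural_last, e, occ_repl o hab]
      simp [Ne.symm ht]
    · rw [occ_natural_of_lt _ hu, occ_natural_of_lt _ hu, e, occ_repl o hab]

/-- When an entry moves from `a` to `b`, the missing value moves from `b` to `a`. This matches the
exchanged roles of E and F on `𝕍` and `𝕎`. -/
theorem corr_hop_last {s : ℕ} {m : Fin s → ℕ} {a b : ℤ}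
    (hab : |a - b| = 1) : Corr (hop .ord m s a b) (hop .sup m s b a) := by
  have hba : |b - a| = 1 := by rwa [abs_sub_comm]
  have hne : a ≠ b := by rintro rfl; simp at hab
  refine corr_hop hab hba (fun g => ?_) fun g g' e o n u x => ?_
  · rw [occ_natural_last, occ_natural_last]
    tauto
  · rw [occ_repl ((occ_natural_last g a).mpr n) hba]
    by_cases hu : u = s
    · subst hu
      rw [occ_natural_last, occ_natural_last, e, occ_repl o hab]
      by_cases h1 : x = a
      · subst h1; simp [hne]
      · by_cases h2 : x = b
        · subst h2; simp [Ne.symm hne]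
        · simp [h1, h2]
    · rw [occ_natural_of_lt _ hu, occ_natural_of_lt _ hu, e, occ_repl o hab]
      simp [hu]

theorem corr_diag {s : ℕ} {m : Fin s → ℕ} {w : Label .ord m → Qq} {w' : Label .sup m → Qq}
    (h : ∀ f, w f = w' (naturalLabel f)) : Corr (diag w) (diag w') := fun u => sup_ext fun f => by
  rw [fockEquiv_apply]
  change w f * u.1 f = w' _ * (fockEquiv m u).1 _
  rw [h, fockEquiv_apply]

/-- The families `D` and `D'` give corresponding actions of `U_q(sl_∞)`. -/
structure FamilyCorr {s : ℕ} {m : Fin s → ℕ} (D : Gen → Module.End Qq (fockSpace .ord m))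
    (D' : Gen → Module.End Qq (fockSpace .sup m)) : Prop where
  opE : ∀ a, Corr (D (E a)) (D' (E a))
  opF : ∀ a, Corr (D (F a)) (D' (F a))
  -- Only ratios correspond: on the last factor, K_a has eigenvalue q or 1 on one side and 1 or q⁻¹
  -- on the other. Both ratios are listed since the comultiplication uses one for F_a and the other
  -- for E_a.
  opK : ∀ a, Corr (D (K a) * D (Kinv (a + 1))) (D' (K a) * D' (Kinv (a + 1)))
  opK' : ∀ a, Corr (D (K (a + 1)) * D (Kinv a)) (D' (K (a + 1)) * D' (Kinv a))

theorem tensorFamily_mul {B : Type} [Ring B] {D₁ D₂ : Gen → B} (hc : ∀ x y, Commute (D₁ x) (D₂ y))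
    (a b : ℤ) : tensorFamily D₁ D₂ (K a) * tensorFamily D₁ D₂ (Kinv b) =
      (D₁ (K a) * D₁ (Kinv b)) * (D₂ (K a) * D₂ (Kinv b)) :=
  mul_pair (hc (Kinv b) (K a)).symm

theorem FamilyCorr.tensor {s : ℕ} {m : Fin s → ℕ}
    {D₁ D₂ : Gen → Module.End Qq (fockSpace .ord m)}
    {D₁' D₂' : Gen → Module.End Qq (fockSpace .sup m)} (h₁ : FamilyCorr D₁ D₁')
    (h₂ : FamilyCorr D₂ D₂') (hc : ∀ x y, Commute (D₁ x) (D₂ y))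
    (hc' : ∀ x y, Commute (D₁' x) (D₂' y)) :
    FamilyCorr (tensorFamily D₁ D₂) (tensorFamily D₁' D₂') where
  opE a := (h₂.opE a).add ((h₁.opE a).mul (h₂.opK' a))
  opF a := (h₁.opF a).add ((h₁.opK a).mul (h₂.opF a))
  opK a := by
    have h := (h₁.opK a).mul (h₂.opK a)
    rwa [← tensorFamily_mul (D₁ := D₁) (D₂ := D₂) hc,
      ← tensorFamily_mul (D₁ := D₁') (D₂ := D₂') hc'] at h
  opK' a := by
    have h := (h₁.opK' a).mul (h₂.opK' a)
    rwa [← tensorFamily_mul (D₁ := D₁) (D₂ := D₂) hc,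
      ← tensorFamily_mul (D₁ := D₁') (D₂ := D₂') hc'] at h

theorem familyCorr_counitFamily {s : ℕ} {m : Fin s → ℕ} :
    FamilyCorr (m := m) counitFamily counitFamily where
  opE _ _ := map_zero _
  opF _ _ := map_zero _
  opK _ _ := rfl
  opK' _ _ := rfl

theorem familyCorr_blockFamily {s : ℕ} {m : Fin s → ℕ} (t : ℕ) :
    FamilyCorr (blockFamily .ord m t) (blockFamily .sup m t) := by
  classical
  have hq := q_ne_zero
  by_cases ht : t = s
  · subst ht
    simp only [blockFamily, if_true]
    refine ⟨fun a => corr_hop_last (abs_succ_sub a), fun a => corr_hop_last (abs_sub_succ a),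
      fun a => ?_, fun a => ?_⟩ <;> simp only [vFamily, wFamily, diag_mul_diag] <;>
    refine corr_diag fun f => ?_ <;> simp only [occ_natural_last] <;> split_ifs <;>
    first
      | contradiction
      | simp [hq]
  · simp only [blockFamily, if_neg ht]
    refine ⟨fun a => corr_hop_of_ne ht (abs_succ_sub a),
      fun a => corr_hop_of_ne ht (abs_sub_succ a), fun a => ?_, fun a => ?_⟩ <;>
    simp only [vFamily, diag_mul_diag] <;>
    refine corr_diag fun f => ?_ <;> simp only [occ_natural_of_lt f ht]

theorem familyCorr_fockFamily {s : ℕ} {m : Fin s → ℕ} (k : ℕ) :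
    FamilyCorr (fockFamily .ord m k) (fockFamily .sup m k) := by
  induction k with
  | zero => exact familyCorr_counitFamily
  | succ k ih =>
    exact ih.tensor (familyCorr_blockFamily k) (fockFamily_comm .ord m k k le_rfl)
      (fockFamily_comm .sup m k k le_rfl)

theorem fockRep_gen {s : ℕ} {κ : Kind} {m : Fin s → ℕ} (x : Gen) :
    fockRep κ m (UqGl.gen x) = fockFamily κ m (s + 1) x := UqGl.lift_gen _ _ _

theorem fockEquiv_fockRep {s : ℕ} {m : Fin s → ℕ} {X : UqGl} (hX : X ∈ UqSl)
    (u : fockSpace .ord m) :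
    fockEquiv m (fockRep .ord m X u) = fockRep .sup m X (fockEquiv m u) := by
  have h := familyCorr_fockFamily (m := m) (s + 1)
  induction hX using Algebra.adjoin_induction generalizing u with
  | mem X hX =>
    simp only [Set.mem_iUnion, Set.mem_insert_iff, Set.mem_singleton_iff] at hX
    obtain ⟨a, rfl | rfl | rfl⟩ := hX
    · rw [fockRep_gen, fockRep_gen]; exact h.opE a u
    · rw [fockRep_gen, fockRep_gen]; exact h.opF a u
    · rw [map_mul, map_mul, fockRep_gen, fockRep_gen, fockRep_gen, fockRep_gen]
      exact h.opK a u
  | algebraMap r =>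
    rw [AlgHom.commutes, AlgHom.commutes, Module.algebraMap_end_apply,
      Module.algebraMap_end_apply, map_smul]
  | add X Y _ _ hX hY =>
    rw [map_add, map_add, LinearMap.add_apply, LinearMap.add_apply, map_add, hX, hY]
  | mul X Y _ _ hX hY =>
    rw [map_mul, map_mul, Module.End.mul_apply, Module.End.mul_apply, hX, hY]

/-! ### The bar involutions -/

theorem sub_monomial_of {s : ℕ} {κ : Kind} {m : Fin s → ℕ} {u : fockSpace κ m} {f : Label κ m}
    {R : Label κ m → Prop} (h1 : u.1 f = 1) (h2 : ∀ g, u.1 g ∈ laurentInt)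
    (h3 : ∀ g, u.1 g ≠ 0 → R g) (g : Label κ m) : (u - monomial f).1 g ∈ laurentInt ∧
      ((u - monomial f).1 g ≠ 0 → R g ∧ g ≠ f) := by
  change u.1 g - (monomial f).1 g ∈ _ ∧ (u.1 g - (monomial f).1 g ≠ 0 → _)
  by_cases h : g = f
  · subst h
    rw [h1, monomial_apply_self, sub_self]
    exact ⟨zero_mem _, fun h => absurd rfl h⟩
  · rw [monomial_apply_ne h, sub_zero]
    exact ⟨h2 g, fun h0 => ⟨h3 g h0, h⟩⟩

theorem of_sub_monomial {s : ℕ} {κ : Kind} {m : Fin s → ℕ} {u : fockSpace κ m} {f : Label κ m}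
    {R : Label κ m → Prop} (hR : R f) (h : ∀ g, (u - monomial f).1 g ≠ 0 → R g ∧ g ≠ f) :
    u.1 f = 1 ∧ ∀ g, u.1 g ≠ 0 → R g := by
  have h' : ∀ g, u.1 g - (monomial f).1 g ≠ 0 → R g ∧ g ≠ f := h
  constructor
  · by_contra h0
    refine (h' f ?_).2 rfl
    rw [monomial_apply_self]
    exact sub_ne_zero.mpr h0
  · intro g hg
    by_cases e : g = f
    · rw [e]; exact hR
    · refine (h' g ?_).1
      rwa [monomial_apply_ne e, sub_zero]

theorem isBarInvolution_barMap {s : ℕ} {m : Fin s → ℕ} : IsBarInvolution (barMap m) where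
  continuous := (continuous_iff_isLocal (map_sub _)).mpr isLocal_barMap
  minimal f hf := eq_monomial_of_minimal (barMap_monomial_self f) fun g hg =>
    hf g (barMap_below hg).1
  equivariant X hX u := barMap_equivariant X hX u
  involutive := barMap_barMap
  triangular f g := sub_monomial_of (barMap_monomial_self f) (barMap_laurent f)
    (fun _ hg => (barMap_below hg).1) g

theorem below_refl {s : ℕ} {κ : Kind} {m : Fin s → ℕ} (f : Label κ m) : Below f f := by
  cases κ
  · exact Relation.ReflTransGen.refl
  · exact Relation.ReflTransGen.refl

theorem IsBarInvolution.isTriBar {s : ℕ} {m : Fin s → ℕ}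
    {φ : fockSpace .ord m →ₛₗ[qBar] fockSpace .ord m} (h : IsBarInvolution φ) : IsTriBar φ where
  isLocal := (continuous_iff_isLocal (map_sub _)).mp h.continuous
  equivariant := h.equivariant
  seed f hf := h.minimal f fun _ hg => hf.eq_of_dle hg.dle
  diag f := (of_sub_monomial (R := fun g => Below g f) (below_refl f) fun g => (h.triangular f g).2).1
  below f g hg := ((of_sub_monomial (R := fun g => Below g f) (below_refl f)
    fun g => (h.triangular f g).2).2 g hg).dle

/-- The bar map of `ℰ̂^{m|∞}`, transported from that of `ℰ̂^{m+∞}`. -/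
def superBarMap {s : ℕ} (m : Fin s → ℕ) : fockSpace .sup m →ₛₗ[qBar] fockSpace .sup m :=
  (fockEquiv m).toLinearMap.comp ((barMap m).comp (fockEquiv m).symm.toLinearMap)

theorem superBarMap_apply {s : ℕ} {m : Fin s → ℕ} (v : fockSpace .sup m) :
    superBarMap m v = fockEquiv m (barMap m ((fockEquiv m).symm v)) := rfl

theorem superBarMap_fockEquiv {s : ℕ} {m : Fin s → ℕ} (u : fockSpace .ord m) :
    superBarMap m (fockEquiv m u) = fockEquiv m (barMap m u) := by
  rw [superBarMap_apply, LinearEquiv.symm_apply_apply]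

theorem superBarMap_monomial {s : ℕ} {m : Fin s → ℕ} (f : Label .ord m) :
    superBarMap m (monomial (naturalLabel f)) = fockEquiv m (barMap m (monomial f)) := by
  rw [← fockEquiv_monomial, superBarMap_fockEquiv]

/-- Minimality and triangularity use the super half of `BothBelow`. Everything else is transport
along the isomorphism. -/
theorem isBarInvolution_superBarMap {s : ℕ} {m : Fin s → ℕ} :
    IsBarInvolution (superBarMap m) where
  continuous := continuous_fockEquiv.comp
    (isBarInvolution_barMap.continuous.comp continuous_fockEquiv_symm)
  minimal g hg := by
    obtain ⟨f, rfl⟩ := naturalLabel_bijective.surjective g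
    rw [superBarMap_monomial, ← fockEquiv_monomial]
    congr 1
    exact eq_monomial_of_minimal (barMap_monomial_self f) fun h hh =>
      naturalLabel_bijective.injective (hg _ (barMap_below hh).2)
  equivariant X hX v := by
    obtain ⟨u, rfl⟩ := (fockEquiv m).surjective v
    rw [← fockEquiv_fockRep hX, superBarMap_fockEquiv, superBarMap_fockEquiv,
      barMap_equivariant X hX, fockEquiv_fockRep (barU_mem_and_barU_barU hX).1]
  involutive v := by
    obtain ⟨u, rfl⟩ := (fockEquiv m).surjective v
    rw [superBarMap_fockEquiv, superBarMap_fockEquiv, barMap_barMap]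
  triangular f' g' := by
    obtain ⟨f, rfl⟩ := naturalLabel_bijective.surjective f'
    refine sub_monomial_of (R := fun g => Below g (naturalLabel f)) ?_ (fun g => ?_)
      (fun g => ?_) g'
    · rw [superBarMap_monomial, fockEquiv_apply, barMap_monomial_self]
    · obtain ⟨g, rfl⟩ := naturalLabel_bijective.surjective g
      rw [superBarMap_monomial, fockEquiv_apply]
      exact barMap_laurent f g
    · obtain ⟨g, rfl⟩ := naturalLabel_bijective.surjective g
      rw [superBarMap_monomial, fockEquiv_apply]
      exact fun h => (barMap_below h).2

/-- Transported to the type A side, a bar involution for the super ordering is triangular for `DLe`.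
It fixes the monomials of seeds, since these labels are minimal for the super ordering as well.
`IsTriBar.unique` does not depend on which ordering these facts came from. -/
theorem IsBarInvolution.eq_superBarMap {s : ℕ} {m : Fin s → ℕ}
    {φ : fockSpace .sup m →ₛₗ[qBar] fockSpace .sup m} (h : IsBarInvolution φ) :
    φ = superBarMap m := by
  have key : ∀ f : Label .ord m, (φ (monomial (naturalLabel f))).1 (naturalLabel f) = 1 ∧
      ∀ g, (φ (monomial (naturalLabel f))).1 g ≠ 0 → Below g (naturalLabel f) := fun f =>
    of_sub_monomial (below_refl _) fun g => (h.triangular _ g).2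
  let φ' : fockSpace .ord m →ₛₗ[qBar] fockSpace .ord m :=
    (fockEquiv m).symm.toLinearMap.comp (φ.comp (fockEquiv m).toLinearMap)
  have hφ' : ∀ u, φ' u = (fockEquiv m).symm (φ (fockEquiv m u)) := fun _ => rfl
  have h1 : IsTriBar φ' :=
    { isLocal := (continuous_iff_isLocal (map_sub _)).mp
        (continuous_fockEquiv_symm.comp (h.continuous.comp continuous_fockEquiv))
      equivariant := fun X hX u => by
        rw [hφ', fockEquiv_fockRep hX, h.equivariant X hX, LinearEquiv.symm_apply_eq,
          fockEquiv_fockRep (barU_mem_and_barU_barU hX).1, hφ', LinearEquiv.apply_symm_apply]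
      seed := fun f hf => by
        rw [hφ', LinearEquiv.symm_apply_eq, fockEquiv_monomial]
        refine h.minimal _ fun g hg => ?_
        obtain ⟨g, rfl⟩ := naturalLabel_bijective.surjective g
        rw [hf.eq_of_dle (Below.dle_of_natural hg)]
      diag := fun f => by
        rw [hφ', fockEquiv_symm_apply, fockEquiv_monomial]
        exact (key f).1
      below := fun f g hg => by
        rw [hφ', fockEquiv_symm_apply, fockEquiv_monomial] at hg
        exact Below.dle_of_natural ((key f).2 _ hg) }
  refine LinearMap.ext fun v => ?_
  rw [superBarMap_apply, ← h1.unique isTriBar_barMap, hφ', LinearEquiv.apply_symm_apply,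
    LinearEquiv.apply_symm_apply]

/-! ### The canonical bases -/

theorem klBasis_self {s : ℕ} {m : Fin s → ℕ} {P : Set Qq} (hP : IsHalf P) (f : Label .ord m) :
    (klBasis hP f).1 f = 1 := klCoeff_self P f

theorem klBasis_dle {s : ℕ} {m : Fin s → ℕ} {P : Set Qq} (hP : IsHalf P) (f g : Label .ord m)
    (h : (klBasis hP f).1 g ≠ 0) : DLe g f := ((klCoeff_spec hP f g).2.2.1 h).dle

theorem isCanonicalBasis_klBasis {s : ℕ} {m : Fin s → ℕ} {P : Set Qq} (hP : IsHalf P) :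
    IsCanonicalBasis (barMap m) P (klBasis hP) where
  basis := existsUnique_hasSum (klBasis_self hP) (klBasis_dle hP)
  bar := barMap_klBasis hP
  coeff f g := (klBasis_sub_apply hP f g).1
  triangular f g := ⟨(klBasis_sub_apply hP f g).2.1, fun h =>
    ⟨((klBasis_sub_apply hP f g).2.2 h).1.1, ((klBasis_sub_apply hP f g).2.2 h).2⟩⟩

/-- The difference is bar-invariant with coefficients in `P`. No triangularity is required, so this
determines both the basis elements and their transported versions. -/
theorem eq_of_barMap_eq {s : ℕ} {m : Fin s → ℕ} {P : Set Qq} (hP : IsHalf P)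
    {u v w : fockSpace .ord m} (hu : barMap m u = u) (hv : barMap m v = v)
    (hu' : ∀ g, (u - w).1 g ∈ P) (hv' : ∀ g, (v - w).1 g ∈ P) : u = v := by
  refine sub_eq_zero.mp (eq_zero_of_barMap_eq hP (by rw [map_sub, hu, hv]) fun g => ?_)
  have : (u - v).1 g = (u - w).1 g - (v - w).1 g := (sub_sub_sub_cancel_right _ _ _).symm
  rw [this]
  exact hP.sub_mem _ (hu' g) _ (hv' g)

theorem IsCanonicalBasis.eq_klBasis {s : ℕ} {m : Fin s → ℕ} {P : Set Qq} (hP : IsHalf P)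
    {B : Label .ord m → fockSpace .ord m} (hB : IsCanonicalBasis (barMap m) P B) :
    B = klBasis hP := funext fun f =>
  eq_of_barMap_eq hP (hB.bar f) (barMap_klBasis hP f) (hB.coeff f)
    (isCanonicalBasis_klBasis hP |>.coeff f)

/-- The elements of the canonical bases of `ℰ̂^{m|∞}`. -/
def superBasis {s : ℕ} {m : Fin s → ℕ} {P : Set Qq} (hP : IsHalf P) (g : Label .sup m) :
    fockSpace .sup m := fockEquiv m (klBasis hP ((labelEquiv m).symm g))

theorem superBasis_natural {s : ℕ} {m : Fin s → ℕ} {P : Set Qq} (hP : IsHalf P)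
    (f : Label .ord m) : superBasis hP (naturalLabel f) = fockEquiv m (klBasis hP f) := by
  unfold superBasis
  rw [show naturalLabel f = labelEquiv m f from rfl, Equiv.symm_apply_apply]

theorem superBasis_sub {s : ℕ} {m : Fin s → ℕ} {P : Set Qq} (hP : IsHalf P)
    (f g : Label .ord m) : (superBasis hP (naturalLabel f) - monomial (naturalLabel f)).1
      (naturalLabel g) = (klBasis hP f - monomial f).1 g := by
  rw [superBasis_natural, ← fockEquiv_monomial, ← map_sub, fockEquiv_apply]

theorem isCanonicalBasis_superBasis {s : ℕ} {m : Fin s → ℕ} {P : Set Qq} (hP : IsHalf P) :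
    IsCanonicalBasis (superBarMap m) P (superBasis hP) where
  basis v := by
    obtain ⟨u, rfl⟩ := (fockEquiv m).surjective v
    have key : ∀ a : Label .sup m → Qq, HasSum (fun g => a g • superBasis hP g) (fockEquiv m u) ↔
        HasSum (fun f => a (naturalLabel f) • klBasis hP f) u := by
      intro a
      rw [← (labelEquiv m).hasSum_iff]
      have e : (fun g => a g • superBasis hP g) ∘ labelEquiv m =
          fockEquiv m ∘ fun f => a (naturalLabel f) • klBasis hP f := funext fun f => by
        change a (naturalLabel f) • superBasis hP (naturalLabel f) = fockEquiv m (_ • _)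
        rw [superBasis_natural, map_smul]
      rw [e]
      constructor
      · intro h
        have := h.map (fockEquiv m).symm continuous_fockEquiv_symm
        rw [LinearEquiv.symm_apply_apply] at this
        convert this using 1
        funext f
        exact ((fockEquiv m).symm_apply_apply _).symm
      · exact fun h => h.map (fockEquiv m) continuous_fockEquiv
    obtain ⟨a, ha, hu⟩ := (isCanonicalBasis_klBasis hP).basis u
    refine ⟨fun g => a ((labelEquiv m).symm g), (key _).mpr ?_, fun b hb => ?_⟩
    · convert ha using 3 with f
      exact congrArg a ((labelEquiv m).symm_apply_apply f)
    · have := hu _ ((key b).mp hb)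
      funext g
      rw [← this]
      exact congrArg b ((labelEquiv m).apply_symm_apply g).symm
  bar g := by
    unfold superBasis
    rw [superBarMap_fockEquiv, barMap_klBasis]
  coeff f' g' := by
    obtain ⟨f, rfl⟩ := naturalLabel_bijective.surjective f'
    obtain ⟨g, rfl⟩ := naturalLabel_bijective.surjective g'
    rw [superBasis_sub]
    exact (klBasis_sub_apply hP f g).1
  triangular f' g' := by
    obtain ⟨f, rfl⟩ := naturalLabel_bijective.surjective f'
    obtain ⟨g, rfl⟩ := naturalLabel_bijective.surjective g'
    rw [superBasis_sub]
    refine ⟨(klBasis_sub_apply hP f g).2.1, fun h => ?_⟩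
    have h1 := (klBasis_sub_apply hP f g).2.2 h
    exact ⟨h1.1.2, fun e => h1.2 (naturalLabel_bijective.injective e)⟩

theorem IsCanonicalBasis.eq_superBasis {s : ℕ} {m : Fin s → ℕ} {P : Set Qq} (hP : IsHalf P)
    {B : Label .sup m → fockSpace .sup m} (hB : IsCanonicalBasis (superBarMap m) P B) :
    B = superBasis hP := funext fun g => by
  obtain ⟨f, rfl⟩ := naturalLabel_bijective.surjective g
  rw [superBasis_natural, ← LinearEquiv.symm_apply_eq]
  refine eq_of_barMap_eq hP (w := monomial f) ?_ (barMap_klBasis hP f) (fun g => ?_)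
    (isCanonicalBasis_klBasis hP |>.coeff f)
  · rw [LinearEquiv.eq_symm_apply]
    exact hB.bar _
  · have : (fockEquiv m).symm (B (naturalLabel f)) - monomial f =
        (fockEquiv m).symm (B (naturalLabel f) - monomial (naturalLabel f)) := by
      rw [map_sub, ← fockEquiv_monomial, LinearEquiv.symm_apply_apply]
    rw [this, fockEquiv_symm_apply]
    exact hB.coeff _ _

end FockDuality
end

/-! ### Assembly of the theorem. -/

open FockDuality in
theorem theorem4p3 {s : ℕ} (m : Fin s → ℕ) (hm : ∀ t, 0 < m t) :
    -- the bar involutions, the (dual) canonical bases and the isomorphism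
    ∃ (ψ : fockSpace .ord m →ₛₗ[qBar] fockSpace .ord m)
      (ψ' : fockSpace .sup m →ₛₗ[qBar] fockSpace .sup m)
      (𝒰 𝓛 : Label .ord m → fockSpace .ord m)
      (U L : Label .sup m → fockSpace .sup m)
      (natural : fockSpace .ord m ≃ₗ[Qq] fockSpace .sup m),
      -- they are the ones of the two completed Fock spaces, each uniquely determined
      (IsBarInvolution ψ ∧ ∀ φ, IsBarInvolution φ → φ = ψ) ∧
      (IsBarInvolution ψ' ∧ ∀ φ, IsBarInvolution φ → φ = ψ') ∧
      (IsCanonicalBasis ψ qZq 𝒰 ∧ ∀ B, IsCanonicalBasis ψ qZq B → B = 𝒰) ∧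
      (IsCanonicalBasis ψ qInvZqInv 𝓛 ∧ ∀ B, IsCanonicalBasis ψ qInvZqInv B → B = 𝓛) ∧
      (IsCanonicalBasis ψ' qZq U ∧ ∀ B, IsCanonicalBasis ψ' qZq B → B = U) ∧
      (IsCanonicalBasis ψ' qInvZqInv L ∧ ∀ B, IsCanonicalBasis ψ' qInvZqInv B → B = L) ∧
      -- `♮` is an isomorphism of topological `𝒰`-modules, and a bijection on labels
      Continuous natural ∧ Continuous natural.symm ∧
      (∀ X ∈ UqSl, ∀ u, natural (fockRep .ord m X u) = fockRep .sup m X (natural u)) ∧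
      Function.Bijective (naturalLabel (m := m)) ∧
      -- monomials go to monomials
      (∀ f, natural (monomial f) = monomial (naturalLabel f)) ∧
      -- compatibility with the bar involutions
      (∀ u, natural (ψ u) = ψ' (natural u)) ∧
      -- dual canonical bases correspond
      (∀ f, natural (𝓛 f) = L (naturalLabel f)) ∧
      -- canonical bases correspond
      (∀ f, natural (𝒰 f) = U (naturalLabel f)) ∧
      -- equality of the polynomials
      (∀ f g, klPoly 𝒰 g f = klPoly U (naturalLabel g) (naturalLabel f) ∧
        klPoly 𝓛 g f = klPoly L (naturalLabel g) (naturalLabel f)) := by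
  refine ⟨barMap m, superBarMap m, klBasis isHalf_qZq, klBasis isHalf_qInvZqInv,
    superBasis isHalf_qZq, superBasis isHalf_qInvZqInv, fockEquiv m,
    ⟨isBarInvolution_barMap, fun φ h => h.isTriBar.unique isTriBar_barMap⟩,
    ⟨isBarInvolution_superBarMap, fun φ h => h.eq_superBarMap⟩,
    ⟨isCanonicalBasis_klBasis _, fun B h => h.eq_klBasis _⟩,
    ⟨isCanonicalBasis_klBasis _, fun B h => h.eq_klBasis _⟩,
    ⟨isCanonicalBasis_superBasis _, fun B h => h.eq_superBasis _⟩,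
    ⟨isCanonicalBasis_superBasis _, fun B h => h.eq_superBasis _⟩,
    continuous_fockEquiv, continuous_fockEquiv_symm, fun X hX u => fockEquiv_fockRep hX u,
    naturalLabel_bijective, fockEquiv_monomial, fun u => (superBarMap_fockEquiv u).symm,
    fun f => (superBasis_natural _ f).symm, fun f => (superBasis_natural _ f).symm,
    fun f g => ?_⟩
  simp only [klPoly, superBasis_natural, fockEquiv_apply, and_self]
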